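/- Let $F$ be a field of characteristic not $2$, $\Gamma$ an abelian group and $\epsilon:\Gamma\times\Gamma\to F^*$ a skew-symmetric bicharacter, i.e. $\epsilon(\lambda,\mu)=\epsilon(\mu,\lambda)^{-1}$ and $\epsilon(\lambda,\mu+\nu)=\epsilon(\lambda,\mu)\epsilon(\lambda,\nu)$. Put $\Gamma_-=\{\lambda\in\Gamma:\epsilon(\lambda,\lambda)=-1\}$. Let $A=\bigoplus_{\lambda\in\Gamma}A_\lambda$ be a $\Gamma$-graded associative $F$-algebra with identity which is color-commutative: $xy=\epsilon(\lambda,\mu)yx$ for $x\in A_\lambda$, $y\in A_\mu$. A homogeneous color derivation of degree (color) $\kappa$ is an $F$-linear map $\partial:A\to A$ with $\partial(A_\lambda)\subseteq A_{\kappa+\lambda}$ and $\partial(xy)=\partial(x)y+\epsilon(\kappa,\lambda)x\partial(y)$ for $x\in A_\lambda$ and homogeneous $y$; let $\mathrm{Der}^\epsilon(A)$ be the span of all of them. Let $D\neq0$ be a $\Gamma$-graded subspace of $\mathrm{Der}^\epsilon(A)$ which is color-commutative, i.e. $\partial\partial'=\epsilon(\kappa,\kappa')\partial'\partial$ for homogeneous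 $\partial,\partial'\in D$ of degrees $\kappa,\kappa'$, and suppose that $A$ is graded $D$-simple: $A\ne0$, and $0$ and $A$ are the only graded two-sided ideals of $A$ stable under $D$. Let $A[D]\subseteq\mathrm{End}_F(A)$ be the subalgebra generated by the left multiplications by elements of $A$ and by $D$. It is a $\Gamma$-graded algebra, an operator having degree $\kappa$ if it maps each $A_\lambda$ into $A_{\kappa+\lambda}$. Let $[\cdot,\cdot]$ be the bilinear bracket on $A[D]$ with $[x,y]=xy-\epsilon(\kappa,\kappa')yx$ for $x,y$ homogeneous of degrees $\kappa,\kappa'$, and let $W=[A[D],A[D]]$ be the span of all brackets. Put $F_1=\{u\in A: D(u)=0\}$, let $F_1[D]\subseteq\mathrm{End}_F(A)$ be the subalgebra generated by $F_1$ and $D$, and let $\mathcal D=\mathrm{Der}^\epsilon(A)\cap F_1[D]$. Let $\mathcal D(A)$ be the span of all $\partial(a)$, $\partial\in\mathcal D$, $a\in A$. Let $\{d_i\}_{i\in\mathcal I}$ be any basis of the left $F_1$-module $\mathcal D$ consisting of homogeneous elements, with a total order on $\mathcal I$. Let $\mathcal J$ be the set of finitely supported $\alpha=(\alpha_i)_{i\in\mathcal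 I}$ with $\alpha_i\in\mathbb Z_{\ge0}$, $\alpha_i\le p-1$ if $\mathrm{char}\,F=p>0$, and $\alpha_i\le1$ if the color of $d_i$ lies in $\Gamma_-$. Put $|\alpha|=\sum_i\alpha_i$, and let $d^\alpha=\prod_i d_i^{\alpha_i}$, the product being taken in increasing order of $i$. (i) If $\mathcal J$ is infinite, then $W=A[D]$. (ii) If $\mathcal J$ is finite and $\gamma\in\mathcal J$ is its maximal element (i.e. $|\gamma|=\max_{\alpha\in\mathcal J}|\alpha|$), then $W=\bigoplus_{\alpha\in\mathcal J\setminus\{\gamma\}}A\,d^\alpha\oplus\mathcal D(A)\,d^\gamma$. (iii) $F_1\subseteq W$, the bracket of $A[D]$ induces on $W/F_1$ the structure of an $(\epsilon,\Gamma)$-Lie color algebra, and $W/F_1$ is simple (its bracket is not zero, and it has no graded Lie color ideals other than $0$ and itself) if and only if we are not in the following exceptional case: $A=F_1[t]/(t^2)$ (that is, $A=F_1\oplus F_1t$ is free over $F_1$ on $1,t$, and $t^2=0$), where $t$ is homogeneous with color in $\Gamma_-$, and $D\subseteq F_1\frac{d}{dt}$, where $\frac{d}{dt}$ is the homogeneous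 color derivation with $\frac{d}{dt}(F_1)=0$, $\frac{d}{dt}(t)=1$, whose color also lies in $\Gamma_-$. -/

import Mathlib

set_option linter.unusedSectionVars false

namespace WeylColor

/-! ### Lie color algebras -/

section LieColor

/-- A skew-symmetric bicharacter `ε : Γ × Γ → F*`. -/
structure IsSkewBicharacter {Γ F : Type*} [AddCommGroup Γ] [Field F]
    (ε : Γ → Γ → Fˣ) : Prop where
  symm : ∀ a b, ε a b = (ε b a)⁻¹
  add_right : ∀ a b c, ε a (b + c) = ε a b * ε a c

/-- `L = ⨁ ℒ γ` with the bilinear map `br` is an `(ε, Γ)`-Lie color algebra. -/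
structure IsLieColorAlgebra {Γ F L : Type*} [AddCommGroup Γ] [DecidableEq Γ] [Field F]
    [AddCommGroup L] [Module F L] (ε : Γ → Γ → Fˣ) (ℒ : Γ → Submodule F L)
    (br : L →ₗ[F] L →ₗ[F] L) : Prop where
  internal : DirectSum.IsInternal ℒ
  bracket_mem : ∀ a b, ∀ x ∈ ℒ a, ∀ y ∈ ℒ b, br x y ∈ ℒ (a + b)
  skew : ∀ a b, ∀ x ∈ ℒ a, ∀ y ∈ ℒ b, br x y = -((ε a b : F) • br y x)
  jacobi : ∀ a b c, ∀ x ∈ ℒ a, ∀ y ∈ ℒ b, ∀ z ∈ ℒ c,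
    br x (br y z) = br (br x y) z + (ε a b : F) • br y (br x z)

/-- A subspace is `Γ`-graded if it is spanned by its homogeneous elements. -/
def IsGradedSubspace {Γ F L : Type*} [Field F] [AddCommGroup L] [Module F L]
    (ℒ : Γ → Submodule F L) (U : Submodule F L) : Prop :=
  U ≤ ⨆ a, U ⊓ ℒ a

/-- A Lie color ideal: a graded subspace `U` with `[L, U] ⊆ U`. -/
def IsColorIdeal {Γ F L : Type*} [Field F] [AddCommGroup L] [Module F L]
    (ℒ : Γ → Submodule F L) (br : L →ₗ[F] L →ₗ[F] L) (U : Submodule F L) : Prop :=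
  IsGradedSubspace ℒ U ∧ ∀ x : L, ∀ u ∈ U, br x u ∈ U

/-- A simple Lie color algebra: `[L, L] ≠ 0`, and the only Lie color ideals are `0` and `L`. -/
structure IsSimpleLieColorAlgebra {Γ F L : Type*} [AddCommGroup Γ] [DecidableEq Γ] [Field F]
    [AddCommGroup L] [Module F L] (ε : Γ → Γ → Fˣ) (ℒ : Γ → Submodule F L)
    (br : L →ₗ[F] L →ₗ[F] L) : Prop extends IsLieColorAlgebra ε ℒ br where
  nonabelian : ∃ x y, br x y ≠ 0
  eq_bot_or_eq_top : ∀ U : Submodule F L, IsColorIdeal ℒ br U → U = ⊥ ∨ U = ⊤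

end LieColor

/-! ### The color commutator of a graded associative algebra -/

section Quotient

variable {F L : Type*} [Field F] [AddCommGroup L] [Module F L]

/-- The bracket induced on `W / (N ∩ W)`, for a subspace `W` closed under the bracket of `L` and
a subspace `N` whose brackets with `L` vanish. -/
noncomputable def quotientBracket (br : L →ₗ[F] L →ₗ[F] L) (W N : Submodule F L)
    (hW : ∀ x ∈ W, ∀ y ∈ W, br x y ∈ W) (hl : ∀ n ∈ N, ∀ x, br n x = 0)
    (hr : ∀ x, ∀ n ∈ N, br x n = 0) :
    (W ⧸ N.submoduleOf W) →ₗ[F] (W ⧸ N.submoduleOf W) →ₗ[F] (W ⧸ N.submoduleOf W) :=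
  (N.submoduleOf W).liftQ
    (LinearMap.mk₂ F
      (fun (x : W) (y : W ⧸ N.submoduleOf W) =>
        (N.submoduleOf W).liftQ
          ((N.submoduleOf W).mkQ ∘ₗ
            ((br x ∘ₗ W.subtype).codRestrict W fun y => hW x x.2 y y.2))
          (fun n hn => by
            have h0 : br x (n : L) = 0 := hr x n hn
            have : ((br x ∘ₗ W.subtype).codRestrict W fun y => hW x x.2 y y.2) n = 0 :=
              Subtype.ext h0
            rw [LinearMap.mem_ker, LinearMap.comp_apply, this, map_zero]) y)
      (fun x x' y => by
        induction y using Submodule.Quotient.induction_on with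
        | _ y =>
          refine (congrArg (N.submoduleOf W).mkQ (?_ : _ = (_ : W) + _)).trans (map_add _ _ _)
          exact Subtype.ext (LinearMap.congr_fun (map_add br (x : L) (x' : L)) (y : L)))
      (fun r x y => by
        induction y using Submodule.Quotient.induction_on with
        | _ y =>
          refine (congrArg (N.submoduleOf W).mkQ (?_ : _ = r • (_ : W))).trans (map_smul _ _ _)
          exact Subtype.ext (LinearMap.congr_fun (map_smul br r (x : L)) (y : L)))
      (fun x y y' => map_add _ _ _)
      (fun r x y => map_smul _ _ _))
    (fun n hn => by
      rw [LinearMap.mem_ker]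
      ext y
      have h0 : br (n : L) (y : L) = 0 := hl n hn y
      refine (congrArg (N.submoduleOf W).mkQ (?_ : _ = (0 : W))).trans (map_zero _)
      exact Subtype.ext h0)

/-- The bracket of the classes of `x` and `y` is the class of the bracket of `x` and `y`. -/
theorem quotientBracket_mk (br : L →ₗ[F] L →ₗ[F] L) (W N : Submodule F L)
    (hW : ∀ x ∈ W, ∀ y ∈ W, br x y ∈ W) (hl : ∀ n ∈ N, ∀ x, br n x = 0)
    (hr : ∀ x, ∀ n ∈ N, br x n = 0) (x y : W) :
    quotientBracket br W N hW hl hr ((N.submoduleOf W).mkQ x) ((N.submoduleOf W).mkQ y) =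
      (N.submoduleOf W).mkQ ⟨br x y, hW x x.2 y y.2⟩ :=
  rfl

end Quotient

section Commutator

variable {Γ F B : Type*} [AddCommGroup Γ] [DecidableEq Γ] [Field F] [Ring B] [Algebra F B]

/-- The linear map `B → B` which multiplies the component of degree `b` by `ε a b`. -/
noncomputable def scale (ε : Γ → Γ → Fˣ) (ℬ : Γ → Submodule F B) [GradedAlgebra ℬ] (a : Γ) :
    B →ₗ[F] B :=
  (DirectSum.toModule F Γ B fun b => (ε a b : F) • (ℬ b).subtype) ∘ₗ
    (DirectSum.decomposeLinearEquiv ℬ).toLinearMap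

/-- The bilinear map with `(x, y) ↦ x y - ε(a, b) y x` for `x ∈ ℬ a`, `y ∈ ℬ b`. -/
noncomputable def colorCommutator (ε : Γ → Γ → Fˣ) (ℬ : Γ → Submodule F B) [GradedAlgebra ℬ] :
    B →ₗ[F] B →ₗ[F] B :=
  LinearMap.mul F B -
    (DirectSum.toModule F Γ (B →ₗ[F] B) fun a =>
        ((LinearMap.mul F B).flip.compl₂ (scale ε ℬ a)) ∘ₗ (ℬ a).subtype) ∘ₗ
      (DirectSum.decomposeLinearEquiv ℬ).toLinearMap

theorem scale_of_mem (ε : Γ → Γ → Fˣ) (ℬ : Γ → Submodule F B) [GradedAlgebra ℬ] (a : Γ) {b : Γ}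
    {y : B} (hy : y ∈ ℬ b) : scale ε ℬ a y = (ε a b : F) • y := by
  lift y to ℬ b using hy
  simp [scale]

theorem colorCommutator_of_mem (ε : Γ → Γ → Fˣ) (ℬ : Γ → Submodule F B) [GradedAlgebra ℬ]
    {a b : Γ} {x y : B} (hx : x ∈ ℬ a) (hy : y ∈ ℬ b) :
    colorCommutator ε ℬ x y = x * y - (ε a b : F) • (y * x) := by
  have := scale_of_mem ε ℬ a hy
  lift x to ℬ a using hx
  simp [colorCommutator, this]

/-- `B` is `ε`-color-commutative. -/
def IsColorCommutative (ε : Γ → Γ → Fˣ) (ℬ : Γ → Submodule F B) : Prop :=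
  ∀ a b, ∀ x ∈ ℬ a, ∀ y ∈ ℬ b, x * y = (ε a b : F) • (y * x)

end Commutator

/-! ### Homogeneous operators and color derivations -/

section Operators

variable {Γ F A : Type*} [AddCommGroup Γ] [Field F] [Ring A] [Algebra F A]

/-- The `F`-linear operators on `A` which are homogeneous of degree `k`. -/
def homEnd (𝒜 : Γ → Submodule F A) (k : Γ) : Submodule F (Module.End F A) where
  carrier := {T | ∀ a, ∀ x ∈ 𝒜 a, T x ∈ 𝒜 (k + a)}
  zero_mem' := fun _ _ _ => zero_mem _
  add_mem' := fun hS hT a x hx => add_mem (hS a x hx) (hT a x hx)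
  smul_mem' := fun r _ hT a x hx => Submodule.smul_mem _ r (hT a x hx)

/-- The homogeneous color derivations of degree `k`. -/
def colorDer (ε : Γ → Γ → Fˣ) (𝒜 : Γ → Submodule F A) (k : Γ) :
    Submodule F (Module.End F A) where
  carrier := {T | T ∈ homEnd 𝒜 k ∧
    ∀ a b, ∀ x ∈ 𝒜 a, ∀ y ∈ 𝒜 b, T (x * y) = T x * y + (ε k a : F) • (x * T y)}
  zero_mem' := ⟨zero_mem _, by simp⟩
  add_mem' := fun {S T} hS hT => ⟨add_mem hS.1 hT.1, fun a b x hx y hy => by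
    rw [LinearMap.add_apply, LinearMap.add_apply, LinearMap.add_apply, hS.2 a b x hx y hy,
      hT.2 a b x hx y hy, add_mul, mul_add, smul_add]
    abel⟩
  smul_mem' := fun r T hT => ⟨Submodule.smul_mem _ r hT.1, fun a b x hx y hy => by
    rw [LinearMap.smul_apply, LinearMap.smul_apply, LinearMap.smul_apply, hT.2 a b x hx y hy,
      smul_add, smul_mul_assoc, mul_smul_comm, smul_comm r]⟩

/-- `Der^ε(A)`, the sum of all the spaces of homogeneous color derivations. -/
def derivations (ε : Γ → Γ → Fˣ) (𝒜 : Γ → Submodule F A) : Submodule F (Module.End F A) :=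
  ⨆ k, colorDer ε 𝒜 k

/-- A `Γ`-graded subspace `D` of `Der^ε(A)`. -/
structure GradedDerSubspace (ε : Γ → Γ → Fˣ) (𝒜 : Γ → Submodule F A) where
  carrier : Submodule F (Module.End F A)
  graded : carrier ≤ ⨆ k, carrier ⊓ colorDer ε 𝒜 k

namespace GradedDerSubspace

variable {ε : Γ → Γ → Fˣ} {𝒜 : Γ → Submodule F A}

/-- `D` is color-commutative. -/
def IsColorCommuting (D : GradedDerSubspace ε 𝒜) : Prop :=
  ∀ j k, ∀ S ∈ D.carrier ⊓ colorDer ε 𝒜 j, ∀ T ∈ D.carrier ⊓ colorDer ε 𝒜 k,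
    S * T = (ε j k : F) • (T * S)

/-- `A[D]`: the subalgebra of `End(A)` generated by the left multiplications and by `D`. -/
def weyl (D : GradedDerSubspace ε 𝒜) : Subalgebra F (Module.End F A) :=
  Algebra.adjoin F (Set.range (Algebra.lmul F A) ∪ (D.carrier : Set (Module.End F A)))

/-- `A[D]` as a type. -/
def Weyl (D : GradedDerSubspace ε 𝒜) : Type _ := D.weyl

noncomputable instance (D : GradedDerSubspace ε 𝒜) : Ring D.Weyl :=
  inferInstanceAs (Ring D.weyl)

noncomputable instance (D : GradedDerSubspace ε 𝒜) : Algebra F D.Weyl :=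
  inferInstanceAs (Algebra F D.weyl)

/-- The inclusion of `A[D]` in `End(A)`. -/
noncomputable def toEnd (D : GradedDerSubspace ε 𝒜) : D.Weyl →ₐ[F] Module.End F A :=
  D.weyl.val

/-- A member of `A[D]` from an operator. -/
def ofEnd (D : GradedDerSubspace ε 𝒜) (T : Module.End F A) (hT : T ∈ D.weyl) : D.Weyl :=
  ⟨T, hT⟩

theorem toEnd_mem (D : GradedDerSubspace ε 𝒜) (x : D.Weyl) : D.toEnd x ∈ D.weyl :=
  Subtype.property (p := (· ∈ D.weyl)) x

theorem toEnd_injective (D : GradedDerSubspace ε 𝒜) : Function.Injective D.toEnd :=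
  Subtype.val_injective

@[simp] theorem toEnd_ofEnd (D : GradedDerSubspace ε 𝒜) (T : Module.End F A) (hT : T ∈ D.weyl) :
    D.toEnd (D.ofEnd T hT) = T :=
  rfl

/-- The homogeneous component of degree `k` of `A[D]`. -/
noncomputable def weylGrading (D : GradedDerSubspace ε 𝒜) (k : Γ) : Submodule F D.Weyl :=
  (homEnd 𝒜 k).comap D.toEnd.toLinearMap

end GradedDerSubspace

end Operators

section Graded

variable {Γ F A : Type*} [AddCommGroup Γ] [Field F] [Ring A] [Algebra F A]
  {ε : Γ → Γ → Fˣ} {𝒜 : Γ → Submodule F A}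

theorem one_mem_homEnd : (1 : Module.End F A) ∈ homEnd 𝒜 0 := by
  intro a x hx
  simpa using hx

theorem mul_mem_homEnd {j k : Γ} {S T : Module.End F A} (hS : S ∈ homEnd 𝒜 j)
    (hT : T ∈ homEnd 𝒜 k) : S * T ∈ homEnd 𝒜 (j + k) := by
  intro a x hx
  rw [add_assoc]
  exact hS _ _ (hT a x hx)

theorem GradedDerSubspace.lmul_mem_weyl (D : GradedDerSubspace ε 𝒜) (u : A) : Algebra.lmul F A u ∈ D.weyl :=
  Algebra.subset_adjoin (Or.inl ⟨u, rfl⟩)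

theorem GradedDerSubspace.mem_weyl (D : GradedDerSubspace ε 𝒜) {T : Module.End F A} (hT : T ∈ D.carrier) :
    T ∈ D.weyl :=
  Algebra.subset_adjoin (Or.inr hT)

/-- The sum of a multiplicative family of subspaces contains the algebra generated by any
subset of it. -/
theorem adjoin_le_iSup {R : Type*} [Ring R] [Algebra F R] {G : Γ → Submodule F R} {s : Set R}
    (h1 : (1 : R) ∈ G 0) (hmul : ∀ j k, ∀ S ∈ G j, ∀ T ∈ G k, S * T ∈ G (j + k))
    (hs : ∀ T ∈ s, T ∈ ⨆ k, G k) {T : R} (hT : T ∈ Algebra.adjoin F s) : T ∈ ⨆ k, G k := by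
  induction hT using Algebra.adjoin_induction with
  | mem x hx => exact hs x hx
  | algebraMap r =>
    rw [Algebra.algebraMap_eq_smul_one]
    exact Submodule.smul_mem _ r (Submodule.mem_iSup_of_mem 0 h1)
  | add x y _ _ hx hy => exact add_mem hx hy
  | mul x y hx' hy' hx hy =>
    clear hx' hy'
    induction hx using Submodule.iSup_induction' with
    | zero => rw [zero_mul]; exact zero_mem _
    | add p q _ _ hp hq => rw [add_mul]; exact add_mem hp hq
    | mem j p hp =>
      induction hy using Submodule.iSup_induction' with
      | zero => rw [mul_zero]; exact zero_mem _
      | add q r _ _ hq hr => rw [mul_add]; exact add_mem hq hr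
      | mem k q hq => exact Submodule.mem_iSup_of_mem (j + k) (hmul j k p hp q hq)

/-- An element is killed by `D` as soon as it is killed by the homogeneous members of `D`. -/
theorem GradedDerSubspace.apply_eq_zero_of_homogeneous (D : GradedDerSubspace ε 𝒜) {u : A}
    (h : ∀ k, ∀ T ∈ D.carrier ⊓ colorDer ε 𝒜 k, T u = 0) {T : Module.End F A}
    (hT : T ∈ D.carrier) : T u = 0 := by
  have hT' := D.graded hT
  clear hT
  induction hT' using Submodule.iSup_induction' with
  | mem k T hT => exact h k T hT
  | zero => rfl
  | add S T _ _ hS hT => rw [LinearMap.add_apply, hS, hT, add_zero]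

variable [DecidableEq Γ] [GradedAlgebra 𝒜]

theorem lmul_mem_homEnd {a : Γ} {u : A} (hu : u ∈ 𝒜 a) : Algebra.lmul F A u ∈ homEnd 𝒜 a := by
  intro b x hx
  exact SetLike.GradedMul.mul_mem hu hx

theorem homEnd_iSupIndep : iSupIndep (homEnd 𝒜) := by
  rw [iSupIndep_iff_finsetSum_eq_zero_imp_eq_zero]
  intro s v hv h0 i hi
  have key : ∀ a, ∀ x ∈ 𝒜 a, v i x = 0 := by
    intro a x hx
    have ind := (iSupIndep_iff_finsetSum_eq_zero_imp_eq_zero (fun k => 𝒜 (k + a))).1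
      ((DirectSum.Decomposition.isInternal 𝒜).submodule_iSupIndep.comp (add_left_injective a))
    refine ind s (fun k => v k x) (fun k hk => hv k hk a x hx) ?_ i hi
    simpa using congrArg (fun T : Module.End F A => T x) h0
  ext x
  induction x using DirectSum.Decomposition.inductionOn 𝒜 with
  | zero => simp
  | @homogeneous a m => simpa using key a m m.2
  | add m m' h h' => rw [map_add, h, h']; simp

/-- A homogeneous member of a sum of subspaces of homogeneous operators lies in the subspace
of its own degree. -/
theorem mem_of_mem_iSup {G : Γ → Submodule F (Module.End F A)} (hG : ∀ k, G k ≤ homEnd 𝒜 k)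
    {T : Module.End F A} (hT : T ∈ ⨆ k, G k) {k : Γ} (hk : T ∈ homEnd 𝒜 k) : T ∈ G k := by
  classical
  obtain ⟨f, hf⟩ := (Submodule.mem_iSup_iff_exists_dfinsupp' G T).1 hT
  have ind := (iSupIndep_iff_finsetSum_eq_zero_imp_eq_zero (homEnd 𝒜)).1 homEnd_iSupIndep
  have h := ind (insert k f.support) (fun j => (f j : Module.End F A) - if j = k then T else 0)
    ?_ ?_ k (Finset.mem_insert_self _ _)
  · simp only [if_true, sub_eq_zero] at h
    rw [← h]
    exact (f k).2
  · intro j _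
    refine sub_mem (hG j (f j).2) ?_
    split_ifs with hjk
    · rw [hjk]; exact hk
    · exact zero_mem _
  · rw [Finset.sum_sub_distrib, Finset.sum_ite_eq' _ k, if_pos (Finset.mem_insert_self _ _),
      sub_eq_zero, ← hf, DFinsupp.sum]
    refine (Finset.sum_subset (Finset.subset_insert _ _) ?_).symm
    intro j _ hj
    simpa using hj

namespace GradedDerSubspace

/-- To show that `A[D]` is contained in the sum of a multiplicative family it suffices to treat
the homogeneous generators. -/
theorem weyl_le_iSup (D : GradedDerSubspace ε 𝒜) {G : Γ → Submodule F (Module.End F A)}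
    (h1 : (1 : Module.End F A) ∈ G 0) (hmul : ∀ j k, ∀ S ∈ G j, ∀ T ∈ G k, S * T ∈ G (j + k))
    (hA : ∀ a, ∀ u ∈ 𝒜 a, Algebra.lmul F A u ∈ G a)
    (hD : ∀ k, ∀ T ∈ D.carrier ⊓ colorDer ε 𝒜 k, T ∈ G k)
    {T : Module.End F A} (hT : T ∈ D.weyl) : T ∈ ⨆ k, G k := by
  refine adjoin_le_iSup h1 hmul ?_ hT
  rintro T (⟨u, rfl⟩ | hT)
  · induction u using DirectSum.Decomposition.inductionOn 𝒜 with
    | zero => rw [map_zero]; exact zero_mem _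
    | @homogeneous a m => exact Submodule.mem_iSup_of_mem a (hA a m m.2)
    | add m m' h h' => rw [map_add]; exact add_mem h h'
  · exact (iSup_mono hD : (⨆ k, D.carrier ⊓ colorDer ε 𝒜 k) ≤ ⨆ k, G k) (D.graded hT)

theorem weylGrading_isInternal (D : GradedDerSubspace ε 𝒜) :
    DirectSum.IsInternal D.weylGrading := by
  refine DirectSum.isInternal_submodule_of_iSupIndep_of_iSup_eq_top ?_ ?_
  · rw [iSupIndep_iff_finsetSum_eq_zero_imp_eq_zero]
    intro s v hv h0 i hi
    have ind := (iSupIndep_iff_finsetSum_eq_zero_imp_eq_zero (homEnd 𝒜)).1 homEnd_iSupIndep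
    refine (map_eq_zero_iff D.toEnd D.toEnd_injective).1
      (ind s (fun j => D.toEnd (v j)) hv ?_ i hi)
    rw [← map_sum, h0, map_zero]
  · rw [eq_top_iff]
    rintro x -
    have hG : ∀ k, ∀ S ∈ D.weyl, S ∈ homEnd 𝒜 k →
        S ∈ (D.weylGrading k).map D.toEnd.toLinearMap :=
      fun k S h1 h2 => Submodule.mem_map.2 ⟨D.ofEnd S h1, h2, rfl⟩
    have hG' : ∀ k, ∀ S ∈ (D.weylGrading k).map D.toEnd.toLinearMap,
        S ∈ D.weyl ∧ S ∈ homEnd 𝒜 k := by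
      intro k S hS
      obtain ⟨x, hx, rfl⟩ := Submodule.mem_map.1 hS
      exact ⟨D.toEnd_mem x, hx⟩
    have hT : D.toEnd x ∈ ⨆ k, (D.weylGrading k).map D.toEnd.toLinearMap :=
      D.weyl_le_iSup (hG 0 1 (one_mem _) one_mem_homEnd)
        (fun j k S hS T hT => hG _ _ (mul_mem (hG' j S hS).1 (hG' k T hT).1)
          (mul_mem_homEnd (hG' j S hS).2 (hG' k T hT).2))
        (fun a u hu => hG a _ (D.lmul_mem_weyl u) (lmul_mem_homEnd hu))
        (fun k T hT => hG k T (D.mem_weyl hT.1) hT.2.1) (D.toEnd_mem x)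
    rw [← Submodule.map_iSup] at hT
    obtain ⟨S, hS, hST⟩ := Submodule.mem_map.1 hT
    rwa [← D.toEnd_injective hST]

/-- `A[D]` is a `Γ`-graded associative algebra. -/
noncomputable instance (D : GradedDerSubspace ε 𝒜) : GradedAlgebra D.weylGrading where
  one_mem := one_mem_homEnd
  mul_mem := fun _ _ _ _ hS hT => mul_mem_homEnd hS hT
  toDecomposition := D.weylGrading_isInternal.chooseDecomposition

/-! ### The constants `F₁ = A^D` -/

theorem apply_component_eq_zero {k : Γ} {T : Module.End F A} (hT : T ∈ homEnd 𝒜 k) {u : A}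
    (hu : T u = 0) (a : Γ) : T (DirectSum.decompose 𝒜 u a) = 0 := by
  classical
  have ind := (iSupIndep_iff_finsetSum_eq_zero_imp_eq_zero (fun b => 𝒜 (k + b))).1
    ((DirectSum.Decomposition.isInternal 𝒜).submodule_iSupIndep.comp (add_right_injective k))
  refine ind (insert a (DirectSum.decompose 𝒜 u).support)
    (fun b => T (DirectSum.decompose 𝒜 u b))
    (fun b _ => hT b _ (DirectSum.decompose 𝒜 u b).2) ?_ a (Finset.mem_insert_self _ _)
  rw [← map_sum, ← hu]
  congr 1
  conv_rhs => rw [← DirectSum.sum_support_decompose 𝒜 u]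
  refine (Finset.sum_subset (Finset.subset_insert _ _) ?_).symm
  intro j _ hj
  simpa using hj

theorem colorDer_apply_mul {k a : Γ} {T : Module.End F A} (hT : T ∈ colorDer ε 𝒜 k) {x : A}
    (hx : x ∈ 𝒜 a) (y : A) : T (x * y) = T x * y + (ε k a : F) • (x * T y) := by
  induction y using DirectSum.Decomposition.inductionOn 𝒜 with
  | zero => simp
  | @homogeneous b m => exact hT.2 a b x hx m m.2
  | add m m' h h' => rw [mul_add, map_add, h, h', mul_add, map_add, mul_add, smul_add]; abel

/-- `F₁ = A^D = {u ∈ A | D(u) = 0}`. -/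
def constants (D : GradedDerSubspace ε 𝒜) : Subalgebra F A where
  carrier := {u | ∀ T ∈ D.carrier, T u = 0}
  add_mem' := fun hu hv T hT => by rw [map_add, hu T hT, hv T hT, add_zero]
  mul_mem' := fun {u v} hu hv T hT => by
    refine D.apply_eq_zero_of_homogeneous (fun k T hT => ?_) hT
    have key : ∀ a, T ((DirectSum.decompose 𝒜 u a : A) * v) = 0 := fun a => by
      rw [colorDer_apply_mul hT.2 (DirectSum.decompose 𝒜 u a).2,
        apply_component_eq_zero hT.2.1 (hu T hT.1), hv T hT.1]
      simp
    classical
    rw [← DirectSum.sum_support_decompose 𝒜 u, Finset.sum_mul, map_sum]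
    exact Finset.sum_eq_zero fun a _ => key a
  algebraMap_mem' := fun r T hT => by
    refine D.apply_eq_zero_of_homogeneous (fun k T hT => ?_) hT
    have h := colorDer_apply_mul hT.2 (SetLike.GradedOne.one_mem (A := 𝒜)) 1
    rw [mul_one, mul_one, one_mul, left_eq_add] at h
    rw [Algebra.algebraMap_eq_smul_one, map_smul,
      (smul_eq_zero.1 h).resolve_left (Units.ne_zero _), smul_zero]

/-- `A` as a subalgebra of `A[D]`. -/
noncomputable def ofA (D : GradedDerSubspace ε 𝒜) : A →ₐ[F] D.Weyl :=
  (Algebra.lmul F A).codRestrict D.weyl D.lmul_mem_weyl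

theorem toEnd_ofA (D : GradedDerSubspace ε 𝒜) (u : A) : D.toEnd (D.ofA u) = Algebra.lmul F A u :=
  rfl

/-- `F₁` as a subspace of `A[D]`. -/
noncomputable def constantOps (D : GradedDerSubspace ε 𝒜) : Submodule F D.Weyl :=
  (Subalgebra.toSubmodule D.constants).map D.ofA.toLinearMap

/-- The color commutator of `A[D]`. -/
noncomputable def bracket (D : GradedDerSubspace ε 𝒜) : D.Weyl →ₗ[F] D.Weyl →ₗ[F] D.Weyl :=
  colorCommutator ε D.weylGrading

/-- `W = [A[D], A[D]]`. -/
noncomputable def derived (D : GradedDerSubspace ε 𝒜) : Submodule F D.Weyl :=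
  Submodule.span F {z | ∃ x y, D.bracket x y = z}

theorem bracket_mem_derived (D : GradedDerSubspace ε 𝒜) (x y : D.Weyl) :
    D.bracket x y ∈ D.derived :=
  Submodule.subset_span ⟨x, y, rfl⟩

theorem _root_.WeylColor.IsSkewBicharacter.add_left (hε : IsSkewBicharacter ε) (a b c : Γ) :
    ε (a + b) c = ε a c * ε b c := by
  rw [hε.symm, hε.add_right, mul_inv, ← hε.symm, ← hε.symm]

/-- Constants color-commute with `A[D]`. -/
theorem mul_lmul_constant (hε : IsSkewBicharacter ε) (hA : IsColorCommutative ε 𝒜)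
    (D : GradedDerSubspace ε 𝒜) {a k : Γ} {u : A} (hu : u ∈ 𝒜 a) (hu' : u ∈ D.constants)
    {T : Module.End F A} (hT : T ∈ D.weyl) (hk : T ∈ homEnd 𝒜 k) :
    T * Algebra.lmul F A u = (ε k a : F) • (Algebra.lmul F A u * T) := by
  let G : Γ → Submodule F (Module.End F A) := fun k =>
    homEnd 𝒜 k ⊓ LinearMap.ker ((LinearMap.mul F (Module.End F A)).flip (Algebra.lmul F A u) -
      (ε k a : F) • LinearMap.mul F (Module.End F A) (Algebra.lmul F A u))
  have hG : ∀ k S, S ∈ G k ↔ S ∈ homEnd 𝒜 k ∧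
      S * Algebra.lmul F A u = (ε k a : F) • (Algebra.lmul F A u * S) := by
    intro k S
    simp [G, sub_eq_zero]
  have h0 : ε 0 a = 1 := by
    have := hε.add_left 0 0 a
    rw [add_zero] at this
    exact left_eq_mul.1 this
  have hT' : T ∈ ⨆ k, G k := by
    refine D.weyl_le_iSup ?_ ?_ ?_ ?_ hT
    · rw [hG]
      exact ⟨one_mem_homEnd, by simp [h0]⟩
    · intro i j S hS T hT
      rw [hG] at hS hT ⊢
      refine ⟨mul_mem_homEnd hS.1 hT.1, ?_⟩
      rw [mul_assoc, hT.2, mul_smul_comm, ← mul_assoc, hS.2, smul_mul_assoc, smul_smul, mul_assoc,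
        hε.add_left, Units.val_mul, mul_comm (ε i a : F)]
    · intro b v hv
      rw [hG]
      refine ⟨lmul_mem_homEnd hv, ?_⟩
      rw [← map_mul, ← map_mul, hA b a v hv u hu, map_smul]
    · intro k T hT
      rw [hG]
      refine ⟨hT.2.1, ?_⟩
      ext y
      have h := colorDer_apply_mul hT.2 hu y
      rw [hu' T hT.1, zero_mul, zero_add] at h
      exact h
  exact ((hG k T).1 (mem_of_mem_iSup (fun k => inf_le_left) hT' hk)).2

theorem bracket_constant (hε : IsSkewBicharacter ε) (hA : IsColorCommutative ε 𝒜)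
    (D : GradedDerSubspace ε 𝒜) (x : D.Weyl) {n : D.Weyl} (hn : n ∈ D.constantOps) :
    D.bracket x n = 0 ∧ D.bracket n x = 0 := by
  obtain ⟨u, hu, rfl⟩ := Submodule.mem_map.1 hn
  change D.bracket x (D.ofA u) = 0 ∧ D.bracket (D.ofA u) x = 0
  have hcomp : ∀ a, (DirectSum.decompose 𝒜 u a : A) ∈ D.constants := fun a T hT => by
    refine D.apply_eq_zero_of_homogeneous (fun k T hT => ?_) hT
    exact apply_component_eq_zero hT.2.1 (hu T hT.1) a
  classical
  have key : ∀ a, D.bracket x (D.ofA (DirectSum.decompose 𝒜 u a)) = 0 ∧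
      D.bracket (D.ofA (DirectSum.decompose 𝒜 u a)) x = 0 := by
    intro a
    have hm : D.ofA (DirectSum.decompose 𝒜 u a) ∈ D.weylGrading a :=
      lmul_mem_homEnd (DirectSum.decompose 𝒜 u a).2
    induction x using DirectSum.Decomposition.inductionOn D.weylGrading with
    | zero => simp
    | add y z hy hz => simp [hy.1, hy.2, hz.1, hz.2]
    | @homogeneous k m =>
      have h := mul_lmul_constant hε hA D (DirectSum.decompose 𝒜 u a).2 (hcomp a)
        (D.toEnd_mem m) m.2
      have h' : (m : D.Weyl) * D.ofA (DirectSum.decompose 𝒜 u a) =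
          (ε k a : F) • (D.ofA (DirectSum.decompose 𝒜 u a) * (m : D.Weyl)) := by
        apply D.toEnd_injective
        rw [map_smul, map_mul, map_mul]
        exact h
      constructor
      · rw [bracket, colorCommutator_of_mem ε _ m.2 hm, h', sub_self]
      · rw [bracket, colorCommutator_of_mem ε _ hm m.2, h', smul_smul, hε.symm a k,
          ← Units.val_mul, inv_mul_cancel, Units.val_one, one_smul, sub_self]
  rw [← DirectSum.sum_support_decompose 𝒜 u]
  simp only [map_sum, LinearMap.sum_apply]
  exact ⟨Finset.sum_eq_zero fun a _ => (key a).1, Finset.sum_eq_zero fun a _ => (key a).2⟩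

/-- The space `W / F₁` (in general `W / (F₁ ∩ W)`). -/
abbrev LieQuotient (D : GradedDerSubspace ε 𝒜) : Type _ :=
  D.derived ⧸ D.constantOps.submoduleOf D.derived

/-- The homogeneous component of degree `k` of `W / F₁`. -/
noncomputable def lieQuotientGrading (D : GradedDerSubspace ε 𝒜) (k : Γ) :
    Submodule F D.LieQuotient :=
  ((D.weylGrading k).submoduleOf D.derived).map (D.constantOps.submoduleOf D.derived).mkQ

/-- The bracket of `W / F₁` induced by the color commutator of `A[D]`. -/
noncomputable def lieQuotientBracket (D : GradedDerSubspace ε 𝒜) (hε : IsSkewBicharacter ε)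
    (hA : IsColorCommutative ε 𝒜) :
    D.LieQuotient →ₗ[F] D.LieQuotient →ₗ[F] D.LieQuotient :=
  quotientBracket D.bracket D.derived D.constantOps (fun x _ y _ => D.bracket_mem_derived x y)
    (fun _ hn x => (bracket_constant hε hA D x hn).2)
    (fun x _ hn => (bracket_constant hε hA D x hn).1)

/-! ### Simplicity of `A`, the space `𝒟`, the multi-indices -/

/-- `A` is graded `D`-simple: `A ≠ 0` and the only graded `D`-stable ideals are `0` and `A`. -/
structure IsGradedSimple (D : GradedDerSubspace ε 𝒜) : Prop where
  nontrivial : Nontrivial A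
  eq_bot_or_eq_top : ∀ I : Ideal A, I.IsTwoSided → I.IsHomogeneous 𝒜 →
    (∀ T ∈ D.carrier, ∀ x ∈ I, T x ∈ I) → I = ⊥ ∨ I = ⊤

/-- `F₁[D]`: the subalgebra of `End(A)` generated by `F₁` and `D`. -/
noncomputable def constantWeyl (D : GradedDerSubspace ε 𝒜) : Subalgebra F (Module.End F A) :=
  Algebra.adjoin F ((Algebra.lmul F A) '' (D.constants : Set A) ∪
    (D.carrier : Set (Module.End F A)))

/-- `𝒟 = Der^ε(A) ∩ F₁[D]`. -/
noncomputable def fullDer (D : GradedDerSubspace ε 𝒜) : Submodule F (Module.End F A) :=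
  derivations ε 𝒜 ⊓ Subalgebra.toSubmodule D.constantWeyl

/-- `d` is an `F₁`-basis of `𝒟`, consisting of homogeneous elements, `d i` being of color `c i`.
Here `F₁` acts on `End(A)` by `(u • T) x = u * T x`. -/
structure IsHomogeneousBasis (D : GradedDerSubspace ε 𝒜) {I : Type*} (d : I → Module.End F A)
    (c : I → Γ) : Prop where
  homogeneous : ∀ i, d i ∈ homEnd 𝒜 (c i)
  linearIndependent : LinearIndependent D.constants d
  span_eq : (Submodule.span D.constants (Set.range d) : Set (Module.End F A)) = D.fullDer

/-- `𝒟(A)`, the span of all `T x` with `T ∈ 𝒟` and `x ∈ A`. -/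
noncomputable def fullDerImage (D : GradedDerSubspace ε 𝒜) : Submodule F A :=
  Submodule.span F {y | ∃ T ∈ D.fullDer, ∃ x, T x = y}

end GradedDerSubspace

/-- The set `𝒥` of admissible exponents, for a family of operators with colors `c`: the entries
are at most `p - 1` if `p = char F > 0`, and at most `1` where the color lies in `Γ₋`. -/
def exponents {I : Type*} (ε : Γ → Γ → Fˣ) (c : I → Γ) : Set (I →₀ ℕ) :=
  {α | ∀ i, (ringChar F ≠ 0 → α i ≤ ringChar F - 1) ∧ (ε (c i) (c i) = -1 → α i ≤ 1)}

/-- The monomial `d^α`, the factors being taken in increasing order of the indices. -/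
noncomputable def monomial {I : Type*} [LinearOrder I] (d : I → Module.End F A) (α : I →₀ ℕ) :
    Module.End F A :=
  (α.support.sort.map fun i => d i ^ α i).prod

/-- The subspace `V T` of `End(A)`, consisting of the operators `x ↦ v * T x` with `v ∈ V`. -/
noncomputable def mulOp (V : Submodule F A) (T : Module.End F A) : Submodule F (Module.End F A) :=
  V.map ((LinearMap.mul F (Module.End F A)).flip T ∘ₗ (Algebra.lmul F A).toLinearMap)

open Classical in
/-- The subspaces `A d^α` for `α ≠ γ`, and `𝒟(A) d^γ` for `α = γ`. -/
noncomputable def GradedDerSubspace.summand {I : Type*} [LinearOrder I]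
    (D : GradedDerSubspace ε 𝒜) (d : I → Module.End F A) (γ α : I →₀ ℕ) :
    Submodule F (Module.End F A) :=
  if α = γ then mulOp D.fullDerImage (monomial d α) else mulOp ⊤ (monomial d α)

/-- `A = F₁[t]/(t²)` with `t` and `∂ = d/dt` of colors in `Γ₋`, and `D` consists of
`F₁`-multiples of `d/dt`. -/
def IsExceptional (D : GradedDerSubspace ε 𝒜) : Prop :=
  ∃ (a k : Γ) (t : A) (T : Module.End F A),
    t ∈ 𝒜 a ∧ ε a a = -1 ∧ t * t = 0 ∧
    (∀ x : A, ∃! p : D.constants × D.constants, x = p.1 + p.2 * t) ∧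
    T ∈ colorDer ε 𝒜 k ∧ ε k k = -1 ∧ (∀ u ∈ D.constants, T u = 0) ∧ T t = 1 ∧
    ∀ S ∈ D.carrier, ∃ u ∈ D.constants, S = Algebra.lmul F A u * T

end Graded

end WeylColor

/-!
A nonzero homogeneous constant generates a graded `D`-stable ideal, so graded `D`-simplicity makes
it invertible: the constants form a graded field, over which graded modules behave like vector
spaces. Moreover the operators generated by the constants and `D` color-commute with each other.

Both the freeness of `A[D]` and the size of brackets rest on one descent principle
(`IsWeylDatum.exists_echelon`). Consider a graded space `V` of operators that is stable under
brackets with `D`, finitely many homogeneous operators `T j` that color-commute with `D`, and the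
vectors `v` over `A` such that `V` contains `∑ a (v j) T j` for all `a`. The `A`-module of these
vectors is graded and stable under `D`, so by graded simplicity it has a reduced echelon form with
constant entries. Hence either `V` contains every `A T j`, or one nonzero tuple of constants
annihilates all these vectors (`IsWeylDatum.mem_or_exists_annihilator`). With `V = 0` it follows
that independence over the constants implies independence over `A` (`IsWeylDatum.coeff_eq_zero`).

Commuting a monomial `d^α` past a multiplication has the leading terms given by a color Leibniz
formula (`monomial_mul_lmul`), and the `p`-th power of a derivation whose color is outside `Γ₋`
is again a derivation (`pow_char_mem_colorDer`). It follows that the admissible monomials form a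
basis of `A[D]` over `A`. If `β` can be raised by one, the bracket of `d^(β + e i)` with a
multiplication has a nonzero component along `d^β`, so by descent `A d^β` consists of brackets
(`smul_monomial_sub_single_mem`). At a maximal `γ` only the image of the derivations survives,
through `[P, x T] = P(x) T`. This computes the span of brackets: `derived_eq_top` when there are
infinitely many admissible exponents and `derivedOps_eq_iSup` otherwise.

For simplicity, an ideal `U` of the span of brackets that is not made of constants contains, after
repeated brackets lowering the order, multiplication by a nonconstant element of `A`
(`exists_lmul_mem`); this is the step that breaks down exactly in the exceptional case, where all
brackets of brackets are constant (`colorBr_of_isExceptional`). Graded simplicity then puts all of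
`A` into `U` (`lmul_mem`). Next come the spaces `A d^β` for `β` that can be raised twice
(`smul_monomial_mem`), by descent the spaces `A d^(γ - e i)` just below a maximal `γ`
(`smul_monomial_sub_single_mem_of_isDerivedIdeal`), and finally the multiples of `d^γ` by the image
of the derivations (`fullDerImage_smul_mem`). Together these exhaust the span of brackets
(`eq_derivedOps`).
-/

namespace WeylColor

/-! ### Bicharacters -/

namespace IsSkewBicharacter

variable {Γ F : Type*} [AddCommGroup Γ] [DecidableEq Γ] [Field F] {ε : Γ → Γ → Fˣ}

theorem zero_left (hε : IsSkewBicharacter ε) (a : Γ) : ε 0 a = 1 := by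
  have := hε.add_left 0 0 a
  rw [add_zero] at this
  exact left_eq_mul.1 this

theorem zero_right (hε : IsSkewBicharacter ε) (a : Γ) : ε a 0 = 1 := by
  rw [hε.symm, hε.zero_left, inv_one]

theorem neg_left (hε : IsSkewBicharacter ε) (a b : Γ) : ε (-a) b = (ε a b)⁻¹ := by
  rw [eq_inv_iff_mul_eq_one, ← hε.add_left, neg_add_cancel, hε.zero_left]

theorem neg_right (hε : IsSkewBicharacter ε) (a b : Γ) : ε a (-b) = (ε a b)⁻¹ := by
  rw [eq_inv_iff_mul_eq_one, ← hε.add_right, neg_add_cancel, hε.zero_right]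

theorem mul_swap (hε : IsSkewBicharacter ε) (a b : Γ) : (ε a b : F) * ε b a = 1 := by
  rw [hε.symm a b, ← Units.val_mul, inv_mul_cancel, Units.val_one]

theorem self_eq (hε : IsSkewBicharacter ε) (a : Γ) : ε a a = 1 ∨ ε a a = -1 := by
  have := hε.mul_swap a a
  rcases mul_self_eq_one_iff.1 this with h | h
  · exact Or.inl (Units.ext h)
  · exact Or.inr (Units.ext (by simpa using h))

theorem neg_self (hε : IsSkewBicharacter ε) (a : Γ) : ε (-a) (-a) = ε a a := by
  rw [hε.neg_left, hε.neg_right, inv_inv]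

end IsSkewBicharacter

section Basics

variable {Γ F A : Type*} [AddCommGroup Γ] [DecidableEq Γ] [Field F] [Ring A] [Algebra F A]
  {ε : Γ → Γ → Fˣ} {𝒜 : Γ → Submodule F A} [GradedAlgebra 𝒜]

/-- The standing assumptions: `char F ≠ 2`, `A` is color-commutative, `D ≠ 0` is
color-commutative, and `A` is graded `D`-simple. -/
structure GradedDerSubspace.IsWeylDatum (D : GradedDerSubspace ε 𝒜) : Prop where
  char_ne_two : ringChar F ≠ 2
  skew : IsSkewBicharacter ε
  comm : IsColorCommutative ε 𝒜
  commuting : D.IsColorCommuting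
  ne_bot : D.carrier ≠ ⊥
  simple : D.IsGradedSimple

/-! ### Homogeneous operators -/

theorem lmul_mul_eq_smul (a : A) (T : Module.End F A) : Algebra.lmul F A a * T = a • T := rfl

theorem lmul_eq_smul_one (a : A) : Algebra.lmul F A a = a • (1 : Module.End F A) := by
  ext x; simp

theorem smul_mul_end (a : A) (S T : Module.End F A) : (a • S) * T = a • (S * T) := rfl

theorem smul_mem_homEnd {a k : Γ} {u : A} (hu : u ∈ 𝒜 a) {T : Module.End F A}
    (hT : T ∈ homEnd 𝒜 k) : u • T ∈ homEnd 𝒜 (a + k) :=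
  mul_mem_homEnd (lmul_mem_homEnd hu) hT

theorem end_ext {S T : Module.End F A} (h : ∀ a, ∀ x ∈ 𝒜 a, S x = T x) : S = T := by
  ext x
  induction x using DirectSum.Decomposition.inductionOn 𝒜 with
  | zero => simp
  | @homogeneous a m => exact h a m m.2
  | add m m' h h' => rw [map_add, map_add, h, h']

theorem colorDer_mul_smul {k a : Γ} {T : Module.End F A} (hT : T ∈ colorDer ε 𝒜 k) {x : A}
    (hx : x ∈ 𝒜 a) (S : Module.End F A) :
    T * (x • S) = T x • S + (ε k a : F) • (x • (T * S)) := by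
  ext y
  exact GradedDerSubspace.colorDer_apply_mul hT hx (S y)

theorem colorDer_apply_one {k : Γ} {T : Module.End F A} (hT : T ∈ colorDer ε 𝒜 k) : T 1 = 0 := by
  have h := GradedDerSubspace.colorDer_apply_mul hT (SetLike.GradedOne.one_mem (A := 𝒜)) 1
  rw [mul_one, mul_one, one_mul, left_eq_add] at h
  exact (smul_eq_zero.1 h).resolve_left (Units.ne_zero _)

/-- The homogeneous component of degree `k` of an operator. -/
noncomputable def opProj (𝒜 : Γ → Submodule F A) [GradedAlgebra 𝒜] (k : Γ) :
    Module.End F A →ₗ[F] Module.End F A where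
  toFun T := (DirectSum.toModule F Γ A fun b =>
      GradedAlgebra.proj 𝒜 (k + b) ∘ₗ T ∘ₗ (𝒜 b).subtype) ∘ₗ
    (DirectSum.decomposeLinearEquiv 𝒜).toLinearMap
  map_add' S T := by
    refine end_ext (𝒜 := 𝒜) fun a x hx => ?_
    lift x to 𝒜 a using hx
    simp
  map_smul' r T := by
    refine end_ext (𝒜 := 𝒜) fun a x hx => ?_
    lift x to 𝒜 a using hx
    simp

theorem opProj_apply (k : Γ) (T : Module.End F A) {b : Γ} {x : A} (hx : x ∈ 𝒜 b) :
    opProj 𝒜 k T x = DirectSum.decompose 𝒜 (T x) (k + b) := by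
  lift x to 𝒜 b using hx
  simp [opProj, GradedAlgebra.proj_apply]

theorem opProj_same {k : Γ} {T : Module.End F A} (hT : T ∈ homEnd 𝒜 k) : opProj 𝒜 k T = T := by
  refine end_ext (𝒜 := 𝒜) fun b x hx => ?_
  rw [opProj_apply k T hx, DirectSum.decompose_of_mem_same _ (hT b x hx)]

theorem opProj_ne {j k : Γ} (hjk : j ≠ k) {T : Module.End F A} (hT : T ∈ homEnd 𝒜 j) :
    opProj 𝒜 k T = 0 := by
  refine end_ext (𝒜 := 𝒜) fun b x hx => ?_
  rw [opProj_apply k T hx, DirectSum.decompose_of_mem_ne _ (hT b x hx)]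
  · rfl
  · simpa using hjk

/-- A graded subspace of operators contains the components of its members. -/
theorem opProj_mem_of_graded {V : Submodule F (Module.End F A)}
    (hV : IsGradedSubspace (homEnd 𝒜) V) (k : Γ) {T : Module.End F A} (hT : T ∈ V) :
    opProj 𝒜 k T ∈ V := by
  have hT' := hV hT
  clear hT
  induction hT' using Submodule.iSup_induction' with
  | zero => simp
  | add S T _ _ hS hT => rw [map_add]; exact add_mem hS hT
  | mem j T hT =>
    by_cases hjk : j = k
    · subst hjk; rw [opProj_same hT.2]; exact hT.1
    · rw [opProj_ne hjk hT.2]; exact zero_mem _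

theorem opProj_smul {k a j : Γ} {u y : A} (hu : u ∈ 𝒜 a) {T : Module.End F A}
    (hT : T ∈ homEnd 𝒜 j) :
    opProj 𝒜 k ((u * y) • T) = (u * (DirectSum.decompose 𝒜 y (k - a - j) : A)) • T := by
  refine end_ext (𝒜 := 𝒜) fun b x hx => ?_
  rw [opProj_apply k _ hx, LinearMap.smul_apply, LinearMap.smul_apply, smul_eq_mul, smul_eq_mul,
    mul_assoc, mul_assoc, show k + b = a + ((k - a - j) + (j + b)) by abel,
    DirectSum.coe_decompose_mul_add_of_left_mem 𝒜 hu,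
    DirectSum.coe_decompose_mul_add_of_right_mem 𝒜 (hT b x hx)]

theorem opProj_smul' {k j : Γ} {y : A} {T : Module.End F A} (hT : T ∈ homEnd 𝒜 j) :
    opProj 𝒜 k (y • T) = (DirectSum.decompose 𝒜 y (k - j) : A) • T := by
  have := opProj_smul (k := k) (y := y) (SetLike.GradedOne.one_mem (A := 𝒜)) hT
  rwa [one_mul, one_mul, sub_zero] at this

namespace GradedDerSubspace

variable {D : GradedDerSubspace ε 𝒜}

/-! ### Consequences of graded simplicity -/

/-- To recognize the graded `D`-stable ideals it suffices to consider homogeneous elements. -/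
theorem IsWeylDatum.ideal_eq (h : D.IsWeylDatum) (J : Ideal A) (hJ : J.IsHomogeneous 𝒜)
    (hD : ∀ k, ∀ T ∈ D.carrier ⊓ colorDer ε 𝒜 k, ∀ a, ∀ x ∈ 𝒜 a, x ∈ J → T x ∈ J) :
    J = ⊥ ∨ J = ⊤ := by
  classical
  refine h.simple.eq_bot_or_eq_top J ⟨fun {x} y hx => ?_⟩ hJ fun T hT x hx => ?_
  · rw [← DirectSum.sum_support_decompose 𝒜 x, ← DirectSum.sum_support_decompose 𝒜 y,
      Finset.sum_mul_sum]
    refine sum_mem fun a _ => sum_mem fun b _ => ?_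
    rw [h.comm a b _ (SetLike.coe_mem _) _ (SetLike.coe_mem _), ← smul_mul_assoc]
    exact J.mul_mem_left _ (hJ a hx)
  · have hT' := D.graded hT
    clear hT
    induction hT' using Submodule.iSup_induction' with
    | zero => exact zero_mem _
    | add S T _ _ hS hT => exact add_mem hS hT
    | mem k T hT =>
      rw [← DirectSum.sum_support_decompose 𝒜 x, map_sum]
      exact sum_mem fun a _ => hD k T hT a _ (SetLike.coe_mem _) (hJ a hx)

theorem mem_constants_iff {u : A} :
    u ∈ D.constants ↔ ∀ k, ∀ T ∈ D.carrier ⊓ colorDer ε 𝒜 k, T u = 0 :=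
  ⟨fun h _ T hT => h T hT.1, fun h _ hT => D.apply_eq_zero_of_homogeneous h hT⟩

theorem decompose_mem_constants {u : A} (hu : u ∈ D.constants) (a : Γ) :
    (DirectSum.decompose 𝒜 u a : A) ∈ D.constants :=
  mem_constants_iff.2 fun _ T hT => apply_component_eq_zero hT.2.1 (hu T hT.1) a

/-- The nonzero homogeneous constants are invertible: `F₁` is a graded field. -/
theorem IsWeylDatum.exists_inv (h : D.IsWeylDatum) {a : Γ} {u : A} (hu : u ∈ 𝒜 a)
    (hc : u ∈ D.constants) (h0 : u ≠ 0) :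
    ∃ v ∈ 𝒜 (-a), v ∈ D.constants ∧ v * u = 1 ∧ u * v = 1 := by
  have hJ : (Ideal.span {u}).IsHomogeneous 𝒜 :=
    Ideal.homogeneous_span 𝒜 _ (by rintro x rfl; exact ⟨a, hu⟩)
  have key := h.ideal_eq (Ideal.span {u}) hJ ?_
  · have htop : Ideal.span {u} = ⊤ := by
      refine key.resolve_left fun hb => h0 ?_
      rwa [Ideal.span_singleton_eq_bot] at hb
    have h1 : (1 : A) ∈ Ideal.span {u} := by rw [htop]; trivial
    obtain ⟨w, hw⟩ := Ideal.mem_span_singleton'.1 h1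
    have hwu : (DirectSum.decompose 𝒜 w (-a) : A) * u = 1 := by
      rw [← DirectSum.coe_decompose_mul_add_of_right_mem 𝒜 hu, hw, neg_add_cancel,
        DirectSum.decompose_of_mem_same _ SetLike.GradedOne.one_mem]
    obtain ⟨v, hvm, hwu⟩ : ∃ v ∈ 𝒜 (-a), v * u = 1 := ⟨_, SetLike.coe_mem _, hwu⟩
    have hcomm : u * v = (ε a (-a) : F) • (1 : A) := by rw [h.comm _ _ u hu v hvm, hwu]
    have huv : u * v = 1 := by
      calc u * v = (ε a (-a) : F) • (1 : A) := hcomm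
        _ = v * ((ε a (-a) : F) • (1 : A)) * u := by simp [hwu]
        _ = v * (u * v) * u := by rw [hcomm]
        _ = (v * u) * (v * u) := by simp only [mul_assoc]
        _ = 1 := by rw [hwu, one_mul]
    refine ⟨v, hvm, mem_constants_iff.2 fun k T hT => ?_, hwu, huv⟩
    have h2 := colorDer_apply_mul hT.2 hu v
    rw [huv, colorDer_apply_one hT.2, hc T hT.1, zero_mul, zero_add] at h2
    have h3 := (smul_eq_zero.1 h2.symm).resolve_left (Units.ne_zero _)
    calc T v = v * u * T v := by rw [hwu, one_mul]
      _ = 0 := by rw [mul_assoc, h3, mul_zero]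
  · intro k T hT b x hx hxJ
    obtain ⟨w, rfl⟩ := Ideal.mem_span_singleton'.1 hxJ
    have hT0 : T u = 0 := hc T hT.1
    have : T (w * u) = T w * u := by
      classical
      rw [← DirectSum.sum_support_decompose 𝒜 w, Finset.sum_mul, map_sum, map_sum, Finset.sum_mul]
      refine Finset.sum_congr rfl fun c _ => ?_
      rw [colorDer_apply_mul hT.2 (SetLike.coe_mem _), hT0, mul_zero, smul_zero, add_zero]
    rw [this]
    exact Ideal.mul_mem_left _ _ (Ideal.mem_span_singleton_self u)

theorem IsWeylDatum.two_ne_zero (h : D.IsWeylDatum) : (2 : F) ≠ 0 :=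
  Ring.two_ne_zero h.char_ne_two

/-- A homogeneous element of `A` whose color lies in `Γ₋` has square zero. -/
theorem IsWeylDatum.mul_self_eq_zero (h : D.IsWeylDatum) {a : Γ} (ha : ε a a = -1) {x : A}
    (hx : x ∈ 𝒜 a) : x * x = 0 := by
  have h1 := h.comm a a x hx x hx
  rw [ha] at h1
  have h2 : (2 : F) • (x * x) = 0 := by
    rw [two_smul]
    nth_rewrite 1 [h1]
    simp
  exact (smul_eq_zero.1 h2).resolve_left h.two_ne_zero

/-- The colors of the nonzero homogeneous constants do not lie in `Γ₋`. -/
theorem IsWeylDatum.constant_color (h : D.IsWeylDatum) {a : Γ} {u : A} (hu : u ∈ 𝒜 a)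
    (hc : u ∈ D.constants) (h0 : u ≠ 0) : ε a a = 1 := by
  refine (h.skew.self_eq a).resolve_right fun ha => h0 ?_
  obtain ⟨v, -, -, hv, -⟩ := h.exists_inv hu hc h0
  calc u = v * u * u := by rw [hv, one_mul]
    _ = 0 := by rw [mul_assoc, h.mul_self_eq_zero ha hu, mul_zero]

/-! ### The color-commutative algebra `F₁[D]` -/

/-- To show that `F₁[D]` is contained in the sum of a multiplicative family it suffices to treat
the homogeneous generators. -/
theorem constantWeyl_le_iSup (D : GradedDerSubspace ε 𝒜) {G : Γ → Submodule F (Module.End F A)}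
    (h1 : (1 : Module.End F A) ∈ G 0) (hmul : ∀ j k, ∀ S ∈ G j, ∀ T ∈ G k, S * T ∈ G (j + k))
    (hA : ∀ a, ∀ u ∈ 𝒜 a, u ∈ D.constants → Algebra.lmul F A u ∈ G a)
    (hD : ∀ k, ∀ T ∈ D.carrier ⊓ colorDer ε 𝒜 k, T ∈ G k)
    {T : Module.End F A} (hT : T ∈ D.constantWeyl) : T ∈ ⨆ k, G k := by
  refine adjoin_le_iSup h1 hmul ?_ hT
  rintro T (⟨u, hu, rfl⟩ | hT)
  · classical
    rw [← DirectSum.sum_support_decompose 𝒜 u, map_sum]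
    exact sum_mem fun a _ => Submodule.mem_iSup_of_mem a
      (hA a _ (SetLike.coe_mem _) (decompose_mem_constants hu a))
  · exact (iSup_mono hD : (⨆ k, D.carrier ⊓ colorDer ε 𝒜 k) ≤ ⨆ k, G k) (D.graded hT)

theorem constantWeyl_graded (D : GradedDerSubspace ε 𝒜) :
    IsGradedSubspace (homEnd 𝒜) (Subalgebra.toSubmodule D.constantWeyl) := by
  intro T hT
  refine D.constantWeyl_le_iSup (G := fun k => Subalgebra.toSubmodule D.constantWeyl ⊓ homEnd 𝒜 k)
    ⟨one_mem D.constantWeyl, one_mem_homEnd⟩ (fun j k S hS T hT => ⟨?_, mul_mem_homEnd hS.2 hT.2⟩)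
    (fun a u hu hc => ⟨Algebra.subset_adjoin (Or.inl ⟨u, hc, rfl⟩), lmul_mem_homEnd hu⟩)
    (fun k T hT => ⟨Algebra.subset_adjoin (Or.inr hT.1), hT.2.1⟩) hT
  exact D.constantWeyl.mul_mem hS.1 hT.1

theorem constantWeyl_le_weyl (D : GradedDerSubspace ε 𝒜) : D.constantWeyl ≤ D.weyl :=
  Algebra.adjoin_mono (Set.union_subset_union_left _ (Set.image_subset_range _ _))

/-- The homogeneous operators of degree `k` which color-commute with the homogeneous operator `Q`
of degree `q`. -/
def colorCentralizer (ε : Γ → Γ → Fˣ) (𝒜 : Γ → Submodule F A) (Q : Module.End F A) (q k : Γ) :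
    Submodule F (Module.End F A) where
  carrier := {S | S ∈ homEnd 𝒜 k ∧ S * Q = (ε k q : F) • (Q * S)}
  zero_mem' := ⟨zero_mem _, by simp⟩
  add_mem' := fun hS hT => ⟨add_mem hS.1 hT.1, by rw [add_mul, mul_add, hS.2, hT.2, smul_add]⟩
  smul_mem' := fun r S hS => ⟨Submodule.smul_mem _ r hS.1, by
    rw [smul_mul_assoc, mul_smul_comm, hS.2, smul_comm]⟩

theorem one_mem_colorCentralizer (hε : IsSkewBicharacter ε) (Q : Module.End F A) (q : Γ) :
    1 ∈ colorCentralizer ε 𝒜 Q q 0 :=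
  ⟨one_mem_homEnd, by simp [hε.zero_left]⟩

theorem mul_mem_colorCentralizer (hε : IsSkewBicharacter ε) {Q : Module.End F A} {q j k : Γ}
    {S T : Module.End F A} (hS : S ∈ colorCentralizer ε 𝒜 Q q j)
    (hT : T ∈ colorCentralizer ε 𝒜 Q q k) : S * T ∈ colorCentralizer ε 𝒜 Q q (j + k) := by
  refine ⟨mul_mem_homEnd hS.1 hT.1, ?_⟩
  rw [mul_assoc, hT.2, mul_smul_comm, ← mul_assoc, hS.2, smul_mul_assoc, smul_smul, mul_assoc,
    hε.add_left, Units.val_mul, mul_comm (ε j q : F)]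

theorem colorComm_symm (hε : IsSkewBicharacter ε) {j k : Γ} {S T : Module.End F A}
    (h : S * T = (ε j k : F) • (T * S)) : T * S = (ε k j : F) • (S * T) := by
  rw [h, smul_smul, hε.mul_swap, one_smul]

/-- `F₁[D]` is color-commutative. -/
theorem IsWeylDatum.constantWeyl_comm (h : D.IsWeylDatum) {j k : Γ} {S T : Module.End F A}
    (hS : S ∈ D.constantWeyl) (hS' : S ∈ homEnd 𝒜 j) (hT : T ∈ D.constantWeyl)
    (hT' : T ∈ homEnd 𝒜 k) : S * T = (ε j k : F) • (T * S) := by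
  -- A homogeneous generator color-commutes with `A[D]` or with the generators.
  have hconst : ∀ a, ∀ u ∈ 𝒜 a, u ∈ D.constants → ∀ k, ∀ Q ∈ D.constantWeyl, Q ∈ homEnd 𝒜 k →
      Algebra.lmul F A u ∈ colorCentralizer ε 𝒜 Q k a := fun a u hu hc k Q hQ hQ' =>
    ⟨lmul_mem_homEnd hu, colorComm_symm h.skew
      (mul_lmul_constant h.skew h.comm D hu hc (D.constantWeyl_le_weyl hQ) hQ')⟩
  have hder : ∀ k, ∀ Q ∈ D.carrier ⊓ colorDer ε 𝒜 k, ∀ j, ∀ S ∈ D.constantWeyl, S ∈ homEnd 𝒜 j →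
      S ∈ colorCentralizer ε 𝒜 Q k j := by
    intro k Q hQ j S hS hS'
    refine mem_of_mem_iSup (G := colorCentralizer ε 𝒜 _ _) (fun k S hS => hS.1)
      (D.constantWeyl_le_iSup
      (one_mem_colorCentralizer h.skew Q k)
      (fun _ _ _ hS _ hT => mul_mem_colorCentralizer h.skew hS hT)
      (fun a u hu hc => hconst a u hu hc k Q (Algebra.subset_adjoin (Or.inr hQ.1)) hQ.2.1)
      (fun l P hP => ⟨hP.2.1, h.commuting l k P hP Q hQ⟩) hS) hS'
  have := mem_of_mem_iSup (G := colorCentralizer ε 𝒜 _ _) (fun k S hS => hS.1)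
      (D.constantWeyl_le_iSup
      (one_mem_colorCentralizer h.skew T k)
      (fun _ _ _ hS _ hT => mul_mem_colorCentralizer h.skew hS hT)
      (fun a u hu hc => hconst a u hu hc k T hT hT')
      (fun l P hP => ⟨hP.2.1, colorComm_symm h.skew (hder l P hP k T hT hT').2⟩) hS) hS'
  exact this.2

end GradedDerSubspace
end Basics
end WeylColor

namespace WeylColor

section Descent

variable {Γ F A : Type*} [AddCommGroup Γ] [DecidableEq Γ] [Field F] [Ring A] [Algebra F A]
  {ε : Γ → Γ → Fˣ} {𝒜 : Γ → Submodule F A} [GradedAlgebra 𝒜]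

namespace GradedDerSubspace

variable {D : GradedDerSubspace ε 𝒜}

/-! ### Descent to the constants -/

/-- `V` is a graded subspace of `End(A)` with `[∂, V] ⊆ V` for all homogeneous `∂ ∈ D`. -/
structure IsAdStable (D : GradedDerSubspace ε 𝒜) (V : Submodule F (Module.End F A)) : Prop where
  graded : IsGradedSubspace (homEnd 𝒜) V
  ad_mem : ∀ k, ∀ P ∈ D.carrier ⊓ colorDer ε 𝒜 k, ∀ j, ∀ S ∈ V, S ∈ homEnd 𝒜 j →
    P * S - (ε k j : F) • (S * P) ∈ V

theorem isAdStable_bot (D : GradedDerSubspace ε 𝒜) : D.IsAdStable ⊥ where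
  graded := bot_le
  ad_mem k P _ j S hS _ := by
    rw [Submodule.mem_bot] at hS ⊢
    simp [hS]

/-- The tuples `v` of elements of `A` such that `A ∑ j, v j • T j` is contained in `V`. -/
def coeffModule {ι : Type*} [Fintype ι] (V : Submodule F (Module.End F A))
    (T : ι → Module.End F A) : Submodule A (ι → A) where
  carrier := {v | ∀ a : A, ∑ j, (a * v j) • T j ∈ V}
  zero_mem' a := by simp
  add_mem' {v w} hv hw a := by
    simpa only [Pi.add_apply, mul_add, add_smul, Finset.sum_add_distrib] using add_mem (hv a) (hw a)
  smul_mem' b v hv a := by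
    simpa only [Pi.smul_apply, smul_eq_mul, mul_assoc] using hv (a * b)

section Coeff

variable {ι : Type*} [Fintype ι] {V : Submodule F (Module.End F A)} {T : ι → Module.End F A}
  {τ : ι → Γ}

theorem mem_coeffModule_of_homogeneous {v : ι → A}
    (hv : ∀ r, ∀ a ∈ 𝒜 r, ∑ j, (a * v j) • T j ∈ V) : v ∈ coeffModule V T := by
  intro a
  induction a using DirectSum.Decomposition.inductionOn 𝒜 with
  | zero => simp
  | @homogeneous r m => exact hv r m m.2
  | add m m' h h' => simpa only [add_mul, add_smul, Finset.sum_add_distrib] using add_mem h h'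

/-- If `T j` is given the degree `τ j`, the coefficients of a homogeneous combination of degree `l`
have the degrees `l - τ j`. The coefficient module is graded accordingly. -/
theorem component_mem_coeffModule (hV : IsGradedSubspace (homEnd 𝒜) V)
    (hT : ∀ j, T j ∈ homEnd 𝒜 (τ j)) {v : ι → A} (hv : v ∈ coeffModule V T) (l : Γ) :
    (fun j => (DirectSum.decompose 𝒜 (v j) (l - τ j) : A)) ∈ coeffModule V T := by
  refine mem_coeffModule_of_homogeneous (𝒜 := 𝒜) fun r a ha => ?_
  have := opProj_mem_of_graded hV (l + r) (hv a)
  rw [map_sum] at this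
  convert this using 2 with j
  rw [opProj_smul ha (hT j), add_sub_cancel_right]

/-- The coefficient module is stable under the componentwise action of `D`. -/
theorem der_mem_coeffModule (hε : IsSkewBicharacter ε) (hV : D.IsAdStable V)
    (hT : ∀ j, T j ∈ homEnd 𝒜 (τ j))
    (hcomm : ∀ k, ∀ P ∈ D.carrier ⊓ colorDer ε 𝒜 k, ∀ j,
      P * T j = (ε k (τ j) : F) • (T j * P))
    {v : ι → A} (hv : v ∈ coeffModule V T) {l : Γ} (hl : ∀ j, v j ∈ 𝒜 (l - τ j)) {k : Γ}
    {P : Module.End F A} (hP : P ∈ D.carrier ⊓ colorDer ε 𝒜 k) :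
    (fun j => P (v j)) ∈ coeffModule V T := by
  refine mem_coeffModule_of_homogeneous (𝒜 := 𝒜) fun r a ha => ?_
  have hdeg : ∀ j, (a * v j) • T j ∈ homEnd 𝒜 (r + l) := fun j => by
    have := smul_mem_homEnd (SetLike.GradedMul.mul_mem ha (hl j)) (hT j)
    rwa [show r + (l - τ j) + τ j = r + l by abel] at this
  have h1 := hV.ad_mem k P hP (r + l) _ (hv a) (sum_mem fun j _ => hdeg j)
  have h2 : P * (∑ j, (a * v j) • T j) - (ε k (r + l) : F) • ((∑ j, (a * v j) • T j) * P) =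
      ∑ j, (P a * v j) • T j + (ε k r : F) • ∑ j, (a * P (v j)) • T j := by
    rw [Finset.mul_sum, Finset.sum_mul, Finset.smul_sum, Finset.smul_sum, ← Finset.sum_sub_distrib,
      ← Finset.sum_add_distrib]
    refine Finset.sum_congr rfl fun j _ => ?_
    rw [colorDer_mul_smul hP.2 (SetLike.GradedMul.mul_mem ha (hl j)), hcomm k P hP j,
      colorDer_apply_mul hP.2 ha, add_smul, smul_mul_end, smul_comm (a * v j) (ε k (τ j) : F),
      smul_smul, ← Units.val_mul, ← hε.add_right, show r + (l - τ j) + τ j = r + l by abel,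
      smul_assoc]
    abel
  rw [h2] at h1
  have h3 := (Submodule.add_mem_iff_right V (hv (P a))).1 h1
  exact (Submodule.smul_mem_iff V (Units.ne_zero _)).1 h3

/-- A reduced echelon form of the coefficient module: it meets the coordinate subspace `A ^ S` only
in `0`, and modulo `A ^ S` every further unit vector is congruent to a member of the coefficient
module; by simplicity, the entries of that member are homogeneous constants. -/
theorem IsWeylDatum.exists_echelon (h : D.IsWeylDatum) (hV : D.IsAdStable V)
    (hT : ∀ j, T j ∈ homEnd 𝒜 (τ j))
    (hcomm : ∀ k, ∀ P ∈ D.carrier ⊓ colorDer ε 𝒜 k, ∀ j,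
      P * T j = (ε k (τ j) : F) • (T j * P)) :
    ∃ S : Finset ι, (∀ v ∈ coeffModule V T, (∀ j ∉ S, v j = 0) → v = 0) ∧
      ∀ j ∉ S, ∃ w ∈ coeffModule V T, w j = 1 ∧ (∀ i ∉ S, i ≠ j → w i = 0) ∧
        ∀ i, w i ∈ D.constants ∧ w i ∈ 𝒜 (τ j - τ i) := by
  classical
  set N := coeffModule V T with hN
  let Q : Finset ι → Prop := fun S => ∀ v ∈ N, (∀ j ∉ S, v j = 0) → v = 0
  obtain ⟨S, hSmem, hmax⟩ := Finset.exists_max_image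
    ((Finset.univ : Finset (Finset ι)).filter Q) Finset.card
    ⟨∅, Finset.mem_filter.2 ⟨Finset.mem_univ _, fun v _ hv => funext fun j => hv j (by simp)⟩⟩
  have hS : Q S := (Finset.mem_filter.1 hSmem).2
  refine ⟨S, hS, fun j hj => ?_⟩
  have hnot : ¬ Q (insert j S) := fun hq => by
    have := hmax (insert j S) (by simpa using hq)
    rw [Finset.card_insert_of_notMem hj] at this
    omega
  -- the ideal of the `j`-th coordinates of the members of `N` supported in `S ∪ {j}`
  let J : Ideal A :=
    { carrier := {a | ∃ w ∈ N, (∀ i ∉ insert j S, w i = 0) ∧ w j = a}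
      zero_mem' := ⟨0, zero_mem _, by simp, rfl⟩
      add_mem' := by
        rintro _ _ ⟨v, hv, hv0, rfl⟩ ⟨w, hw, hw0, rfl⟩
        exact ⟨v + w, add_mem hv hw, fun i hi => by simp [hv0 i hi, hw0 i hi], rfl⟩
      smul_mem' := by
        rintro b _ ⟨v, hv, hv0, rfl⟩
        exact ⟨b • v, N.smul_mem b hv, fun i hi => by simp [hv0 i hi], rfl⟩ }
  have hcomp : ∀ w ∈ N, (∀ i ∉ insert j S, w i = 0) → ∀ b,
      ∃ w' ∈ N, (∀ i ∉ insert j S, w' i = 0) ∧ w' j = DirectSum.decompose 𝒜 (w j) b ∧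
        ∀ i, w' i ∈ 𝒜 (b + τ j - τ i) := by
    intro w hw hw0 b
    refine ⟨_, component_mem_coeffModule hV.graded hT hw (b + τ j), fun i hi => ?_, ?_, fun i =>
      SetLike.coe_mem _⟩
    · simp [hw0 i hi]
    · dsimp only
      rw [add_sub_cancel_right]
  have hJ : J = ⊥ ∨ J = ⊤ := by
    refine h.ideal_eq J ?_ ?_
    · rintro b _ ⟨w, hw, hw0, rfl⟩
      obtain ⟨w', hw', hw0', hj', -⟩ := hcomp w hw hw0 b
      exact ⟨w', hw', hw0', hj'⟩
    · rintro k P hP b x hx ⟨w, hw, hw0, rfl⟩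
      obtain ⟨w', hw', hw0', hj', hdeg⟩ := hcomp w hw hw0 b
      rw [DirectSum.decompose_of_mem_same _ hx] at hj'
      refine ⟨_, der_mem_coeffModule h.skew hV hT hcomm hw' hdeg hP, fun i hi => ?_, ?_⟩
      · simp [hw0' i hi]
      · simp only [hj']
  have hJtop : J = ⊤ := by
    refine hJ.resolve_left fun hb => hnot fun v hv hv0 => hS v hv fun i hi => ?_
    by_cases hij : i = j
    · subst hij
      have : v i ∈ J := ⟨v, hv, hv0, rfl⟩
      rwa [hb] at this
    · exact hv0 i (by simp [hij, hi])
  have h1 : (1 : A) ∈ J := by rw [hJtop]; trivial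
  obtain ⟨w, hw, hw0, hw1⟩ := h1
  obtain ⟨w', hw', hw0', hj', hdeg⟩ := hcomp w hw hw0 0
  rw [hw1, DirectSum.decompose_of_mem_same _ SetLike.GradedOne.one_mem] at hj'
  simp only [zero_add] at hdeg
  refine ⟨w', hw', hj', fun i hi hij => hw0' i (by simp [hij, hi]), fun i => ⟨?_, hdeg i⟩⟩
  refine mem_constants_iff.2 fun k P hP => ?_
  have hz := hS _ (der_mem_coeffModule h.skew hV hT hcomm hw' hdeg hP) fun i hi => by
    by_cases hij : i = j
    · subst hij
      simp only [hj', colorDer_apply_one hP.2]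
    · simp [hw0' i (by simp [hij, hi])]
  exact congrFun hz i

/-- Either `V` contains all the spaces `A T j`, or the coefficient module is annihilated by a
nonzero tuple of homogeneous constants. -/
theorem IsWeylDatum.mem_or_exists_annihilator (h : D.IsWeylDatum) (hV : D.IsAdStable V)
    (hT : ∀ j, T j ∈ homEnd 𝒜 (τ j))
    (hcomm : ∀ k, ∀ P ∈ D.carrier ⊓ colorDer ε 𝒜 k, ∀ j,
      P * T j = (ε k (τ j) : F) • (T j * P)) :
    (∀ j, ∀ a : A, a • T j ∈ V) ∨ ∃ (μ : Γ) (u : ι → A), (∃ j, u j ≠ 0) ∧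
      (∀ j, u j ∈ D.constants ∧ u j ∈ 𝒜 (μ + τ j)) ∧
      ∀ v ∈ coeffModule V T, ∑ j, v j * u j = 0 := by
  classical
  obtain ⟨S, hS, hw⟩ := h.exists_echelon hV hT hcomm
  by_cases hemp : S = ∅
  · left
    subst hemp
    intro j a
    obtain ⟨w, hwN, hwj, hw0, -⟩ := hw j (by simp)
    have := hwN a
    rwa [Finset.sum_eq_single j (fun i _ hij => by simp [hw0 i (by simp) hij]) (by simp), hwj,
      mul_one] at this
  · right
    obtain ⟨s, hs⟩ := Finset.nonempty_iff_ne_empty.2 hemp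
    choose! w hwN hwj hw0 hwc using hw
    have hnt := h.simple.nontrivial
    refine ⟨-τ s, fun j => if j ∈ S then (if j = s then 1 else 0) else - w j s, ⟨s, ?_⟩, ?_, ?_⟩
    · simp [hs]
    · intro j
      dsimp only
      split_ifs with h1 h2
      · subst h2
        rw [neg_add_cancel]
        exact ⟨one_mem _, SetLike.GradedOne.one_mem⟩
      · exact ⟨zero_mem _, zero_mem _⟩
      · refine ⟨neg_mem (hwc j h1 s).1, neg_mem ?_⟩
        have := (hwc j h1 s).2
        rwa [sub_eq_neg_add] at this
    · intro v hv
      have hz := hS (v - ∑ j ∈ Sᶜ, v j • w j)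
        (sub_mem hv (sum_mem fun j hj => Submodule.smul_mem _ _ (hwN j (by simpa using hj)))) ?_
      · have hzs := congrFun hz s
        simp only [Pi.sub_apply, Finset.sum_apply, Pi.smul_apply, smul_eq_mul, Pi.zero_apply] at hzs
        refine Eq.trans ?_ hzs
        beta_reduce
        rw [← Finset.sum_add_sum_compl S, Finset.sum_eq_single s, if_pos hs, if_pos rfl,
          mul_one, sub_eq_add_neg, ← Finset.sum_neg_distrib]
        · congr 1
          refine Finset.sum_congr rfl fun j hj => ?_
          rw [if_neg (by simpa using hj), mul_neg]
        · intro j hj hjs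
          simp [hj, hjs]
        · simp [hs]
      · intro i hi
        simp only [Pi.sub_apply, Finset.sum_apply, Pi.smul_apply, smul_eq_mul]
        rw [Finset.sum_eq_single i, hwj i hi, mul_one, sub_self]
        · intro j hj hji
          rw [hw0 j (by simpa using hj) i hi (Ne.symm hji), mul_zero]
        · simp [hi]

/-- Homogeneous operators which color-commute with `D` and are linearly independent over the
constants are linearly independent over `A`. -/
theorem IsWeylDatum.coeff_eq_zero (h : D.IsWeylDatum)
    (hT : ∀ j, T j ∈ homEnd 𝒜 (τ j))
    (hcomm : ∀ k, ∀ P ∈ D.carrier ⊓ colorDer ε 𝒜 k, ∀ j,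
      P * T j = (ε k (τ j) : F) • (T j * P))
    (hind : LinearIndependent D.constants T) {v : ι → A} (hv : ∑ j, v j • T j = 0) : v = 0 := by
  obtain ⟨S, hS, hw⟩ := h.exists_echelon D.isAdStable_bot hT hcomm
  have hvN : v ∈ coeffModule ⊥ T := fun a => by
    rw [Submodule.mem_bot]
    simp only [mul_smul]
    rw [← Finset.smul_sum, hv, smul_zero]
  refine hS v hvN fun j hj => ?_
  exfalso
  obtain ⟨w, hwN, hwj, -, hwc⟩ := hw j hj
  have h0 : ∑ i, (⟨w i, (hwc i).1⟩ : D.constants) • T i = 0 := by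
    have := hwN 1
    rw [Submodule.mem_bot] at this
    simp only [one_mul] at this
    exact this
  have h1 := Fintype.linearIndependent_iff.1 hind _ h0 j
  have h2 : w j = 0 := congrArg Subtype.val h1
  have hnt := h.simple.nontrivial
  exact one_ne_zero (hwj.symm.trans h2)

end Coeff

end GradedDerSubspace
end Descent
end WeylColor

namespace WeylColor

/-! ### Multi-indices -/

section Exponents

variable {Γ F I : Type*} [AddCommGroup Γ] [DecidableEq Γ] [Field F] {ε : Γ → Γ → Fˣ} {c : I → Γ}

theorem exists_eq_add_single {α : I →₀ ℕ} {i : I} (hi : α i ≠ 0) :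
    α = (α - Finsupp.single i 1) + Finsupp.single i 1 := by
  refine (tsub_add_cancel_of_le ?_).symm
  rw [Finsupp.single_le_iff]
  omega

theorem degree_add_single (α : I →₀ ℕ) (i : I) :
    (α + Finsupp.single i 1).degree = α.degree + 1 := by
  rw [map_add, Finsupp.degree_single]

theorem degree_sub_single {α : I →₀ ℕ} {i : I} (hi : α i ≠ 0) :
    (α - Finsupp.single i 1).degree + 1 = α.degree := by
  rw [← degree_add_single, ← exists_eq_add_single hi]

theorem exists_apply_ne_zero {α : I →₀ ℕ} (h : α.degree ≠ 0) : ∃ i, α i ≠ 0 := by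
  by_contra hn
  push Not at hn
  have h0 : α = 0 := Finsupp.ext hn
  exact h (by rw [h0, map_zero])

theorem multiIndex_induction {p : (I →₀ ℕ) → Prop} (zero : p 0)
    (add_single : ∀ α i, p α → p (α + Finsupp.single i 1)) (α : I →₀ ℕ) : p α := by
  induction hn : α.degree generalizing α with
  | zero =>
    rw [Finsupp.degree_eq_zero_iff] at hn
    rwa [hn]
  | succ n ih =>
    obtain ⟨i, hi⟩ := exists_apply_ne_zero (α := α) (by omega)
    rw [exists_eq_add_single hi]
    exact add_single _ _ (ih _ (by have := degree_sub_single hi; omega))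

theorem exponents_mono {α β : I →₀ ℕ} (hβ : β ∈ exponents ε c) (h : α ≤ β) :
    α ∈ exponents ε c :=
  fun i => ⟨fun hp => (h i).trans ((hβ i).1 hp), fun hi => (h i).trans ((hβ i).2 hi)⟩

theorem zero_mem_exponents : (0 : I →₀ ℕ) ∈ exponents ε c := fun i => by simp

theorem sub_single_mem_exponents {α : I →₀ ℕ} (hα : α ∈ exponents ε c) (i : I) :
    α - Finsupp.single i 1 ∈ exponents ε c :=
  exponents_mono hα tsub_le_self

theorem three_le_ringChar (hF : ringChar F ≠ 2) (h0 : ringChar F ≠ 0) : 3 ≤ ringChar F := by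
  have := ((CharP.char_is_prime_or_zero F (ringChar F)).resolve_right h0).two_le
  omega

theorem single_mem_exponents (hF : ringChar F ≠ 2) (i : I) :
    Finsupp.single i 1 ∈ exponents ε c := by
  intro j
  have : Finsupp.single i 1 j ≤ 1 := by
    classical
    rw [Finsupp.single_apply]; split_ifs <;> simp
  refine ⟨fun hp => ?_, fun _ => this⟩
  have := three_le_ringChar hF hp
  omega

theorem natCast_exponent_ne_zero {α : I →₀ ℕ} (hα : α ∈ exponents ε c) {i : I} (hi : α i ≠ 0) :
    (α i : F) ≠ 0 := by
  intro h
  rw [ringChar.spec] at h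
  by_cases hp : ringChar F = 0
  · rw [hp, zero_dvd_iff] at h
    exact hi h
  · have h1 := (hα i).1 hp
    have h2 := Nat.le_of_dvd (by omega) h
    omega

/-- A multi-index which cannot be raised in any direction dominates all multi-indices. -/
theorem le_of_forall_notMem {β : I →₀ ℕ} (hβ : β ∈ exponents ε c)
    (h : ∀ i, β + Finsupp.single i 1 ∉ exponents ε c) {α : I →₀ ℕ} (hα : α ∈ exponents ε c) :
    α ≤ β := by
  classical
  intro i
  by_contra hlt
  push Not at hlt
  refine h i fun j => ?_
  by_cases hij : i = j
  · subst hij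
    have : (β + Finsupp.single i 1 : I →₀ ℕ) i ≤ α i := by simp; omega
    exact ⟨fun hp => this.trans ((hα i).1 hp), fun hi => this.trans ((hα i).2 hi)⟩
  · have : (β + Finsupp.single i 1 : I →₀ ℕ) j = β j := by simp [hij]
    rw [this]
    exact hβ j

theorem degree_mono {α β : I →₀ ℕ} (h : α ≤ β) : α.degree ≤ β.degree := by
  rw [← tsub_add_cancel_of_le h, map_add]
  omega

/-- The color of `d ^ α`. -/
noncomputable def colorDeg (c : I → Γ) : (I →₀ ℕ) →+ Γ :=
  (Finsupp.linearCombination ℕ c).toAddMonoidHom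

theorem colorDeg_single (c : I → Γ) (i : I) : colorDeg c (Finsupp.single i 1) = c i := by
  simp [colorDeg]

theorem colorDeg_sub_single {α : I →₀ ℕ} {i : I} (hi : α i ≠ 0) :
    colorDeg c (α - Finsupp.single i 1) + c i = colorDeg c α := by
  rw [← colorDeg_single c i, ← map_add, ← exists_eq_add_single hi]

end Exponents

section PrimePower

variable {Γ F A : Type*} [AddCommGroup Γ] [DecidableEq Γ] [Field F] [Ring A] [Algebra F A]
  {ε : Γ → Γ → Fˣ} {𝒜 : Γ → Submodule F A} [GradedAlgebra 𝒜]

theorem pow_mem_homEnd {k : Γ} {T : Module.End F A} (hT : T ∈ homEnd 𝒜 k) (n : ℕ) :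
    T ^ n ∈ homEnd 𝒜 (n • k) := by
  induction n with
  | zero => rw [pow_zero, zero_smul]; exact one_mem_homEnd
  | succ n ih => rw [pow_succ, succ_nsmul]; exact mul_mem_homEnd ih hT

open TensorProduct in
/-- In characteristic `p`, the `p`-th power of a color derivation whose color is not in `Γ₋` is a
color derivation: the color Leibniz rule reads `T ∘ μ = μ ∘ (T ⊗ 1 + σ ⊗ T)`, where `μ` is the
multiplication of `A` and `σ` the action of the color of `T`, and the two summands commute. -/
theorem pow_char_mem_colorDer (hε : IsSkewBicharacter ε) {k : Γ} (hk : ε k k = 1)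
    (hp : ringChar F ≠ 0) {T : Module.End F A} (hT : T ∈ colorDer ε 𝒜 k) :
    T ^ ringChar F ∈ colorDer ε 𝒜 (ringChar F • k) := by
  set p := ringChar F with hpdef
  have hprime : p.Prime := (CharP.char_is_prime_or_zero F p).resolve_right hp
  refine ⟨pow_mem_homEnd hT.1 p, fun a b x hx y _ => ?_⟩
  set σ : Module.End F A := scale ε 𝒜 k with hσ
  have hσT : σ * T = T * σ := by
    refine end_ext (𝒜 := 𝒜) fun b z hz => ?_
    simp only [Module.End.mul_apply]
    rw [hσ, scale_of_mem ε 𝒜 k hz, scale_of_mem ε 𝒜 k (hT.1 b z hz), map_smul, hε.add_right, hk,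
      one_mul]
  let X : Module.End F (A ⊗[F] A) := TensorProduct.map T 1
  let Y : Module.End F (A ⊗[F] A) := TensorProduct.map σ T
  have hXY : Commute X Y := by
    change X * Y = Y * X
    rw [← TensorProduct.map_mul, ← TensorProduct.map_mul, hσT, one_mul, mul_one]
  have hleib : T ∘ₗ LinearMap.mul' F A = LinearMap.mul' F A ∘ₗ (X + Y) := by
    refine TensorProduct.ext' fun x y => ?_
    induction x using DirectSum.Decomposition.inductionOn 𝒜 with
    | zero => simp
    | @homogeneous a m =>
      simp [X, Y, hσ, GradedDerSubspace.colorDer_apply_mul hT m.2, scale_of_mem ε 𝒜 k m.2]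
    | add m m' h h' =>
      rw [TensorProduct.add_tmul, map_add, h, h', map_add]
  have hpow : ∀ n : ℕ, (T ^ n) ∘ₗ LinearMap.mul' F A = LinearMap.mul' F A ∘ₗ ((X + Y) ^ n) := by
    intro n
    induction n with
    | zero => rfl
    | succ n ih =>
      rw [pow_succ, pow_succ, Module.End.mul_eq_comp, Module.End.mul_eq_comp, LinearMap.comp_assoc,
        hleib, ← LinearMap.comp_assoc, ih, LinearMap.comp_assoc]
  have hsum : (X + Y) ^ p = X ^ p + Y ^ p := by
    obtain ⟨r, hr⟩ := hXY.exists_add_pow_prime_eq hprime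
    have hp0 : ((p : ℕ) : Module.End F (A ⊗[F] A)) = 0 := by
      rw [← map_natCast (algebraMap F (Module.End F (A ⊗[F] A))), hpdef, ringChar.Nat.cast_ringChar,
        map_zero]
    rw [hr, hp0, zero_mul, zero_mul, zero_mul, add_zero]
  have hσn : ∀ n : ℕ, (σ ^ n) x = (ε (n • k) a : F) • x := by
    intro n
    induction n with
    | zero => simp [hε.zero_left]
    | succ n ih =>
      rw [pow_succ', Module.End.mul_apply, ih, map_smul, hσ, scale_of_mem ε 𝒜 k hx, smul_smul,
        succ_nsmul, hε.add_left, Units.val_mul]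
  have h := LinearMap.congr_fun (hpow p) (x ⊗ₜ y)
  rw [hsum] at h
  simp only [X, Y, TensorProduct.map_pow, one_pow] at h
  simpa [hσn] using h

end PrimePower

section Monomials

variable {Γ F A I : Type*} [AddCommGroup Γ] [DecidableEq Γ] [Field F] [Ring A] [Algebra F A]
  {ε : Γ → Γ → Fˣ} {𝒜 : Γ → Submodule F A} [GradedAlgebra 𝒜] {D : GradedDerSubspace ε 𝒜}
  {d : I → Module.End F A} {c : I → Γ}

open GradedDerSubspace

/-- The standing assumptions, together with a homogeneous basis of `𝒟`. -/
structure IsWeylBasis (D : GradedDerSubspace ε 𝒜) (d : I → Module.End F A) (c : I → Γ) : Prop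
    extends D.IsWeylDatum where
  basis : D.IsHomogeneousBasis d c

namespace IsWeylBasis

/-! ### Basis derivations -/

theorem mem_fullDer (h : IsWeylBasis D d c) (i : I) : d i ∈ D.fullDer := by
  have : d i ∈ (D.fullDer : Set (Module.End F A)) := by
    rw [← h.basis.span_eq]
    exact Submodule.subset_span ⟨i, rfl⟩
  exact this

theorem mem_span (h : IsWeylBasis D d c) {T : Module.End F A} (hT : T ∈ D.fullDer) :
    T ∈ Submodule.span D.constants (Set.range d) := by
  have : T ∈ (Submodule.span D.constants (Set.range d) : Set (Module.End F A)) := by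
    rw [h.basis.span_eq]; exact hT
  exact this

theorem mem_constantWeyl (h : IsWeylBasis D d c) (i : I) : d i ∈ D.constantWeyl :=
  (h.mem_fullDer i).2

theorem mem_colorDer (h : IsWeylBasis D d c) (i : I) : d i ∈ colorDer ε 𝒜 (c i) :=
  mem_of_mem_iSup (G := colorDer ε 𝒜) (fun _ _ hT => hT.1) (h.mem_fullDer i).1
    (h.basis.homogeneous i)

theorem apply_constant (h : IsWeylBasis D d c) (i : I) {u : A} (hu : u ∈ D.constants) :
    d i u = 0 := by
  classical
  rw [← DirectSum.sum_support_decompose 𝒜 u, map_sum]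
  refine Finset.sum_eq_zero fun a _ => ?_
  have h1 := mul_lmul_constant h.skew h.comm D (SetLike.coe_mem _) (decompose_mem_constants hu a)
    (D.constantWeyl_le_weyl (h.mem_constantWeyl i)) (h.basis.homogeneous i)
  have h2 := LinearMap.congr_fun h1 1
  simpa [colorDer_apply_one (h.mem_colorDer i)] using h2

theorem mul_comm' (h : IsWeylBasis D d c) (i j : I) :
    d i * d j = (ε (c i) (c j) : F) • (d j * d i) :=
  h.constantWeyl_comm (h.mem_constantWeyl i) (h.basis.homogeneous i) (h.mem_constantWeyl j)
    (h.basis.homogeneous j)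

theorem mul_self (h : IsWeylBasis D d c) {i : I} (hi : ε (c i) (c i) = -1) : d i * d i = 0 := by
  have h1 := h.mul_comm' i i
  rw [hi, Units.val_neg, Units.val_one] at h1
  generalize d i * d i = Q at h1 ⊢
  have h2 : (2 : F) • Q = 0 := by
    rw [two_smul]
    nth_rewrite 1 [h1]
    module
  exact (smul_eq_zero.1 h2).resolve_left h.two_ne_zero

theorem mem_fullDer_of_mem {k : Γ} {P : Module.End F A}
    (hP : P ∈ D.carrier ⊓ colorDer ε 𝒜 k) : P ∈ D.fullDer :=
  ⟨Submodule.mem_iSup_of_mem k hP.2, Algebra.subset_adjoin (Or.inr hP.1)⟩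

theorem pow_char_mem_fullDer (h : IsWeylBasis D d c) {i : I} (hi : ε (c i) (c i) = 1)
    (hp : ringChar F ≠ 0) : d i ^ ringChar F ∈ D.fullDer :=
  ⟨Submodule.mem_iSup_of_mem _ (pow_char_mem_colorDer h.skew hi hp (h.mem_colorDer i)),
    pow_mem (h.mem_constantWeyl i) _⟩

/-! ### Monomials -/

variable [LinearOrder I]

theorem mul_pow_comm (h : IsWeylBasis D d c) (i j : I) (n : ℕ) :
    ∃ u : Fˣ, d i * d j ^ n = (u : F) • (d j ^ n * d i) := by
  induction n with
  | zero => exact ⟨1, by simp⟩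
  | succ n ih =>
    obtain ⟨u, hu⟩ := ih
    refine ⟨u * ε (c i) (c j), ?_⟩
    rw [pow_succ, ← mul_assoc, hu, smul_mul_assoc, mul_assoc, h.mul_comm' i j, mul_smul_comm,
      smul_smul, mul_assoc, Units.val_mul]

theorem mul_list_prod (h : IsWeylBasis D d c) (i : I) (β : I →₀ ℕ) (l : List I) (hl : l.Nodup)
    (hi : i ∈ l) : ∃ u : Fˣ, d i * (l.map fun j => d j ^ β j).prod =
      (u : F) • (l.map fun j => d j ^ (β + Finsupp.single i 1 : I →₀ ℕ) j).prod := by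
  induction l with
  | nil => simp at hi
  | cons j l ih =>
    rw [List.nodup_cons] at hl
    by_cases hij : i = j
    · subst hij
      refine ⟨1, ?_⟩
      simp only [List.map_cons, List.prod_cons, Units.val_one, one_smul]
      rw [← mul_assoc, ← pow_succ', Finsupp.add_apply, Finsupp.single_eq_same]
      congr 2
      refine List.map_congr_left fun k hk => ?_
      have : k ≠ i := fun hki => hl.1 (hki ▸ hk)
      simp [Ne.symm this]
    · obtain ⟨u, hu⟩ := ih hl.2 ((List.mem_cons.1 hi).resolve_left hij)
      obtain ⟨v, hv⟩ := h.mul_pow_comm i j (β j)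
      refine ⟨v * u, ?_⟩
      simp only [List.map_cons, List.prod_cons]
      rw [← mul_assoc, hv, smul_mul_assoc, mul_assoc, hu, mul_smul_comm, smul_smul,
        Finsupp.add_apply, Finsupp.single_apply, if_neg hij, add_zero, Units.val_mul]

theorem monomial_eq_of_subset (d : I → Module.End F A) {α : I →₀ ℕ} {s : Finset I}
    (hs : α.support ⊆ s) : (s.sort.map fun i => d i ^ α i).prod = monomial d α := by
  have hfil : s.sort.filter (fun i => α i ≠ 0) = α.support.sort := by
    refine List.Perm.eq_of_pairwise (le := (· ≤ ·)) (fun a b _ _ => le_antisymm)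
      ((Finset.pairwise_sort s _).filter _) (Finset.pairwise_sort _ _) ?_
    rw [List.perm_ext_iff_of_nodup ((Finset.sort_nodup _ _).filter _) (Finset.sort_nodup _ _)]
    intro i
    simp only [List.mem_filter, Finset.mem_sort, decide_eq_true_eq, Finsupp.mem_support_iff]
    exact ⟨fun h => h.2, fun h => ⟨hs (Finsupp.mem_support_iff.2 h), h⟩⟩
  rw [monomial, ← hfil]
  generalize s.sort = l
  induction l with
  | nil => rfl
  | cons i l ih =>
    by_cases hi : α i = 0
    · rw [List.filter_cons_of_neg (by simpa using hi), ← ih, List.map_cons, List.prod_cons, hi,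
        pow_zero, one_mul]
    · rw [List.filter_cons_of_pos (by simpa using hi), List.map_cons, List.map_cons,
        List.prod_cons, List.prod_cons, ih]

theorem mul_monomial (h : IsWeylBasis D d c) (i : I) (β : I →₀ ℕ) :
    ∃ u : Fˣ, d i * monomial d β = (u : F) • monomial d (β + Finsupp.single i 1) := by
  classical
  have h1 : β.support ⊆ insert i β.support := Finset.subset_insert _ _
  have h2 : (β + Finsupp.single i 1).support ⊆ insert i β.support := by
    refine Finsupp.support_add.trans (Finset.union_subset h1 ?_)
    exact Finsupp.support_single_subset.trans (by simp)
  rw [← monomial_eq_of_subset d h1, ← monomial_eq_of_subset d h2]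
  exact h.mul_list_prod i β _ (Finset.sort_nodup _ _) (by simp)

theorem monomial_zero (d : I → Module.End F A) : monomial d 0 = 1 := by simp [monomial]

theorem monomial_add_single (h : IsWeylBasis D d c) (i : I) (β : I →₀ ℕ) :
    ∃ u : Fˣ, monomial d (β + Finsupp.single i 1) = (u : F) • (d i * monomial d β) := by
  obtain ⟨u, hu⟩ := h.mul_monomial i β
  exact ⟨u⁻¹, by rw [hu, smul_smul, ← Units.val_mul, inv_mul_cancel, Units.val_one, one_smul]⟩

theorem monomial_single (d : I → Module.End F A) (i : I) :
    monomial d (Finsupp.single i 1) = d i := by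
  have := monomial_eq_of_subset d (α := Finsupp.single i 1) (s := {i})
    Finsupp.support_single_subset
  rw [← this]
  simp

theorem monomial_mem_constantWeyl (h : IsWeylBasis D d c) (α : I →₀ ℕ) :
    monomial d α ∈ D.constantWeyl := by
  induction α using multiIndex_induction with
  | zero => rw [monomial_zero]; exact one_mem _
  | add_single α i ih =>
    obtain ⟨u, hu⟩ := h.monomial_add_single i α
    rw [hu]
    exact Subalgebra.smul_mem _ (mul_mem (h.mem_constantWeyl i) ih) _

theorem monomial_mem_homEnd (h : IsWeylBasis D d c) (α : I →₀ ℕ) :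
    monomial d α ∈ homEnd 𝒜 (colorDeg c α) := by
  induction α using multiIndex_induction with
  | zero => rw [monomial_zero, map_zero]; exact one_mem_homEnd
  | add_single α i ih =>
    obtain ⟨u, hu⟩ := h.monomial_add_single i α
    rw [hu, map_add, colorDeg_single, add_comm]
    exact Submodule.smul_mem _ _ (mul_mem_homEnd (h.basis.homogeneous i) ih)

theorem pow_mul_monomial (h : IsWeylBasis D d c) (i : I) (n : ℕ) (β : I →₀ ℕ) :
    ∃ u : Fˣ, monomial d (β + Finsupp.single i n) = (u : F) • (d i ^ n * monomial d β) := by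
  induction n with
  | zero => exact ⟨1, by simp⟩
  | succ n ih =>
    obtain ⟨u, hu⟩ := ih
    obtain ⟨v, hv⟩ := h.monomial_add_single i (β + Finsupp.single i n)
    refine ⟨v * u, ?_⟩
    rw [Finsupp.single_add, ← add_assoc, hv, hu, mul_smul_comm, smul_smul, ← mul_assoc,
      ← pow_succ', Units.val_mul]

/-! ### The filtration by the order -/

/-- The left `A`-submodule of `End(A)` spanned by the monomials `d ^ α`, `α ∈ 𝒥`, `|α| < n`. -/
noncomputable def filt (ε : Γ → Γ → Fˣ) (d : I → Module.End F A) (c : I → Γ) (n : ℕ) :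
    Submodule A (Module.End F A) :=
  Submodule.span A (monomial d '' {α | α ∈ exponents ε c ∧ α.degree < n})

theorem monomial_mem_filt {α : I →₀ ℕ} (hα : α ∈ exponents ε c) {n : ℕ} (hn : α.degree < n) :
    monomial d α ∈ filt ε d c n :=
  Submodule.subset_span ⟨α, ⟨hα, hn⟩, rfl⟩

theorem filt_mono {m n : ℕ} (hmn : m ≤ n) : filt ε d c m ≤ filt ε d c n :=
  Submodule.span_mono (Set.image_mono fun _ hα => ⟨hα.1, hα.2.trans_le hmn⟩)

theorem filt_zero : filt ε d c 0 = ⊥ := by simp [filt]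

theorem smul_mem_of_mem {N : Submodule A (Module.End F A)} (r : F) {T : Module.End F A}
    (hT : T ∈ N) : r • T ∈ N := by
  have : r • T = (algebraMap F A r) • T := by ext x; simp
  rw [this]
  exact N.smul_mem _ hT

theorem mul_mem_of_span {k : Γ} {P : Module.End F A} (hP : P ∈ colorDer ε 𝒜 k)
    {s : Set (Module.End F A)} {N : Submodule A (Module.End F A)}
    (hs : ∀ S ∈ s, S ∈ N ∧ P * S ∈ N) {T : Module.End F A} (hT : T ∈ Submodule.span A s) :
    P * T ∈ N := by
  have hsub : Submodule.span A s ≤ N := Submodule.span_le.2 fun S hS => (hs S hS).1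
  induction hT using Submodule.span_induction with
  | mem S hS => exact (hs S hS).2
  | zero => simp
  | add S T _ _ hS hT => rw [mul_add]; exact add_mem hS hT
  | smul a S hS ih =>
    induction a using DirectSum.Decomposition.inductionOn 𝒜 with
    | zero => simp
    | @homogeneous r m =>
      rw [colorDer_mul_smul hP m.2]
      exact add_mem (N.smul_mem _ (hsub hS)) (smul_mem_of_mem _ (N.smul_mem _ ih))
    | add m m' h h' => rw [add_smul, mul_add]; exact add_mem h h'

/-- Left multiplication by a basis derivation raises the order by at most one; a monomial which is
not admissible has a smaller order than its degree suggests, as `d i ^ 2 = 0` or `d i ^ p ∈ 𝒟`. -/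
theorem mul_monomial_mem_filt (h : IsWeylBasis D d c) {α : I →₀ ℕ} (hα : α ∈ exponents ε c)
    (i : I) : d i * monomial d α ∈ filt ε d c (α.degree + 2) ∧
      (α + Finsupp.single i 1 ∉ exponents ε c →
        d i * monomial d α ∈ filt ε d c (α.degree + 1)) := by
  induction hn : α.degree using Nat.strong_induction_on generalizing α i with
  | _ n ih =>
  subst hn
  have key : α + Finsupp.single i 1 ∉ exponents ε c →
      d i * monomial d α ∈ filt ε d c (α.degree + 1) := by
    intro hnot
    have hfail : ¬ ((ringChar F ≠ 0 → α i + 1 ≤ ringChar F - 1) ∧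
        (ε (c i) (c i) = -1 → α i + 1 ≤ 1)) := by
      intro hc
      refine hnot fun j => ?_
      by_cases hij : i = j
      · subst hij; simpa using hc
      · simpa [Finsupp.single_apply, hij] using hα j
    by_cases hodd : ε (c i) (c i) = -1
    · have hi : α i ≠ 0 := by
        intro h0
        refine hfail ⟨fun hp => ?_, fun _ => by omega⟩
        have := three_le_ringChar h.char_ne_two hp
        omega
      obtain ⟨u, hu⟩ := h.monomial_add_single i (α - Finsupp.single i 1)
      rw [← exists_eq_add_single hi] at hu
      rw [hu, mul_smul_comm, ← mul_assoc, h.mul_self hodd, zero_mul, smul_zero]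
      exact zero_mem _
    · have heven := (h.skew.self_eq (c i)).resolve_right hodd
      have hp : ringChar F ≠ 0 := fun hp => hfail ⟨fun h => absurd hp h, fun h => absurd h hodd⟩
      have hαi : α i = ringChar F - 1 := by
        have h1 := (hα i).1 hp
        by_contra hne
        exact hfail ⟨fun _ => by omega, fun h => absurd h hodd⟩
      have h3 := three_le_ringChar h.char_ne_two hp
      set β := α - Finsupp.single i (ringChar F - 1) with hβ
      have hαβ : α = β + Finsupp.single i (ringChar F - 1) :=
        (tsub_add_cancel_of_le (by rw [Finsupp.single_le_iff, hαi])).symm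
      have hdeg : α.degree = β.degree + (ringChar F - 1) := by
        rw [hαβ, map_add, Finsupp.degree_single]
      have hβmem : β ∈ exponents ε c := exponents_mono hα tsub_le_self
      obtain ⟨u, hu⟩ := h.pow_mul_monomial i (ringChar F - 1) β
      rw [← hαβ] at hu
      rw [hu, mul_smul_comm, ← mul_assoc, ← pow_succ', Nat.sub_add_cancel (by omega)]
      refine smul_mem_of_mem _ ?_
      have hspan := h.mem_span (h.pow_char_mem_fullDer heven hp)
      generalize d i ^ ringChar F = Q at hspan
      induction hspan using Submodule.span_induction with
      | zero => simp
      | add S T _ _ hS hT => rw [add_mul]; exact add_mem hS hT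
      | smul a S _ hS => exact (filt ε d c _).smul_mem (a : A) hS
      | mem S hS =>
        obtain ⟨j, rfl⟩ := hS
        exact filt_mono (by omega) (ih β.degree (by omega) hβmem j rfl).1
  refine ⟨?_, key⟩
  by_cases hmem : α + Finsupp.single i 1 ∈ exponents ε c
  · obtain ⟨u, hu⟩ := h.mul_monomial i α
    rw [hu]
    exact smul_mem_of_mem _ (monomial_mem_filt hmem (by rw [degree_add_single]; omega))
  · exact filt_mono (by omega) (key hmem)

theorem mul_mem_filt (h : IsWeylBasis D d c) (i : I) {n : ℕ} {T : Module.End F A}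
    (hT : T ∈ filt ε d c n) : d i * T ∈ filt ε d c (n + 1) := by
  refine mul_mem_of_span (h.mem_colorDer i) ?_ hT
  rintro _ ⟨α, ⟨hα, hn⟩, rfl⟩
  exact ⟨monomial_mem_filt hα (by omega), filt_mono (by omega) (h.mul_monomial_mem_filt hα i).1⟩

theorem fullDer_mul_mem_filt (h : IsWeylBasis D d c) {P : Module.End F A} (hP : P ∈ D.fullDer)
    {n : ℕ} {T : Module.End F A} (hT : T ∈ filt ε d c n) : P * T ∈ filt ε d c (n + 1) := by
  have hspan := h.mem_span hP
  clear hP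
  induction hspan using Submodule.span_induction with
  | zero => simp
  | add S T _ _ hS hT => rw [add_mul]; exact add_mem hS hT
  | smul a S _ hS => exact (filt ε d c _).smul_mem (a : A) hS
  | mem S hS =>
    obtain ⟨j, rfl⟩ := hS
    exact h.mul_mem_filt j hT

theorem one_mem_filt : (1 : Module.End F A) ∈ filt ε d c 1 := by
  rw [← monomial_zero d]
  exact monomial_mem_filt zero_mem_exponents (by simp)

theorem lmul_mem_filt (a : A) : Algebra.lmul F A a ∈ filt ε d c 1 := by
  rw [lmul_eq_smul_one]
  exact Submodule.smul_mem _ _ one_mem_filt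

theorem mem_filt_one {T : Module.End F A} (hT : T ∈ filt ε d c 1) : T = Algebra.lmul F A (T 1) := by
  induction hT using Submodule.span_induction with
  | zero => simp
  | add S T _ _ hS hT =>
    rw [LinearMap.add_apply, map_add, ← hS, ← hT]
  | smul a S _ hS =>
    rw [LinearMap.smul_apply, smul_eq_mul, map_mul, ← hS]; rfl
  | mem S hS =>
    obtain ⟨α, ⟨-, h1⟩, rfl⟩ := hS
    have : α = 0 := (Finsupp.degree_eq_zero_iff α).1 (by omega)
    rw [this, monomial_zero, Module.End.one_apply, map_one]

/-- The filtration exhausts `A[D]`. -/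
theorem exists_mem_filt (h : IsWeylBasis D d c) {T : Module.End F A} (hT : T ∈ D.weyl) :
    ∃ n, T ∈ filt ε d c n := by
  have key : ∀ T ∈ D.weyl, ∀ n, ∀ S ∈ filt ε d c n, ∃ m, T * S ∈ filt ε d c m := by
    intro T hT
    induction hT using Algebra.adjoin_induction with
    | algebraMap r =>
      intro n S hS
      refine ⟨n, ?_⟩
      rw [← Algebra.smul_def]
      exact smul_mem_of_mem r hS
    | add T T' _ _ h1 h2 =>
      intro n S hS
      obtain ⟨m, hm⟩ := h1 n S hS
      obtain ⟨m', hm'⟩ := h2 n S hS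
      refine ⟨max m m', ?_⟩
      rw [add_mul]
      exact add_mem (filt_mono (le_max_left _ _) hm) (filt_mono (le_max_right _ _) hm')
    | mul T T' _ _ h1 h2 =>
      intro n S hS
      obtain ⟨m, hm⟩ := h2 n S hS
      rw [mul_assoc]
      exact h1 m _ hm
    | mem T hT =>
      intro n S hS
      rcases hT with ⟨a, rfl⟩ | hT
      · exact ⟨n, (filt ε d c n).smul_mem a hS⟩
      · refine ⟨n + 1, h.fullDer_mul_mem_filt ⟨?_, Algebra.subset_adjoin (Or.inr hT)⟩ hS⟩
        have := D.graded hT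
        exact (iSup_mono fun _ => inf_le_right :
          (⨆ k, D.carrier ⊓ colorDer ε 𝒜 k) ≤ ⨆ k, colorDer ε 𝒜 k) this
  simpa using key T hT 1 1 one_mem_filt

end IsWeylBasis
end Monomials
end WeylColor

namespace WeylColor

section Symbol

variable {Γ F A I : Type*} [AddCommGroup Γ] [DecidableEq Γ] [Field F] [Ring A] [Algebra F A]
  {ε : Γ → Γ → Fˣ} {𝒜 : Γ → Submodule F A} [GradedAlgebra 𝒜] {D : GradedDerSubspace ε 𝒜}
  {d : I → Module.End F A} {c : I → Γ}

open GradedDerSubspace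

/-- The color commutator of homogeneous operators of degrees `j` and `k`. -/
def colorBr (ε : Γ → Γ → Fˣ) (j k : Γ) (S T : Module.End F A) : Module.End F A :=
  S * T - (ε j k : F) • (T * S)

theorem colorBr_mem_homEnd {j k : Γ} {S T : Module.End F A} (hS : S ∈ homEnd 𝒜 j)
    (hT : T ∈ homEnd 𝒜 k) : colorBr ε j k S T ∈ homEnd 𝒜 (j + k) := by
  refine sub_mem (mul_mem_homEnd hS hT) (Submodule.smul_mem _ _ ?_)
  rw [add_comm]
  exact mul_mem_homEnd hT hS

/-- The color commutator with a multiplication is linear over `A` in the first argument. -/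
theorem colorBr_smul_lmul (hε : IsSkewBicharacter ε) (hA : IsColorCommutative ε 𝒜) {r s b : Γ}
    {a x : A} (ha : a ∈ 𝒜 r) (hx : x ∈ 𝒜 b) (S : Module.End F A) :
    colorBr ε (r + s) b (a • S) (Algebra.lmul F A x) =
      a • colorBr ε s b S (Algebra.lmul F A x) := by
  rw [colorBr, colorBr, smul_mul_end, smul_sub, lmul_mul_eq_smul, lmul_mul_eq_smul, smul_smul,
    smul_comm a (ε s b : F) (x • S), smul_smul a x S, hA r b a ha x hx, smul_assoc, smul_smul,
    hε.add_left, Units.val_mul, mul_comm (ε r b : F)]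

/-- The color commutator of a derivation with `a T`, if the derivation color-commutes with `T`. -/
theorem colorBr_der_smul (hε : IsSkewBicharacter ε) {k r s : Γ} {P T : Module.End F A}
    (hP : P ∈ colorDer ε 𝒜 k) (hPT : P * T = (ε k s : F) • (T * P)) {a : A} (ha : a ∈ 𝒜 r) :
    colorBr ε k (r + s) P (a • T) = P a • T := by
  rw [colorBr, colorDer_mul_smul hP ha, hPT, smul_mul_end, smul_comm a (ε k s : F), smul_smul,
    ← Units.val_mul, ← hε.add_right, add_sub_cancel_right]

namespace IsWeylBasis

variable [LinearOrder I]

/-! ### Leading terms and linear independence of the monomials -/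

/-- The leading terms of `d ^ α ∘ x`: up to order `|α| - 2`, it is
`x d ^ α + ∑ j, α j κ j (d j) x d ^ (α - e j)` up to color factors, where `κ j` is the scalar by
which `d ^ α` differs from `d j * d ^ (α - e j)`. -/
theorem monomial_mul_lmul (h : IsWeylBasis D d c) {α : I →₀ ℕ} (hα : α ∈ exponents ε c) :
    ∃ κ : I → F, (∀ j, α j ≠ 0 → κ j ≠ 0 ∧
        monomial d α = κ j • (d j * monomial d (α - Finsupp.single j 1))) ∧
      ∀ b, ∀ x ∈ 𝒜 b, colorBr ε (colorDeg c α) b (monomial d α) (Algebra.lmul F A x) -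
        (ε (colorDeg c α) b : F) • ∑ j ∈ α.support, ((α j : F) * κ j * ε b (c j)) •
          (d j x) • monomial d (α - Finsupp.single j 1) ∈ filt ε d c (α.degree - 1) := by
  classical
  induction α using multiIndex_induction with
  | zero =>
    refine ⟨fun _ => 1, by simp, fun b x _ => ?_⟩
    rw [monomial_zero, colorBr]
    simp [h.skew.zero_left]
  | add_single β i ih =>
    have hβ : β ∈ exponents ε c := exponents_mono hα (le_add_of_nonneg_right zero_le)
    obtain ⟨κ, hκ, hx⟩ := ih hβ
    obtain ⟨u, hu⟩ := h.monomial_add_single i β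
    choose v hv using fun j => h.mul_monomial i (β - Finsupp.single j 1)
    set α := β + Finsupp.single i 1 with hαdef
    have hαi : α - Finsupp.single i 1 = β := add_tsub_cancel_right _ _
    have hαj : ∀ j, β j ≠ 0 → β - Finsupp.single j 1 + Finsupp.single i 1 =
        α - Finsupp.single j 1 := fun j hj =>
      (tsub_add_eq_add_tsub (by rw [Finsupp.single_le_iff]; omega))
    have hii : α i = β i + 1 := by simp [hαdef]
    have hij : ∀ j, j ≠ i → α j = β j := fun j hj => by simp [hαdef, Ne.symm hj]
    have hself : β i ≠ 0 → ε (c i) (c i) = 1 := fun h0 =>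
      (h.skew.self_eq _).resolve_right fun hodd => by
        have := (hα i).2 hodd
        omega
    let κ' : I → F := fun j => if j = i then u else u * κ j * ε (c i) (c j) * v j
    refine ⟨κ', fun j hj => ?_, fun b x hxb => ?_⟩
    · by_cases hji : j = i
      · subst hji
        simp only [κ', if_true]
        exact ⟨Units.ne_zero _, by rw [hαi, hu]⟩
      · rw [hij j hji] at hj
        simp only [κ', if_neg hji]
        refine ⟨mul_ne_zero (mul_ne_zero (mul_ne_zero (Units.ne_zero _) (hκ j hj).1)
          (Units.ne_zero _)) (Units.ne_zero _), ?_⟩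
        have h1 : (v j : F) • (d j * monomial d (α - Finsupp.single j 1)) =
            d j * (d i * monomial d (β - Finsupp.single j 1)) := by
          rw [hv j, hαj j hj, mul_smul_comm]
        rw [mul_smul, h1, ← mul_assoc, mul_smul, ← smul_mul_assoc, ← h.mul_comm' i j, mul_smul, hu,
          mul_assoc]
        congr 1
        rw [← mul_smul_comm, ← (hκ j hj).2]
    · set E : Module.End F A := ∑ j ∈ β.support, ((β j : F) * κ j * ε b (c j)) •
          (d j x) • monomial d (β - Finsupp.single j 1) with hE
      have hlow : d i * (colorBr ε (colorDeg c β) b (monomial d β) (Algebra.lmul F A x) -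
          (ε (colorDeg c β) b : F) • E) ∈ filt ε d c (α.degree - 1) := by
        have h1 := h.mul_mem_filt i (hx b x hxb)
        rcases Nat.eq_zero_or_pos β.degree with h0 | h0
        · have h2 := hx b x hxb
          rw [h0, filt_zero, Submodule.mem_bot] at h2
          rw [h2, mul_zero]
          exact zero_mem _
        · rwa [show β.degree - 1 + 1 = α.degree - 1 by
            rw [hαdef, degree_add_single]; omega] at h1
      -- the terms of `d i * E` in which `d i` does not meet the coefficient
      set E' : Module.End F A := ∑ j ∈ α.support, ((β j : F) * κ j * ε b (c j) *
          ε (c i) (c j + b)) • (d j x) • (d i * monomial d (β - Finsupp.single j 1)) with hE'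
      have hEE' : d i * E - E' ∈ filt ε d c (α.degree - 1) := by
        have hsub : β.support ⊆ α.support := Finsupp.support_mono (le_add_of_nonneg_right zero_le)
        have : E' = ∑ j ∈ β.support, ((β j : F) * κ j * ε b (c j) *
          ε (c i) (c j + b)) • (d j x) • (d i * monomial d (β - Finsupp.single j 1)) := by
          refine (Finset.sum_subset hsub fun j _ hj => ?_).symm
          rw [Finsupp.notMem_support_iff.1 hj]
          simp
        rw [this, hE, Finset.mul_sum, ← Finset.sum_sub_distrib]
        refine sum_mem fun j hj => ?_
        have hj0 : β j ≠ 0 := Finsupp.mem_support_iff.1 hj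
        rw [mul_smul_comm, colorDer_mul_smul (h.mem_colorDer i) ((h.mem_colorDer j).1 b x hxb),
          smul_add, smul_smul, add_sub_cancel_right]
        refine smul_mem_of_mem _ (Submodule.smul_mem _ _
          (monomial_mem_filt (sub_single_mem_exponents hβ j) ?_))
        have := degree_sub_single hj0
        rw [hαdef, degree_add_single]
        omega
      have hsum : (ε (c i) b : F) • ∑ j ∈ α.support, ((α j : F) * κ' j * ε b (c j)) •
            (d j x) • monomial d (α - Finsupp.single j 1) =
          (u : F) • ((d i x) • monomial d β + E') := by
        have hterm : ∀ j ∈ α.support, ((α j : F) * κ' j * ε b (c j)) •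
            (d j x) • monomial d (α - Finsupp.single j 1) =
          ((u : F) * ε b (c i)) • ((β j : F) * κ j * ε b (c j) * ε (c i) (c j + b)) • (d j x) •
              (d i * monomial d (β - Finsupp.single j 1)) +
            if j = i then ((u : F) * ε b (c i)) • (d i x) • monomial d β else 0 := by
          intro j _
          have hsw := h.skew.mul_swap b (c i)
          by_cases hji : j = i
          · subst hji
            simp only [κ', if_true]
            rw [hαi, hii]
            by_cases hj0 : β j = 0
            · simp [hj0]
            · have hβj := (hκ j hj0).2
              rw [h.skew.add_right, hself hj0, one_mul, smul_smul,
                show (u : F) * ε b (c j) * ((β j : F) * κ j * ε b (c j) * ε (c j) b) =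
                  ((u : F) * ε b (c j) * β j) * κ j by
                    linear_combination (u : F) * ε b (c j) * β j * κ j * hsw,
                mul_smul _ (κ j), smul_comm (κ j) (d j x), ← hβj, ← add_smul]
              congr 1
              push_cast
              ring
          · simp only [κ', if_neg hji, add_zero]
            rw [hij j hji]
            by_cases hj0 : β j = 0
            · simp [hj0]
            · rw [hv j, hαj j hj0, smul_comm (d j x), smul_smul, smul_smul, h.skew.add_right,
                Units.val_mul]
              congr 1
              linear_combination (-(u : F) * β j * κ j * ε b (c j) * ε (c i) (c j) * v j) * hsw
        rw [Finset.sum_congr rfl hterm, Finset.sum_add_distrib, Finset.sum_ite_eq',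
          if_pos (by simp [hii]), ← Finset.smul_sum, ← smul_add, smul_smul, add_comm E' _]
        congr 1
        have hsw := h.skew.mul_swap b (c i)
        linear_combination (u : F) * hsw
      have hαu : colorDeg c α = colorDeg c β + c i := by
        rw [hαdef, map_add, colorDeg_single]
      have hmain : colorBr ε (colorDeg c α) b (monomial d α) (Algebra.lmul F A x) -
          (ε (colorDeg c α) b : F) • ∑ j ∈ α.support, ((α j : F) * κ' j * ε b (c j)) •
            (d j x) • monomial d (α - Finsupp.single j 1) =
          (u : F) • (d i * (colorBr ε (colorDeg c β) b (monomial d β) (Algebra.lmul F A x) -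
            (ε (colorDeg c β) b : F) • E)) +
          (u : F) • ((ε (colorDeg c β) b : F) • (d i * E - E')) := by
        rw [hαu, h.skew.add_left, Units.val_mul, mul_smul (ε (colorDeg c β) b : F), hsum]
        simp only [colorBr]
        rw [hu, lmul_mul_eq_smul, lmul_mul_eq_smul, mul_sub, mul_sub,
          mul_smul_comm (ε (colorDeg c β) b : F), mul_smul_comm (ε (colorDeg c β) b : F),
          colorDer_mul_smul (h.mem_colorDer i) hxb, smul_mul_assoc, mul_assoc, smul_comm x (u : F),
          h.skew.add_left, Units.val_mul]
        generalize x • (d i * monomial d β) = X₁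
        generalize d i x • monomial d β = X₂
        module
      rw [hmain]
      exact add_mem (smul_mem_of_mem _ hlow) (smul_mem_of_mem _ (smul_mem_of_mem _ hEE'))

/-- The basis derivations are linearly independent over `A`. -/
theorem basis_coeff_eq_zero (h : IsWeylBasis D d c) {s : Finset I} {v : s → A}
    (hv : ∑ j : s, v j • d j = 0) : v = 0 :=
  h.coeff_eq_zero (T := fun j : s => d j) (τ := fun j => c j)
    (fun j => h.basis.homogeneous j)
    (fun _ _ hP j => h.constantWeyl_comm (mem_fullDer_of_mem hP).2 hP.2.1 (h.mem_constantWeyl j)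
      (h.basis.homogeneous j))
    (h.basis.linearIndependent.comp _ Subtype.val_injective) hv

theorem colorBr_mem_filt (h : IsWeylBasis D d c) {α : I →₀ ℕ} (hα : α ∈ exponents ε c) {b : Γ}
    {x : A} (hx : x ∈ 𝒜 b) :
    colorBr ε (colorDeg c α) b (monomial d α) (Algebra.lmul F A x) ∈ filt ε d c α.degree := by
  obtain ⟨κ, -, hκ⟩ := h.monomial_mul_lmul hα
  have h1 := filt_mono (Nat.sub_le _ 1) (hκ b x hx)
  refine (Submodule.sub_mem_iff_left _ ?_).1 h1
  refine smul_mem_of_mem _ (sum_mem fun j hj => smul_mem_of_mem _ (Submodule.smul_mem _ _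
    (monomial_mem_filt (sub_single_mem_exponents hα j) ?_)))
  have := degree_sub_single (Finsupp.mem_support_iff.1 hj)
  omega

/-- If the commutators of `∑ a α d ^ α` with the elements of `A` have order at most `n - 1`, then
there are no terms with `|α| = n + 1`. -/
theorem top_coeff_eq_zero (h : IsWeylBasis D d c) (n : ℕ)
    (hind : LinearIndepOn A (monomial d) {α | α ∈ exponents ε c ∧ α.degree < n + 1})
    (s : Finset (I →₀ ℕ)) (hs : ∀ α ∈ s, α ∈ exponents ε c ∧ α.degree ≤ n + 1)
    (a : (I →₀ ℕ) → A) (t : Γ) (ha : ∀ α ∈ s, a α ∈ 𝒜 (t - colorDeg c α))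
    (hT : ∀ b, ∀ x ∈ 𝒜 b,
      colorBr ε t b (∑ α ∈ s, a α • monomial d α) (Algebra.lmul F A x) ∈ filt ε d c n) :
    ∀ α ∈ s, α.degree = n + 1 → a α = 0 := by
  classical
  intro α₀ hα₀ hdeg₀
  obtain ⟨i, hi⟩ := exists_apply_ne_zero (α := α₀) (by omega)
  set β := α₀ - Finsupp.single i 1 with hβ
  have hβdeg : β.degree = n := by have := degree_sub_single hi; rw [← hβ] at this; omega
  choose! κ hκ hκx using fun (α : I →₀ ℕ) (hα : α ∈ exponents ε c) => h.monomial_mul_lmul hα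
  set s' := s.filter (fun α => α.degree = n + 1) with hs'
  set J : Finset I := s'.biUnion Finsupp.support with hJ
  -- the coefficient of the differential `d j x` in the coefficient of `d ^ β`
  set w : I → A := fun j => if β + Finsupp.single j 1 ∈ s' then
    (((β + Finsupp.single j 1 : I →₀ ℕ) j : F) * κ (β + Finsupp.single j 1) j) •
      a (β + Finsupp.single j 1) else 0 with hw
  have hw0 : ∑ j ∈ J, w j • d j = 0 := by
    refine end_ext (𝒜 := 𝒜) fun b x hx => ?_
    -- the coefficients of the leading part of the commutator with `x`
    let C : (I →₀ ℕ) → I → A := fun α j =>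
      ((ε (colorDeg c α) b : F) * ((α j : F) * κ α j * ε b (c j))) • (a α * d j x)
    have hlead : (∑ α ∈ s', ∑ j ∈ α.support, C α j • monomial d (α - Finsupp.single j 1)) ∈
        filt ε d c n := by
      have hall : (∑ α ∈ s, ∑ j ∈ α.support, C α j • monomial d (α - Finsupp.single j 1)) ∈
          filt ε d c n := by
        have hsub : (colorBr ε t b (∑ α ∈ s, a α • monomial d α) (Algebra.lmul F A x) -
            ∑ α ∈ s, ∑ j ∈ α.support, C α j • monomial d (α - Finsupp.single j 1)) ∈
            filt ε d c n := by
          have hexp : colorBr ε t b (∑ α ∈ s, a α • monomial d α) (Algebra.lmul F A x) =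
              ∑ α ∈ s, a α • colorBr ε (colorDeg c α) b (monomial d α) (Algebra.lmul F A x) := by
            have : ∀ α ∈ s, a α • colorBr ε (colorDeg c α) b (monomial d α) (Algebra.lmul F A x) =
                colorBr ε t b (a α • monomial d α) (Algebra.lmul F A x) := fun α hα => by
              rw [← colorBr_smul_lmul h.skew h.comm (ha α hα) hx, sub_add_cancel]
            rw [Finset.sum_congr rfl this]
            simp only [colorBr, Finset.sum_mul, Finset.mul_sum, Finset.smul_sum,
              Finset.sum_sub_distrib]
          rw [hexp, ← Finset.sum_sub_distrib]
          refine sum_mem fun α hα => ?_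
          have h1 := (filt ε d c _).smul_mem (a α) (hκx α (hs α hα).1 b x hx)
          have h2 := filt_mono (n := n) (by have := (hs α hα).2; omega) h1
          convert h2 using 1
          rw [smul_sub, smul_comm (a α), Finset.smul_sum, Finset.smul_sum]
          congr 1
          refine Finset.sum_congr rfl fun j _ => ?_
          simp only [C]
          rw [smul_assoc, mul_smul, mul_smul (a α), smul_comm (a α) _ ((d j x) • _)]
        exact (Submodule.sub_mem_iff_right _ (hT b x hx)).1 hsub
      rw [← Finset.sum_filter_add_sum_filter_not s (fun α => α.degree = n + 1)] at hall
      refine (Submodule.add_mem_iff_left _ ?_).1 hall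
      refine sum_mem fun α hα => sum_mem fun j hj => Submodule.smul_mem _ _
        (monomial_mem_filt (sub_single_mem_exponents (hs α (Finset.mem_filter.1 hα).1).1 j) ?_)
      have h1 := degree_sub_single (Finsupp.mem_support_iff.1 hj)
      have h2 := (hs α (Finset.mem_filter.1 hα).1).2
      have h3 := (Finset.mem_filter.1 hα).2
      omega
    obtain ⟨g', hg', hg'T⟩ := (Finsupp.mem_span_image_iff_linearCombination A).1 hlead
    let g : (I →₀ ℕ) →₀ A := ∑ α ∈ s', ∑ j ∈ α.support,
      Finsupp.single (α - Finsupp.single j 1) (C α j)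
    have hg : g ∈ Finsupp.supported A A {α | α ∈ exponents ε c ∧ α.degree < n + 1} := by
      refine sum_mem fun α hα => sum_mem fun j hj => Finsupp.single_mem_supported A _ ?_
      have h1 := degree_sub_single (Finsupp.mem_support_iff.1 hj)
      have h3 := (Finset.mem_filter.1 hα).2
      exact ⟨sub_single_mem_exponents (hs α (Finset.mem_filter.1 hα).1).1 j, by omega⟩
    have hgg' : g - g' = 0 := by
      refine (linearIndepOn_iff.1 hind) _ (sub_mem hg (Finsupp.supported_mono ?_ hg')) ?_
      · exact fun α hα => ⟨hα.1, hα.2.trans (Nat.lt_succ_self n)⟩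
      · rw [map_sub, hg'T, sub_eq_zero]
        simp [g]
    have hgβ : g β = 0 := by
      rw [sub_eq_zero.1 hgg']
      by_contra hne
      have := hg' (Finsupp.mem_support_iff.2 hne)
      exact absurd this.2 (by omega)
    have hgβ' : g β = (ε (colorDeg c β) b : F) • ∑ j ∈ J, w j * d j x := by
      have hinner : ∀ α ∈ s', (∑ j ∈ α.support,
          Finsupp.single (α - Finsupp.single j 1) (C α j)) β =
          ∑ j ∈ J, if α = β + Finsupp.single j 1 then C α j else 0 := by
        intro α hα
        rw [Finsupp.finsetSum_apply]
        have hterm : ∀ j ∈ α.support, (Finsupp.single (α - Finsupp.single j 1) (C α j)) β =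
            if α = β + Finsupp.single j 1 then C α j else 0 := by
          intro j hj
          rw [Finsupp.single_apply]
          congr 1
          rw [eq_iff_iff]
          constructor
          · intro hαβ
            rw [← hαβ]
            exact exists_eq_add_single (Finsupp.mem_support_iff.1 hj)
          · intro hαβ
            rw [hαβ, add_tsub_cancel_right]
        rw [Finset.sum_congr rfl hterm]
        refine Finset.sum_subset (Finset.subset_biUnion_of_mem _ hα) fun j _ hj => ?_
        rw [if_neg]
        rintro rfl
        simp at hj
      simp only [g]
      rw [Finsupp.finsetSum_apply, Finset.sum_congr rfl hinner, Finset.sum_comm, Finset.smul_sum]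
      refine Finset.sum_congr rfl fun j _ => ?_
      rw [Finset.sum_ite_eq']
      simp only [hw]
      split_ifs
      · simp only [C]
        rw [map_add, colorDeg_single, h.skew.add_left, smul_mul_assoc, smul_smul]
        congr 1
        have hsw := h.skew.mul_swap b (c j)
        rw [Units.val_mul]
        linear_combination (ε (colorDeg c β) b : F) *
          ((β + Finsupp.single j 1 : I →₀ ℕ) j : F) * κ (β + Finsupp.single j 1) j * hsw
      · simp
    rw [hgβ] at hgβ'
    have := (smul_eq_zero.1 hgβ'.symm).resolve_left (Units.ne_zero _)
    simpa using this
  have hα₀' : α₀ = β + Finsupp.single i 1 := exists_eq_add_single hi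
  have hmem : β + Finsupp.single i 1 ∈ s' := by
    rw [← hα₀']; exact Finset.mem_filter.2 ⟨hα₀, hdeg₀⟩
  have hi' : w i = 0 := congrFun
    (h.basis_coeff_eq_zero (s := J) (v := fun j => w j)
      ((Finset.sum_coe_sort J (fun j => w j • d j)).trans hw0))
    ⟨i, Finset.mem_biUnion.2 ⟨_, hmem, by simp⟩⟩
  simp only [hw, if_pos hmem] at hi'
  rw [← hα₀'] at hi'
  refine (smul_eq_zero.1 hi').resolve_left (mul_ne_zero ?_ ?_)
  · exact natCast_exponent_ne_zero (hs α₀ hα₀).1 hi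
  · exact (hκ α₀ (hs α₀ hα₀).1 i hi).1

/-- The homogeneous members of the filtration are combinations of monomials with homogeneous
coefficients. -/
theorem exists_homogeneous_sum (h : IsWeylBasis D d c) {n : ℕ} {T : Module.End F A}
    (hT : T ∈ filt ε d c n) {t : Γ} (ht : T ∈ homEnd 𝒜 t) :
    ∃ (s : Finset (I →₀ ℕ)) (a : (I →₀ ℕ) → A),
      (∀ α ∈ s, α ∈ exponents ε c ∧ α.degree < n) ∧ (∀ α ∈ s, a α ∈ 𝒜 (t - colorDeg c α)) ∧
      T = ∑ α ∈ s, a α • monomial d α := by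
  obtain ⟨g, hg, rfl⟩ := (Finsupp.mem_span_image_iff_linearCombination A).1 hT
  refine ⟨g.support, fun α => DirectSum.decompose 𝒜 (g α) (t - colorDeg c α),
    fun α hα => hg hα, fun α _ => SetLike.coe_mem _, ?_⟩
  rw [← opProj_same ht, Finsupp.linearCombination_apply, Finsupp.sum, map_sum]
  exact Finset.sum_congr rfl fun α _ => opProj_smul' (h.monomial_mem_homEnd α)

theorem linearIndepOn_monomial_lt (h : IsWeylBasis D d c) (n : ℕ) :
    LinearIndepOn A (monomial d) {α | α ∈ exponents ε c ∧ α.degree < n} := by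
  classical
  induction n with
  | zero => simp
  | succ n ih =>
    have hhom : ∀ (s : Finset (I →₀ ℕ)) (a : (I →₀ ℕ) → A) (t : Γ),
        (∀ α ∈ s, α ∈ exponents ε c ∧ α.degree < n + 1) → (∀ α ∈ s, a α ∈ 𝒜 (t - colorDeg c α)) →
        ∑ α ∈ s, a α • monomial d α = 0 → ∀ α ∈ s, a α = 0 := by
      intro s a t hs ha hsum
      rcases n with - | n
      · intro α hα
        have hz : ∀ β ∈ s, β = 0 := fun β hβ =>
          (Finsupp.degree_eq_zero_iff β).1 (by have := (hs β hβ).2; omega)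
        have hα0 := hz α hα
        subst hα0
        rw [Finset.sum_eq_single (0 : I →₀ ℕ) (fun β hβ hβ0 => absurd (hz β hβ) hβ0)
          (fun hn => absurd hα hn), monomial_zero] at hsum
        simpa using LinearMap.congr_fun hsum 1
      · have htop := h.top_coeff_eq_zero n ih s
          (fun α hα => ⟨(hs α hα).1, by have := (hs α hα).2; omega⟩) a t ha
          (fun b x _ => by rw [hsum]; simp [colorBr])
        have hrest := (linearIndepOn_iff'.1 ih) (s.filter fun α => α.degree < n + 1) a
          (fun α hα => by
            have := Finset.mem_filter.1 hα
            exact ⟨(hs α this.1).1, this.2⟩)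
          (by
            rw [← hsum, Finset.sum_filter]
            refine Finset.sum_congr rfl fun α hα => ?_
            split_ifs with hlt
            · rfl
            · have := (hs α hα).2
              rw [htop α hα (by omega), zero_smul])
        intro α hα
        by_cases hlt : α.degree < n + 1
        · exact hrest α (Finset.mem_filter.2 ⟨hα, hlt⟩)
        · have := (hs α hα).2
          exact htop α hα (by omega)
    rw [linearIndepOn_iff']
    intro s a hs hsum α hα
    have hcomp : ∀ b, (DirectSum.decompose 𝒜 (a α) b : A) = 0 := by
      intro b
      have := hhom s (fun β => DirectSum.decompose 𝒜 (a β) (b + colorDeg c α - colorDeg c β))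
        (b + colorDeg c α) (fun β hβ => hs hβ) (fun β _ => SetLike.coe_mem _) ?_ α hα
      · rwa [add_sub_cancel_right] at this
      · rw [← map_zero (opProj 𝒜 (b + colorDeg c α)), ← hsum, map_sum]
        exact Finset.sum_congr rfl fun β _ => (opProj_smul' (h.monomial_mem_homEnd β)).symm
    rw [← DirectSum.sum_support_decompose 𝒜 (a α)]
    exact Finset.sum_eq_zero fun b _ => hcomp b

/-- The monomials `d ^ α`, `α ∈ 𝒥`, are linearly independent over `A`. -/
theorem linearIndepOn_monomial (h : IsWeylBasis D d c) :
    LinearIndepOn A (monomial d) (exponents ε c) := by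
  rw [linearIndepOn_iff']
  intro s a hs hsum α hα
  refine (linearIndepOn_iff'.1 (h.linearIndepOn_monomial_lt (s.sup Finsupp.degree + 1))) s a
    (fun β hβ => ⟨hs hβ, ?_⟩) hsum α hα
  exact Nat.lt_succ_of_le (Finset.le_sup (f := fun β : I →₀ ℕ => β.degree) hβ)

/-- If all commutators of `T` with elements of `A` have order at most `n - 1`, then `T` has order
at most `n`. -/
theorem mem_filt_of_colorBr (h : IsWeylBasis D d c) {n : ℕ} {T : Module.End F A}
    (hT : T ∈ filt ε d c (n + 2)) {t : Γ} (ht : T ∈ homEnd 𝒜 t)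
    (hbr : ∀ b, ∀ x ∈ 𝒜 b, colorBr ε t b T (Algebra.lmul F A x) ∈ filt ε d c n) :
    T ∈ filt ε d c (n + 1) := by
  obtain ⟨s, a, hs, ha, rfl⟩ := h.exists_homogeneous_sum hT ht
  have htop := h.top_coeff_eq_zero n (h.linearIndepOn_monomial_lt _) s
    (fun α hα => ⟨(hs α hα).1, by have := (hs α hα).2; omega⟩) a t ha hbr
  refine sum_mem fun α hα => ?_
  by_cases hlt : α.degree < n + 1
  · exact Submodule.smul_mem _ _ (monomial_mem_filt (hs α hα).1 hlt)
  · have := (hs α hα).2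
    rw [htop α hα (by omega), zero_smul]
    exact zero_mem _

/-- The color commutator with an element of `A` lowers the order. -/
theorem colorBr_lmul_mem_filt (h : IsWeylBasis D d c) {n : ℕ} {T : Module.End F A}
    (hT : T ∈ filt ε d c (n + 1)) {t : Γ} (ht : T ∈ homEnd 𝒜 t) {b : Γ} {x : A} (hx : x ∈ 𝒜 b) :
    colorBr ε t b T (Algebra.lmul F A x) ∈ filt ε d c n := by
  obtain ⟨s, a, hs, ha, rfl⟩ := h.exists_homogeneous_sum hT ht
  have : colorBr ε t b (∑ α ∈ s, a α • monomial d α) (Algebra.lmul F A x) =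
      ∑ α ∈ s, colorBr ε t b (a α • monomial d α) (Algebra.lmul F A x) := by
    simp only [colorBr, Finset.sum_mul, Finset.mul_sum, Finset.smul_sum, Finset.sum_sub_distrib]
  rw [this]
  refine sum_mem fun α hα => ?_
  have h1 := colorBr_smul_lmul (s := colorDeg c α) h.skew h.comm (ha α hα) hx (monomial d α)
  rw [sub_add_cancel] at h1
  rw [h1]
  refine Submodule.smul_mem _ _ (filt_mono ?_ (h.colorBr_mem_filt (hs α hα).1 hx))
  have := (hs α hα).2
  omega

end IsWeylBasis
end Symbol
end WeylColor

namespace WeylColor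

section Derived

variable {Γ F A I : Type*} [AddCommGroup Γ] [DecidableEq Γ] [Field F] [Ring A] [Algebra F A]
  {ε : Γ → Γ → Fˣ} {𝒜 : Γ → Submodule F A} [GradedAlgebra 𝒜] {D : GradedDerSubspace ε 𝒜}

namespace GradedDerSubspace

/-! ### The derived space as a space of operators -/

/-- `W = [A[D], A[D]]` as a space of operators. -/
noncomputable def derivedOps (D : GradedDerSubspace ε 𝒜) : Submodule F (Module.End F A) :=
  D.derived.map D.toEnd.toLinearMap

theorem toEnd_bracket {j k : Γ} {x y : D.Weyl} (hx : x ∈ D.weylGrading j)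
    (hy : y ∈ D.weylGrading k) :
    D.toEnd (D.bracket x y) = colorBr ε j k (D.toEnd x) (D.toEnd y) := by
  rw [bracket, colorCommutator_of_mem ε _ hx hy, map_sub, map_smul, map_mul, map_mul, colorBr]

theorem colorBr_mem_derivedOps {j k : Γ} {S T : Module.End F A} (hS : S ∈ D.weyl)
    (hS' : S ∈ homEnd 𝒜 j) (hT : T ∈ D.weyl) (hT' : T ∈ homEnd 𝒜 k) :
    colorBr ε j k S T ∈ D.derivedOps :=
  Submodule.mem_map.2 ⟨D.bracket (D.ofEnd S hS) (D.ofEnd T hT), D.bracket_mem_derived _ _,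
    toEnd_bracket (x := D.ofEnd S hS) (y := D.ofEnd T hT) hS' hT'⟩

theorem derivedOps_le {Y : Submodule F (Module.End F A)}
    (hY : ∀ j k, ∀ S ∈ D.weyl, S ∈ homEnd 𝒜 j → ∀ T ∈ D.weyl, T ∈ homEnd 𝒜 k →
      colorBr ε j k S T ∈ Y) : D.derivedOps ≤ Y := by
  rw [derivedOps, Submodule.map_le_iff_le_comap, derived, Submodule.span_le]
  rintro _ ⟨x, y, rfl⟩
  change D.toEnd (D.bracket x y) ∈ Y
  induction x using DirectSum.Decomposition.inductionOn D.weylGrading with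
  | zero => simp
  | add x x' hx hx' => rw [map_add, LinearMap.add_apply, map_add]; exact add_mem hx hx'
  | @homogeneous j x =>
    induction y using DirectSum.Decomposition.inductionOn D.weylGrading with
    | zero => simp
    | add y y' hy hy' => rw [map_add, map_add]; exact add_mem hy hy'
    | @homogeneous k y =>
      rw [toEnd_bracket x.2 y.2]
      exact hY j k _ (D.toEnd_mem _) x.2 _ (D.toEnd_mem _) y.2

theorem derivedOps_le_weyl (D : GradedDerSubspace ε 𝒜) :
    D.derivedOps ≤ Subalgebra.toSubmodule D.weyl :=
  derivedOps_le fun _ _ _ hS _ _ hT _ =>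
    D.weyl.sub_mem (D.weyl.mul_mem hS hT) (D.weyl.smul_mem (D.weyl.mul_mem hT hS) _)

theorem derivedOps_graded (D : GradedDerSubspace ε 𝒜) :
    IsGradedSubspace (homEnd 𝒜) D.derivedOps :=
  derivedOps_le fun j k _ hS hS' _ hT hT' => Submodule.mem_iSup_of_mem (j + k)
    ⟨colorBr_mem_derivedOps hS hS' hT hT', colorBr_mem_homEnd hS' hT'⟩

theorem derivedOps_isAdStable (D : GradedDerSubspace ε 𝒜) : D.IsAdStable D.derivedOps where
  graded := D.derivedOps_graded
  ad_mem _ _ hP _ _ hS hS' := colorBr_mem_derivedOps (D.mem_weyl hP.1) hP.2.1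
    (D.derivedOps_le_weyl hS) hS'

theorem colorBr_swap (hε : IsSkewBicharacter ε) (j k : Γ) (S T : Module.End F A) :
    colorBr ε j k S T = -((ε j k : F) • colorBr ε k j T S) := by
  rw [colorBr, colorBr, smul_sub, smul_smul, hε.mul_swap, one_smul, neg_sub]

/-- The cyclic identity `[S, Q Q'] = [S Q, Q'] ± [Q' S, Q]`. -/
theorem colorBr_mul_right (hε : IsSkewBicharacter ε) (s q q' : Γ) (S Q Q' : Module.End F A) :
    colorBr ε s (q + q') S (Q * Q') =
      colorBr ε (s + q) q' (S * Q) Q' + (ε (s + q) q' : F) • colorBr ε (q' + s) q (Q' * S) Q := by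
  have h1 : (ε (s + q) q' : F) * ε (q' + s) q = ε s (q + q') := by
    have := hε.mul_swap q q'
    rw [hε.add_left, hε.add_left, hε.add_right, Units.val_mul, Units.val_mul, Units.val_mul]
    linear_combination (ε s q' : F) * ε s q * this
  simp only [colorBr, smul_sub, smul_smul, h1, mul_assoc]
  abel

/-- `W` is spanned by the brackets of `A[D]` with `A` and with `D`. -/
theorem IsWeylDatum.derivedOps_le_of_generators (h : D.IsWeylDatum)
    {Y : Submodule F (Module.End F A)}
    (hA : ∀ s, ∀ S ∈ D.weyl, S ∈ homEnd 𝒜 s → ∀ b, ∀ x ∈ 𝒜 b,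
      colorBr ε s b S (Algebra.lmul F A x) ∈ Y)
    (hD : ∀ s, ∀ S ∈ D.weyl, S ∈ homEnd 𝒜 s → ∀ k, ∀ P ∈ D.carrier ⊓ colorDer ε 𝒜 k,
      colorBr ε k s P S ∈ Y) : D.derivedOps ≤ Y := by
  let G : Γ → Submodule F (Module.End F A) := fun k =>
    { carrier := {Q | Q ∈ D.weyl ∧ Q ∈ homEnd 𝒜 k ∧
        ∀ s, ∀ S ∈ D.weyl, S ∈ homEnd 𝒜 s → colorBr ε s k S Q ∈ Y}
      zero_mem' := ⟨zero_mem _, zero_mem _, fun s S _ _ => by simp [colorBr]⟩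
      add_mem' := fun {Q Q'} hQ hQ' => ⟨add_mem hQ.1 hQ'.1, add_mem hQ.2.1 hQ'.2.1,
        fun s S hS hS' => by
          have := add_mem (hQ.2.2 s S hS hS') (hQ'.2.2 s S hS hS')
          simp only [colorBr] at this ⊢
          rw [mul_add, add_mul, smul_add]
          convert this using 1
          abel⟩
      smul_mem' := fun r Q hQ => ⟨Subalgebra.smul_mem _ hQ.1 r, Submodule.smul_mem _ r hQ.2.1,
        fun s S hS hS' => by
          have := Submodule.smul_mem Y r (hQ.2.2 s S hS hS')
          simp only [colorBr] at this ⊢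
          rwa [smul_sub, smul_comm r, ← mul_smul_comm, ← smul_mul_assoc] at this⟩ }
  refine derivedOps_le fun j k S hS hS' T hT hT' => ?_
  have hTG : T ∈ G k := by
    refine mem_of_mem_iSup (G := G) (fun k Q hQ => hQ.2.1) (D.weyl_le_iSup ?_ ?_ ?_ ?_ hT) hT'
    · exact ⟨one_mem _, one_mem_homEnd, fun s S _ _ => by simp [colorBr, h.skew.zero_right]⟩
    · refine fun q q' Q hQ Q' hQ' => ⟨mul_mem hQ.1 hQ'.1, mul_mem_homEnd hQ.2.1 hQ'.2.1,
        fun s S hS hS' => ?_⟩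
      rw [colorBr_mul_right h.skew]
      exact add_mem (hQ'.2.2 _ _ (mul_mem hS hQ.1) (mul_mem_homEnd hS' hQ.2.1))
        (Submodule.smul_mem _ _ (hQ.2.2 _ _ (mul_mem hQ'.1 hS) (mul_mem_homEnd hQ'.2.1 hS')))
    · exact fun a u hu => ⟨D.lmul_mem_weyl u, lmul_mem_homEnd hu,
        fun s S hS hS' => hA s S hS hS' a u hu⟩
    · refine fun k P hP => ⟨D.mem_weyl hP.1, hP.2.1, fun s S hS hS' => ?_⟩
      rw [colorBr_swap h.skew]
      exact neg_mem (Submodule.smul_mem _ _ (hD s S hS hS' k P hP))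
  exact hTG.2.2 j S hS hS'

/-- `𝒟` is graded. -/
theorem fullDer_graded (D : GradedDerSubspace ε 𝒜) :
    D.fullDer ≤ ⨆ k, D.fullDer ⊓ colorDer ε 𝒜 k := by
  classical
  intro T hT
  obtain ⟨f, hf⟩ := (Submodule.mem_iSup_iff_exists_dfinsupp' (colorDer ε 𝒜) T).1 hT.1
  rw [← hf]
  refine sum_mem fun k _ => Submodule.mem_iSup_of_mem k
    ⟨⟨Submodule.mem_iSup_of_mem k (f k).2, ?_⟩, (f k).2⟩
  have h1 : opProj 𝒜 k T = f k := by
    rw [← hf, DFinsupp.sum, map_sum, Finset.sum_eq_single k]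
    · exact opProj_same (f k).2.1
    · exact fun j _ hjk => opProj_ne hjk (f j).2.1
    · intro hk
      rw [DFinsupp.notMem_support_iff.1 hk]
      simp
  change (f k : Module.End F A) ∈ Subalgebra.toSubmodule D.constantWeyl
  rw [← h1]
  exact opProj_mem_of_graded D.constantWeyl_graded k hT.2

/-- `𝒟(A)` is spanned by the values of the homogeneous members of `𝒟` on homogeneous elements. -/
theorem fullDerImage_le {Y : Submodule F A}
    (hY : ∀ k, ∀ P ∈ D.fullDer ⊓ colorDer ε 𝒜 k, ∀ b, ∀ x ∈ 𝒜 b, P x ∈ Y) :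
    D.fullDerImage ≤ Y := by
  rw [fullDerImage, Submodule.span_le]
  rintro _ ⟨T, hT, x, rfl⟩
  have hT' := D.fullDer_graded hT
  clear hT
  induction hT' using Submodule.iSup_induction' with
  | zero => exact zero_mem _
  | add S T _ _ hS hT => exact add_mem hS hT
  | mem k P hP =>
    induction x using DirectSum.Decomposition.inductionOn 𝒜 with
    | zero => simp
    | @homogeneous b m => exact hY k P hP b m m.2
    | add m m' h h' => rw [map_add]; exact add_mem h h'

theorem apply_mem_fullDerImage {P : Module.End F A} (hP : P ∈ D.fullDer) (x : A) :
    P x ∈ D.fullDerImage :=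
  Submodule.subset_span ⟨P, hP, x, rfl⟩

/-- `𝒟(A) T` lies in `W` for `T` in `F₁[D]`, as `P(x) T = [P, x T]` for `P` in `𝒟`. -/
theorem IsWeylDatum.fullDerImage_smul_mem_derivedOps (h : D.IsWeylDatum) {k : Γ}
    {T : Module.End F A} (hT : T ∈ D.constantWeyl) (hk : T ∈ homEnd 𝒜 k) {y : A}
    (hy : y ∈ D.fullDerImage) : y • T ∈ D.derivedOps := by
  have hle : D.fullDerImage ≤ D.derivedOps.comap
      ((LinearMap.mul F (Module.End F A)).flip T ∘ₗ (Algebra.lmul F A).toLinearMap) := by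
    refine fullDerImage_le fun j P hP b x hx => ?_
    change P x • T ∈ D.derivedOps
    rw [← colorBr_der_smul h.skew hP.2 (h.constantWeyl_comm hP.1.2 hP.2.1 hT hk) hx]
    exact colorBr_mem_derivedOps (D.constantWeyl_le_weyl hP.1.2) hP.2.1
      (mul_mem (D.lmul_mem_weyl x) (D.constantWeyl_le_weyl hT)) (smul_mem_homEnd hx hk)
  exact hle hy

theorem mem_mulOp {V : Submodule F A} {T S : Module.End F A} :
    S ∈ mulOp V T ↔ ∃ v ∈ V, v • T = S := Iff.rfl

end GradedDerSubspace

open GradedDerSubspace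

namespace IsWeylBasis

variable [LinearOrder I] {d : I → Module.End F A} {c : I → Γ}

/-! ### Extracting the coefficients of the leading terms -/

/-- The homogeneous derivations in `𝒟` color-commute with the monomials. -/
theorem der_mul_monomial (h : IsWeylBasis D d c) {k : Γ} {P : Module.End F A}
    (hP : P ∈ D.fullDer ⊓ colorDer ε 𝒜 k) (α : I →₀ ℕ) :
    P * monomial d α = (ε k (colorDeg c α) : F) • (monomial d α * P) :=
  h.constantWeyl_comm hP.1.2 hP.2.1 (h.monomial_mem_constantWeyl α) (h.monomial_mem_homEnd α)

theorem colorBr_der_smul_monomial (h : IsWeylBasis D d c) {k r : Γ} {P : Module.End F A}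
    (hP : P ∈ D.fullDer ⊓ colorDer ε 𝒜 k) {a : A} (ha : a ∈ 𝒜 r) (α : I →₀ ℕ) :
    colorBr ε k (r + colorDeg c α) P (a • monomial d α) = P a • monomial d α :=
  colorBr_der_smul h.skew hP.2 (h.der_mul_monomial hP α) ha

theorem filt_subset {V : Submodule F (Module.End F A)} {n : ℕ}
    (hV : ∀ α ∈ exponents ε c, α.degree < n → ∀ a : A, a • monomial d α ∈ V)
    {T : Module.End F A} (hT : T ∈ filt ε d c n) : T ∈ V := by
  obtain ⟨g, hg, rfl⟩ := (Finsupp.mem_span_image_iff_linearCombination A).1 hT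
  rw [Finsupp.linearCombination_apply]
  exact sum_mem fun α hα => hV α (hg hα).1 (hg hα).2 _

/-- Pairing the leading coefficients of the commutator of `d ^ α` and `x` with a homogeneous tuple
`u` amounts to applying to `x` a combination of the basis derivations. -/
theorem sum_leadingCoeff_mul (h : IsWeylBasis D d c) {α : I →₀ ℕ} {κ : I → F} {μ : Γ}
    {u : α.support → A}
    (hu : ∀ j : α.support, u j ∈ 𝒜 (μ + colorDeg c (α - Finsupp.single (j : I) 1)))
    {b : Γ} {x : A} (hx : x ∈ 𝒜 b) :
    ∑ j : α.support, ((κ j * ε b (c j)) • d j x) * u j = (ε b (μ + colorDeg c α) : F) •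
      (∑ j : α.support,
        ((κ j * ε (c j) (μ + colorDeg c (α - Finsupp.single (j : I) 1))) • u j) • d j) x := by
  rw [LinearMap.sum_apply, Finset.smul_sum]
  refine Finset.sum_congr rfl fun j _ => ?_
  have hj := colorDeg_sub_single (c := c) (Finsupp.mem_support_iff.1 j.2)
  rw [LinearMap.smul_apply, smul_eq_mul, smul_mul_assoc,
    h.comm _ _ _ ((h.mem_colorDer j).1 b x hx) _ (hu j), smul_mul_assoc, smul_smul, smul_smul,
    h.skew.add_left, ← hj, ← add_assoc, h.skew.add_right b _ (c j)]
  congr 1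
  push_cast
  ring

/-- The leading coefficients of the commutators of `d ^ α` with `A` can be separated: a graded
subspace stable under the commutators with `D` which contains `A [d ^ α, A]` and the operators of
order at most `|α| - 2` contains all the spaces `A d ^ (α - e j)`. -/
theorem smul_monomial_sub_single_mem (h : IsWeylBasis D d c) {V : Submodule F (Module.End F A)}
    (hV : D.IsAdStable V) {α : I →₀ ℕ} (hα : α ∈ exponents ε c)
    (hlow : ∀ T ∈ filt ε d c (α.degree - 1), T ∈ V)
    (hbr : ∀ r, ∀ a ∈ 𝒜 r, ∀ b, ∀ x ∈ 𝒜 b,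
      a • colorBr ε (colorDeg c α) b (monomial d α) (Algebra.lmul F A x) ∈ V)
    {j : I} (hj : α j ≠ 0) (a : A) : a • monomial d (α - Finsupp.single j 1) ∈ V := by
  obtain ⟨κ, hκ, hx⟩ := h.monomial_mul_lmul hα
  rcases h.mem_or_exists_annihilator (ι := α.support) hV
    (T := fun j => monomial d (α - Finsupp.single (j : I) 1))
    (τ := fun j => colorDeg c (α - Finsupp.single (j : I) 1))
    (fun j => h.monomial_mem_homEnd _)
    (fun k P hP j => h.der_mul_monomial ⟨mem_fullDer_of_mem hP, hP.2⟩ _) with hall | hann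
  · exact hall ⟨j, Finsupp.mem_support_iff.2 hj⟩ a
  · exfalso
    obtain ⟨μ, u, ⟨i, hi⟩, hu, hann⟩ := hann
    suffices hzero : ∑ j : α.support, ((((α j : F) * κ j) * ε (c j)
        (μ + colorDeg c (α - Finsupp.single (j : I) 1))) • u j) • d j = 0 by
      have := congrFun (h.basis_coeff_eq_zero hzero) i
      have hi0 := Finsupp.mem_support_iff.1 i.2
      exact hi ((smul_eq_zero.1 this).resolve_left (mul_ne_zero
        (mul_ne_zero (natCast_exponent_ne_zero hα hi0) (hκ i hi0).1) (Units.ne_zero _)))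
    refine end_ext (𝒜 := 𝒜) fun b x hxb => ?_
    have h0 := hann (fun j => (((α j : F) * κ j) * ε b (c j)) • d j x) ?_
    · rw [h.sum_leadingCoeff_mul (κ := fun j => (α j : F) * κ j) (fun j => (hu j).2) hxb] at h0
      exact (smul_eq_zero.1 h0).resolve_left (Units.ne_zero _)
    · refine mem_coeffModule_of_homogeneous (𝒜 := 𝒜) fun r a ha => ?_
      have h1 := hlow _ ((filt ε d c _).smul_mem a (hx b x hxb))
      rw [smul_sub] at h1
      have h2 := (Submodule.sub_mem_iff_right V (hbr r a ha b x hxb)).1 h1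
      rw [smul_comm, Submodule.smul_mem_iff V (Units.ne_zero _), Finset.smul_sum,
        ← Finset.sum_coe_sort α.support] at h2
      convert h2 using 2 with j
      rw [smul_comm a, mul_smul_comm, smul_assoc, mul_smul a]

/-! ### The computation of `W` -/

theorem smul_monomial_mem_derivedOps (h : IsWeylBasis D d c) {β : I →₀ ℕ} {i : I}
    (hi : β + Finsupp.single i 1 ∈ exponents ε c) (a : A) :
    a • monomial d β ∈ D.derivedOps := by
  induction hn : β.degree using Nat.strong_induction_on generalizing β i a with
  | _ n ih =>
  subst hn
  have hβ : β ∈ exponents ε c := exponents_mono hi (le_add_of_nonneg_right zero_le)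
  have := h.smul_monomial_sub_single_mem (D.derivedOps_isAdStable) hi ?_ ?_ (j := i) (by simp) a
  · rwa [add_tsub_cancel_right] at this
  · intro T hT
    refine filt_subset (fun α hα hdeg a => ?_) hT
    rw [degree_add_single, Nat.add_sub_cancel] at hdeg
    -- `α` can be raised, as otherwise it would dominate `β`
    by_cases hex : ∃ j, α + Finsupp.single j 1 ∈ exponents ε c
    · obtain ⟨j, hj⟩ := hex
      exact ih α.degree hdeg hj a rfl
    · push Not at hex
      have := degree_mono (le_of_forall_notMem hα hex hβ)
      omega
  · intro r a ha b x hx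
    rw [← colorBr_smul_lmul h.skew h.comm ha hx]
    exact colorBr_mem_derivedOps
      (mul_mem (D.lmul_mem_weyl a) (D.constantWeyl_le_weyl (h.monomial_mem_constantWeyl _)))
      (smul_mem_homEnd ha (h.monomial_mem_homEnd _)) (D.lmul_mem_weyl x) (lmul_mem_homEnd hx)

theorem exists_add_single_mem_of_infinite (hinf : (exponents ε c).Infinite) {β : I →₀ ℕ}
    (hβ : β ∈ exponents ε c) : ∃ i, β + Finsupp.single i 1 ∈ exponents ε c := by
  classical
  by_contra hex
  push Not at hex
  exact hinf ((Set.finite_Iic β).subset fun α hα => le_of_forall_notMem hβ hex hα)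

theorem eq_of_forall_notMem {β γ : I →₀ ℕ} (hβ : β ∈ exponents ε c) (hγ : γ ∈ exponents ε c)
    (hmax : ∀ α ∈ exponents ε c, α.degree ≤ γ.degree)
    (hex : ∀ i, β + Finsupp.single i 1 ∉ exponents ε c) : β = γ := by
  have hle := le_of_forall_notMem hβ hex hγ
  have hdeg : (β - γ).degree + γ.degree = β.degree := by
    rw [← map_add, tsub_add_cancel_of_le hle]
  have h0 : (β - γ).degree = 0 := by have := hmax β hβ; omega
  rw [Finsupp.degree_eq_zero_iff] at h0
  exact le_antisymm (tsub_eq_zero_iff_le.1 h0) hle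

theorem exists_add_single_mem_of_ne {β γ : I →₀ ℕ} (hβ : β ∈ exponents ε c)
    (hγ : γ ∈ exponents ε c) (hmax : ∀ α ∈ exponents ε c, α.degree ≤ γ.degree) (hne : β ≠ γ) :
    ∃ i, β + Finsupp.single i 1 ∈ exponents ε c := by
  by_contra hex
  push Not at hex
  exact hne (eq_of_forall_notMem hβ hγ hmax hex)

/-- If there are infinitely many monomials, `W = A[D]`. -/
theorem derived_eq_top (h : IsWeylBasis D d c) (hinf : (exponents ε c).Infinite) :
    D.derived = ⊤ := by
  rw [eq_top_iff]
  rintro x -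
  obtain ⟨n, hn⟩ := h.exists_mem_filt (D.toEnd_mem x)
  have hx : D.toEnd x ∈ D.derivedOps := filt_subset (fun α hα _ a => by
    obtain ⟨i, hi⟩ := exists_add_single_mem_of_infinite hinf hα
    exact h.smul_monomial_mem_derivedOps hi a) hn
  obtain ⟨y, hy, hyx⟩ := Submodule.mem_map.1 hx
  rwa [← D.toEnd_injective hyx]

theorem mem_filt_of_max (h : IsWeylBasis D d c) {γ : I →₀ ℕ}
    (hmax : ∀ α ∈ exponents ε c, α.degree ≤ γ.degree) {T : Module.End F A} (hT : T ∈ D.weyl) :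
    T ∈ filt ε d c (γ.degree + 1) := by
  obtain ⟨n, hn⟩ := h.exists_mem_filt hT
  have hsub : {α | α ∈ exponents ε c ∧ α.degree < n} ⊆
      {α | α ∈ exponents ε c ∧ α.degree < γ.degree + 1} :=
    fun α hα => ⟨hα.1, Nat.lt_succ_of_le (hmax α hα.1)⟩
  exact Submodule.span_mono (Set.image_mono hsub) hn

theorem iSupIndep_summand (h : IsWeylBasis D d c) (γ : I →₀ ℕ) :
    iSupIndep (fun α : exponents ε c => D.summand d γ α) := by
  classical
  rw [iSupIndep_iff_finsetSum_eq_zero_imp_eq_zero]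
  intro s v hv h0 α hα
  have hex : ∀ α ∈ s, ∃ a : A, a • monomial d α = v α := fun α hα => by
    have := hv α hα
    rw [GradedDerSubspace.summand] at this
    split_ifs at this
    · obtain ⟨a, -, ha⟩ := mem_mulOp.1 this
      exact ⟨a, ha⟩
    · obtain ⟨a, -, ha⟩ := mem_mulOp.1 this
      exact ⟨a, ha⟩
  choose! a ha using hex
  have hli := linearIndependent_iff'.1 (h.linearIndepOn_monomial) s a
    (by rw [← h0]; exact Finset.sum_congr rfl fun α hα => ha α hα) α hα
  rw [← ha α hα, hli, zero_smul]

/-- If there are finitely many monomials, only the coefficient of the maximal one is restricted. -/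
theorem derivedOps_eq_iSup (h : IsWeylBasis D d c) {γ : I →₀ ℕ} (hγ : γ ∈ exponents ε c)
    (hmax : ∀ α ∈ exponents ε c, α.degree ≤ γ.degree) :
    D.derivedOps = ⨆ α : exponents ε c, D.summand d γ α := by
  have hmem : ∀ α (hα : α ∈ exponents ε c), α ≠ γ → ∀ a : A,
      a • monomial d α ∈ ⨆ α : exponents ε c, D.summand d γ α := fun α hα hne a => by
    refine Submodule.mem_iSup_of_mem ⟨α, hα⟩ ?_
    rw [GradedDerSubspace.summand, if_neg hne]
    exact mem_mulOp.2 ⟨a, trivial, rfl⟩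
  have hmem' : ∀ α (hα : α ∈ exponents ε c), ∀ a ∈ D.fullDerImage,
      a • monomial d α ∈ ⨆ α : exponents ε c, D.summand d γ α := fun α hα a ha => by
    refine Submodule.mem_iSup_of_mem ⟨α, hα⟩ ?_
    rw [GradedDerSubspace.summand]
    split_ifs
    · exact mem_mulOp.2 ⟨a, ha, rfl⟩
    · exact mem_mulOp.2 ⟨a, trivial, rfl⟩
  apply le_antisymm
  · refine h.derivedOps_le_of_generators (fun s S hS hS' b x hx => ?_)
      (fun s S hS hS' k P hP => ?_)
    · refine filt_subset (fun α hα hdeg a => hmem α hα ?_ a)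
        (h.colorBr_lmul_mem_filt (h.mem_filt_of_max hmax hS) hS' hx)
      rintro rfl
      exact lt_irrefl _ hdeg
    · obtain ⟨t, a, ht, ha, rfl⟩ := h.exists_homogeneous_sum (h.mem_filt_of_max hmax hS) hS'
      have hP' : P ∈ D.fullDer ⊓ colorDer ε 𝒜 k := ⟨mem_fullDer_of_mem hP, hP.2⟩
      have hsum : colorBr ε k s P (∑ α ∈ t, a α • monomial d α) =
          ∑ α ∈ t, P (a α) • monomial d α := by
        have : ∀ α ∈ t, P (a α) • monomial d α = colorBr ε k s P (a α • monomial d α) :=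
          fun α hα => by rw [← h.colorBr_der_smul_monomial hP' (ha α hα), sub_add_cancel]
        rw [Finset.sum_congr rfl this]
        simp only [colorBr, Finset.mul_sum, Finset.sum_mul, Finset.smul_sum,
          Finset.sum_sub_distrib]
      rw [hsum]
      exact sum_mem fun α hα => hmem' α (ht α hα).1 _ (apply_mem_fullDerImage hP'.1 _)
  · refine iSup_le fun α => ?_
    rw [GradedDerSubspace.summand]
    split_ifs with hαγ
    · rintro _ ⟨a, ha, rfl⟩
      exact h.fullDerImage_smul_mem_derivedOps (h.monomial_mem_constantWeyl α)
        (h.monomial_mem_homEnd α) ha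
    · rintro _ ⟨a, -, rfl⟩
      obtain ⟨i, hi⟩ := exists_add_single_mem_of_ne α.2 hγ hmax hαγ
      exact h.smul_monomial_mem_derivedOps hi a

end IsWeylBasis
end Derived
end WeylColor

namespace WeylColor

section Exceptional

variable {Γ F A : Type*} [AddCommGroup Γ] [DecidableEq Γ] [Field F] [Ring A] [Algebra F A]
  {ε : Γ → Γ → Fˣ} {𝒜 : Γ → Submodule F A} [GradedAlgebra 𝒜] {D : GradedDerSubspace ε 𝒜}

namespace GradedDerSubspace

/-! ### Existence of homogeneous bases -/

theorem smul_mem_colorDer (hε : IsSkewBicharacter ε) (hA : IsColorCommutative ε 𝒜) {r k : Γ}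
    {a : A} (ha : a ∈ 𝒜 r) {T : Module.End F A} (hT : T ∈ colorDer ε 𝒜 k) :
    a • T ∈ colorDer ε 𝒜 (r + k) := by
  refine ⟨smul_mem_homEnd ha hT.1, fun b b' x hx y _ => ?_⟩
  simp only [LinearMap.smul_apply, smul_eq_mul]
  rw [colorDer_apply_mul hT hx, mul_add, mul_assoc, mul_smul_comm, ← mul_assoc a x,
    hA r b a ha x hx, hε.add_left, Units.val_mul, smul_mul_assoc, smul_smul, mul_comm (ε k b : F),
    mul_assoc x]

/-- `𝒟` is a module over the constants. -/
theorem IsWeylDatum.smul_mem_fullDer (h : D.IsWeylDatum) (u : D.constants) {T : Module.End F A}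
    (hT : T ∈ D.fullDer) : u • T ∈ D.fullDer := by
  classical
  have hmul : Algebra.lmul F A u * T ∈ D.constantWeyl :=
    D.constantWeyl.mul_mem (Algebra.subset_adjoin (Or.inl ⟨u, u.2, rfl⟩)) hT.2
  refine ⟨?_, hmul⟩
  change (u : A) • T ∈ derivations ε 𝒜
  have hT' := hT.1
  clear hT hmul
  induction hT' using Submodule.iSup_induction' with
  | zero => rw [smul_zero]; exact zero_mem _
  | add S T _ _ hS hT => rw [smul_add]; exact add_mem hS hT
  | mem k T hT =>
    rw [← DirectSum.sum_support_decompose 𝒜 (u : A), Finset.sum_smul]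
    exact sum_mem fun a _ => Submodule.mem_iSup_of_mem (a + k)
      (smul_mem_colorDer h.skew h.comm (SetLike.coe_mem _) hT)

/-- As the constants form a graded field, `𝒟` has a homogeneous basis: take a maximal linearly
independent set of homogeneous members. -/
theorem IsWeylDatum.exists_basis (h : D.IsWeylDatum) :
    ∃ (s : Set {T : Module.End F A // T ∈ D.fullDer ∧ ∃ k, T ∈ homEnd 𝒜 k}) (c : s → Γ),
      D.IsHomogeneousBasis (fun T : s => (T.1.1 : Module.End F A)) c := by
  classical
  obtain ⟨s, hs, hmax⟩ := exists_maximal_linearIndepOn D.constants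
    (fun T : {T : Module.End F A // T ∈ D.fullDer ∧ ∃ k, T ∈ homEnd 𝒜 k} => (T.1 : Module.End F A))
  refine ⟨s, fun T => T.1.2.2.choose, fun T => T.1.2.2.choose_spec, hs, ?_⟩
  set N := Submodule.span D.constants (Set.range fun T : s => (T.1.1 : Module.End F A)) with hN
  have hNproj : ∀ T ∈ N, ∀ m, opProj 𝒜 m T ∈ N := by
    intro T hT m
    obtain ⟨g, rfl⟩ := (Finsupp.mem_span_range_iff_exists_finsupp).1 hT
    rw [Finsupp.sum, map_sum]
    refine sum_mem fun T _ => ?_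
    obtain ⟨k, hk⟩ := T.1.2.2
    have : opProj 𝒜 m (((g T : D.constants) : A) • T.1.1) = _ := opProj_smul' hk
    change opProj 𝒜 m (((g T : D.constants) : A) • T.1.1) ∈ N
    rw [this]
    exact N.smul_mem ⟨_, decompose_mem_constants (g T).2 _⟩ (Submodule.subset_span ⟨T, rfl⟩)
  have hhom : ∀ T ∈ D.fullDer, ∀ k, T ∈ homEnd 𝒜 k → T ∈ N := by
    intro T hT k hk
    by_cases hmem : (⟨T, hT, k, hk⟩ : {T : Module.End F A // T ∈ D.fullDer ∧
        ∃ k, T ∈ homEnd 𝒜 k}) ∈ s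
    · exact Submodule.subset_span ⟨⟨_, hmem⟩, rfl⟩
    · obtain ⟨u, hu0, hu⟩ := hmax _ hmem
      rw [Set.image_eq_range] at hu
      have hu' : (u : A) • T ∈ N := hu
      obtain ⟨b, hb⟩ : ∃ b, (DirectSum.decompose 𝒜 (u : A) b : A) ≠ 0 := by
        by_contra hall
        push Not at hall
        refine hu0 (Subtype.ext ?_)
        rw [← DirectSum.sum_support_decompose 𝒜 (u : A)]
        exact Finset.sum_eq_zero fun b _ => hall b
      have h1 := hNproj _ hu' (b + k)
      rw [opProj_smul' hk, add_sub_cancel_right] at h1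
      obtain ⟨v, -, hvc, hv, -⟩ := h.exists_inv (SetLike.coe_mem _)
        (decompose_mem_constants u.2 b) hb
      have h2 : v • (DirectSum.decompose 𝒜 (u : A) b : A) • T ∈ N := N.smul_mem ⟨v, hvc⟩ h1
      rwa [smul_smul, hv, one_smul] at h2
  apply Set.Subset.antisymm
  · intro T hT
    change T ∈ D.fullDer
    have hT' : T ∈ N := hT
    clear hT
    induction hT' using Submodule.span_induction with
    | zero => exact zero_mem _
    | add S T _ _ hS hT => exact add_mem hS hT
    | smul u T _ hT => exact h.smul_mem_fullDer u hT
    | mem T hT => obtain ⟨T, rfl⟩ := hT; exact T.1.2.1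
  · intro T hT
    change T ∈ N
    have hT' := D.fullDer_graded hT
    clear hT
    induction hT' using Submodule.iSup_induction' with
    | zero => exact zero_mem _
    | add S T _ _ hS hT => exact add_mem hS hT
    | mem k T hT => exact hhom T hT.1 k hT.2.1

/-! ### The exceptional case -/

theorem scale_injective (ε : Γ → Γ → Fˣ) (𝒜 : Γ → Submodule F A) [GradedAlgebra 𝒜] (k : Γ)
    {x : A} (hx : scale ε 𝒜 k x = 0) : x = 0 := by
  classical
  have hcomp : ∀ b y, (DirectSum.decompose 𝒜 (scale ε 𝒜 k y) b : A) =
      (ε k b : F) • (DirectSum.decompose 𝒜 y b : A) := by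
    intro b y
    induction y using DirectSum.Decomposition.inductionOn 𝒜 with
    | zero => simp
    | @homogeneous a m =>
      rw [scale_of_mem ε 𝒜 k m.2]
      by_cases hab : a = b
      · subst hab
        rw [DirectSum.decompose_smul]
        rfl
      · rw [DirectSum.decompose_of_mem_ne 𝒜 (Submodule.smul_mem _ _ m.2) hab,
          DirectSum.decompose_of_mem_ne 𝒜 m.2 hab, smul_zero]
    | add m m' hm hm' =>
      simp only [map_add, DirectSum.decompose_add, DirectSum.add_apply, Submodule.coe_add, hm,
        hm', smul_add]
  rw [← DirectSum.sum_support_decompose 𝒜 x]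
  refine Finset.sum_eq_zero fun b _ => ?_
  have := hcomp b x
  rw [hx, DirectSum.decompose_zero] at this
  exact (smul_eq_zero.1 this.symm).resolve_left (Units.ne_zero _)

/-- A derivation which kills the constants is linear over them, up to color factors. -/
theorem der_constant_mul {k : Γ} {T : Module.End F A} (hT : T ∈ colorDer ε 𝒜 k)
    (hTc : ∀ u ∈ D.constants, T u = 0) {u : A} (hu : u ∈ D.constants) (x : A) :
    T (u * x) = scale ε 𝒜 k u * T x := by
  classical
  rw [← DirectSum.sum_support_decompose 𝒜 u]
  simp only [Finset.sum_mul, map_sum]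
  refine Finset.sum_congr rfl fun b _ => ?_
  rw [colorDer_apply_mul hT (SetLike.coe_mem _), hTc _ (decompose_mem_constants hu b), zero_mul,
    zero_add, scale_of_mem ε 𝒜 k (SetLike.coe_mem _), smul_mul_assoc]

theorem scale_mem_constants {k : Γ} {u : A} (hu : u ∈ D.constants) :
    scale ε 𝒜 k u ∈ D.constants := by
  classical
  rw [← DirectSum.sum_support_decompose 𝒜 u, map_sum]
  refine sum_mem fun b _ => ?_
  rw [scale_of_mem ε 𝒜 k (SetLike.coe_mem _)]
  exact D.constants.smul_mem (decompose_mem_constants hu b) _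

/-- A nonzero homogeneous derivation with constant values which kills the constants exists only in
the exceptional case: normalize `δ t = 1`; then `δ (t y) = y ± t δ y` is constant for all `y`. -/
theorem IsWeylDatum.isExceptional_of_der (h : D.IsWeylDatum) {k : Γ} {δ : Module.End F A}
    (hδ : δ ∈ colorDer ε 𝒜 k) (hδ0 : δ ≠ 0) (himg : ∀ x, δ x ∈ D.constants)
    (hker : ∀ u ∈ D.constants, δ u = 0) : IsExceptional D := by
  classical
  have hnt := h.simple.nontrivial
  obtain ⟨t, ht, hδt⟩ : ∃ t ∈ 𝒜 (-k), δ t = 1 := by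
    obtain ⟨b, x, hx, hx0⟩ : ∃ b, ∃ x ∈ 𝒜 b, δ x ≠ 0 := by
      by_contra hall
      push Not at hall
      exact hδ0 (end_ext (𝒜 := 𝒜) hall)
    obtain ⟨v, hv, hvc, hv1, -⟩ := h.exists_inv (hδ.1 b x hx) (himg x) hx0
    have hvx : v * x ∈ 𝒜 (-k) := by
      have := SetLike.GradedMul.mul_mem hv hx
      rwa [show -(k + b) + b = -k by abel] at this
    refine ⟨((ε k (-(k + b)) : F))⁻¹ • (v * x), Submodule.smul_mem _ _ hvx, ?_⟩
    rw [map_smul, der_constant_mul hδ hker hvc, scale_of_mem ε 𝒜 k hv, smul_mul_assoc, hv1,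
      smul_smul, inv_mul_cancel₀ (Units.ne_zero _), one_smul]
  -- every element is a combination of `1` and `t`
  have hex : ∀ x : A, ∃ p q : A, p ∈ D.constants ∧ q ∈ D.constants ∧ x = p + q * t := by
    intro x
    induction x using DirectSum.Decomposition.inductionOn 𝒜 with
    | zero => exact ⟨0, 0, zero_mem _, zero_mem _, by simp⟩
    | @homogeneous b m =>
      have h1 := colorDer_apply_mul hδ ht (m : A)
      rw [hδt, one_mul, h.comm _ _ t ht _ (hδ.1 b m m.2), smul_smul] at h1
      refine ⟨δ (t * m), -(((ε k (-k) : F) * ε (-k) (k + b)) • δ m), himg _,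
        neg_mem (D.constants.smul_mem (himg _) _), ?_⟩
      rw [h1, neg_mul, smul_mul_assoc, add_neg_cancel_right]
    | add m m' hm hm' =>
      obtain ⟨p, q, hp, hq, hpq⟩ := hm
      obtain ⟨p', q', hp', hq', hpq'⟩ := hm'
      exact ⟨p + p', q + q', add_mem hp hp', add_mem hq hq', by rw [hpq, hpq', add_mul]; abel⟩
  have happly : ∀ p ∈ D.constants, ∀ q ∈ D.constants, ∀ (j : Γ) (S : Module.End F A),
      S ∈ colorDer ε 𝒜 j → (∀ u ∈ D.constants, S u = 0) →
      S (p + q * t) = scale ε 𝒜 j q * S t := fun p hp q hq j S hS hSc => by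
    rw [map_add, hSc p hp, zero_add, der_constant_mul hS hSc hq]
  have huniq : ∀ p ∈ D.constants, ∀ q ∈ D.constants, p + q * t = 0 → p = 0 ∧ q = 0 := by
    intro p hp q hq hpq
    have h1 := happly p hp q hq k δ hδ hker
    rw [hpq, map_zero, hδt, mul_one] at h1
    have h2 := scale_injective ε 𝒜 k h1.symm
    rw [h2, zero_mul, add_zero] at hpq
    exact ⟨hpq, h2⟩
  have hkk : ε k k = -1 := by
    refine (h.skew.self_eq k).resolve_left fun hk => ?_
    -- otherwise `δ (t ^ 2) = 2 t` would be constant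
    have h1 := colorDer_apply_mul hδ ht t
    rw [hδt, one_mul, mul_one, h.skew.neg_right, hk, inv_one, Units.val_one, one_smul] at h1
    have h2 := hker _ (himg (t * t))
    rw [h1, map_add, hδt] at h2
    have h3 : (2 : F) • (1 : A) = 0 := by rw [two_smul]; exact h2
    exact ((smul_eq_zero.1 h3).resolve_left h.two_ne_zero) |> one_ne_zero
  have hodd : ε (-k) (-k) = -1 := by rw [h.skew.neg_self, hkk]
  have htt : t * t = 0 := h.mul_self_eq_zero hodd ht
  -- the elements of `D` are multiples of `δ`
  have hSform : ∀ j, ∀ S ∈ D.carrier ⊓ colorDer ε 𝒜 j, S = S t • δ := by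
    intro j S hS
    ext x
    obtain ⟨p, q, hp, hq, rfl⟩ := hex x
    have hSc : ∀ u ∈ D.constants, S u = 0 := fun u hu => hu S hS.1
    rw [LinearMap.smul_apply, happly p hp q hq j S hS.2 hSc, happly p hp q hq k δ hδ hker, hδt,
      mul_one, smul_eq_mul]
    rw [← DirectSum.sum_support_decompose 𝒜 q]
    simp only [map_sum, Finset.sum_mul, Finset.mul_sum]
    refine Finset.sum_congr rfl fun b _ => ?_
    set m := (DirectSum.decompose 𝒜 q b : A)
    have hm : m ∈ 𝒜 b := SetLike.coe_mem _
    rw [scale_of_mem ε 𝒜 j hm, scale_of_mem ε 𝒜 k hm, smul_mul_assoc, mul_smul_comm,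
      h.comm _ _ _ (hS.2.1 _ t ht) m hm, smul_smul, ← Units.val_mul, ← h.skew.add_left,
      show k + (j + -k) = j by abel]
  have hcase : ∀ j, ∀ S ∈ D.carrier ⊓ colorDer ε 𝒜 j,
      S t ∈ D.constants ∨ ∃ q ∈ D.constants, S t = q * t := by
    intro j S hS
    obtain ⟨p, q, hp, hq, hpq⟩ := hex (S t)
    have hSt := hS.2.1 _ t ht
    have h1 := DirectSum.decompose_of_mem_same 𝒜 hSt
    nth_rewrite 1 [hpq] at h1
    rw [DirectSum.decompose_add, DirectSum.add_apply, Submodule.coe_add,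
      DirectSum.coe_decompose_mul_add_of_right_mem 𝒜 ht] at h1
    set p' := (DirectSum.decompose 𝒜 p (j + -k) : A)
    set q' := (DirectSum.decompose 𝒜 q j : A)
    have hp' : p' ∈ 𝒜 (j + -k) := SetLike.coe_mem _
    have hq' : q' ∈ 𝒜 j := SetLike.coe_mem _
    have hpc : p' ∈ D.constants := decompose_mem_constants hp _
    have hqc : q' ∈ D.constants := decompose_mem_constants hq _
    by_cases hp0 : p' = 0
    · exact Or.inr ⟨q', hqc, by rw [← h1, hp0, zero_add]⟩
    by_cases hq0 : q' = 0
    · exact Or.inl (by rw [← h1, hq0, zero_mul, add_zero]; exact hpc)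
    exfalso
    -- the colors of `p'` and `q'` differ by `k`, which lies in `Γ₋`
    have e1 := h.constant_color hp' hpc hp0
    have e2 := h.constant_color hq' hqc hq0
    rw [h.skew.add_left, h.skew.add_right, h.skew.add_right, e2, hodd, h.skew.symm j (-k)] at e1
    have e3 : (-1 : Fˣ) = 1 := by simpa using e1
    have e4 := congrArg Units.val e3
    rw [Units.val_neg, Units.val_one] at e4
    exact h.two_ne_zero (by linear_combination -e4)
  -- the ideal generated by `t` is not stable under `D`
  obtain ⟨j₀, S₀, hS₀, hS₀c, hS₀t⟩ : ∃ j, ∃ S ∈ D.carrier ⊓ colorDer ε 𝒜 j,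
      S t ∈ D.constants ∧ S t ≠ 0 := by
    by_contra hall
    push Not at hall
    have hmem : ∀ j, ∀ S ∈ D.carrier ⊓ colorDer ε 𝒜 j, ∃ q : A, S t = q * t := by
      intro j S hS
      rcases hcase j S hS with h1 | ⟨q, -, hq⟩
      · exact ⟨0, by rw [zero_mul]; exact hall j S hS h1⟩
      · exact ⟨q, hq⟩
    have hJ := h.ideal_eq (Ideal.span {t})
      (Ideal.homogeneous_span 𝒜 _ (by rintro x rfl; exact ⟨_, ht⟩)) ?_
    · rcases hJ with hJ | hJ
      · rw [Ideal.span_singleton_eq_bot] at hJ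
        rw [hJ, map_zero] at hδt
        exact zero_ne_one hδt
      · have h1 : (1 : A) ∈ Ideal.span {t} := by rw [hJ]; trivial
        obtain ⟨y, hy⟩ := Ideal.mem_span_singleton'.1 h1
        have : t = 0 := by
          calc t = y * t * t := by rw [hy, one_mul]
            _ = 0 := by rw [mul_assoc, htt, mul_zero]
        rw [this, map_zero] at hδt
        exact zero_ne_one hδt
    · intro j S hS b x _ hxJ
      obtain ⟨y, rfl⟩ := Ideal.mem_span_singleton'.1 hxJ
      obtain ⟨q, hq⟩ := hmem j S hS
      rw [← DirectSum.sum_support_decompose 𝒜 y, Finset.sum_mul, map_sum]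
      refine sum_mem fun a _ => ?_
      rw [colorDer_apply_mul hS.2 (SetLike.coe_mem _), hq, ← mul_assoc, ← smul_mul_assoc, ← add_mul]
      exact Ideal.mul_mem_left _ _ (Ideal.mem_span_singleton_self t)
  have hconst : ∀ j, ∀ S ∈ D.carrier ⊓ colorDer ε 𝒜 j, S t ∈ D.constants := by
    intro j S hS
    rcases hcase j S hS with h1 | ⟨q, hq, hqt⟩
    · exact h1
    · have h1 := LinearMap.congr_fun (h.commuting j₀ j S₀ hS₀ S hS) t
      rw [Module.End.mul_apply, LinearMap.smul_apply, Module.End.mul_apply, hS₀c S hS.1, smul_zero,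
        hqt, der_constant_mul hS₀.2 (fun u hu => hu S₀ hS₀.1) hq] at h1
      obtain ⟨v, -, -, -, hv⟩ := h.exists_inv (hS₀.2.1 _ t ht) hS₀c hS₀t
      have h2 : scale ε 𝒜 j₀ q = 0 := by
        calc scale ε 𝒜 j₀ q = scale ε 𝒜 j₀ q * S₀ t * v := by rw [mul_assoc, hv, mul_one]
          _ = 0 := by rw [h1, zero_mul]
      rw [hqt, scale_injective ε 𝒜 j₀ h2, zero_mul]
      exact zero_mem _
  refine ⟨-k, k, t, δ, ht, hodd, htt, fun x => ?_, hδ, hkk, hker, hδt, fun S hS => ?_⟩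
  · obtain ⟨p, q, hp, hq, hpq⟩ := hex x
    refine ⟨(⟨p, hp⟩, ⟨q, hq⟩), hpq, ?_⟩
    rintro ⟨⟨p', hp'⟩, ⟨q', hq'⟩⟩ hpq'
    have h1 := huniq (p' - p) (sub_mem hp' hp) (q' - q) (sub_mem hq' hq) (by
      have : p' + q' * t = p + q * t := hpq'.symm.trans hpq
      rw [sub_mul, sub_add_sub_comm, this, sub_self])
    exact Prod.ext (Subtype.ext (sub_eq_zero.1 h1.1)) (Subtype.ext (sub_eq_zero.1 h1.2))
  · have hS' := D.graded hS
    clear hS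
    induction hS' using Submodule.iSup_induction' with
    | zero => exact ⟨0, zero_mem _, by simp⟩
    | add S S' _ _ h1 h2 =>
      obtain ⟨u, hu, rfl⟩ := h1
      obtain ⟨u', hu', rfl⟩ := h2
      exact ⟨u + u', add_mem hu hu', by rw [map_add, add_mul]⟩
    | mem j S hS => exact ⟨S t, hconst j S hS, hSform j S hS⟩

/-- In the exceptional case, the brackets of elements of `W` are constants. -/
theorem IsWeylDatum.colorBr_of_isExceptional (h : D.IsWeylDatum) (hex : IsExceptional D) {j k : Γ}
    {S T : Module.End F A} (hS : S ∈ D.derivedOps) (hS' : S ∈ homEnd 𝒜 j)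
    (hT : T ∈ D.derivedOps) (hT' : T ∈ homEnd 𝒜 k) :
    ∃ f ∈ D.constants, colorBr ε j k S T = Algebra.lmul F A f := by
  classical
  have hnt := h.simple.nontrivial
  obtain ⟨b, m, t, δ, ht, -, -, hdec, hδ, -, hker, hδt, hDδ⟩ := hex
  have hbm : b = -m := by
    have h1 := hδ.1 b t ht
    rw [hδt] at h1
    by_contra hne
    have h2 := DirectSum.decompose_of_mem_ne 𝒜 h1 (j := 0)
      (fun h0 => hne (eq_neg_of_add_eq_zero_right h0))
    rw [DirectSum.decompose_of_mem_same 𝒜 SetLike.GradedOne.one_mem] at h2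
    exact one_ne_zero h2
  subst hbm
  have himg : ∀ x, δ x ∈ D.constants := by
    intro x
    obtain ⟨⟨p, q⟩, hpq, -⟩ := hdec x
    rw [hpq, map_add, hker _ p.2, zero_add, der_constant_mul hδ hker q.2, hδt, mul_one]
    exact scale_mem_constants q.2
  have hδδ : δ * δ = 0 := by
    ext x
    exact hker _ (himg x)
  have hconst : ∀ f, δ f = 0 → f ∈ D.constants := by
    intro f hf S hS
    obtain ⟨u, -, rfl⟩ := hDδ S hS
    rw [lmul_mul_eq_smul, LinearMap.smul_apply, hf, smul_zero]
  have hprod : ∀ (r : Γ) (a b a' b' : A), a' ∈ 𝒜 r → b' ∈ 𝒜 (r - m) →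
      (a • (1 : Module.End F A) + b • δ) * (a' • 1 + b' • δ) =
      (a * a' + b * δ a') • (1 : Module.End F A) +
        (a * b' + (ε m r : F) • (b * a') + b * δ b') • δ := by
    intro r a b a' b' ha' hb'
    rw [add_mul, mul_add, mul_add, smul_mul_end, smul_mul_end, smul_mul_end, smul_mul_end, one_mul,
      one_mul, colorDer_mul_smul hδ ha', colorDer_mul_smul hδ hb', hδδ, smul_zero, smul_zero,
      add_zero, mul_one, smul_add, smul_smul, smul_smul, smul_smul, smul_smul, smul_comm b,
      smul_smul, add_smul, add_smul, add_smul, smul_assoc]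
    abel
  -- the operators of the form `a + b δ`
  let G : Γ → Submodule F (Module.End F A) := fun r =>
    { carrier := {Q | ∃ a ∈ 𝒜 r, ∃ b ∈ 𝒜 (r - m), Q = a • (1 : Module.End F A) + b • δ}
      zero_mem' := ⟨0, zero_mem _, 0, zero_mem _, by simp⟩
      add_mem' := by
        rintro _ _ ⟨a, ha, b, hb, rfl⟩ ⟨a', ha', b', hb', rfl⟩
        exact ⟨a + a', add_mem ha ha', b + b', add_mem hb hb', by rw [add_smul, add_smul]; abel⟩
      smul_mem' := by
        rintro s _ ⟨a, ha, b, hb, rfl⟩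
        exact ⟨s • a, Submodule.smul_mem _ _ ha, s • b, Submodule.smul_mem _ _ hb, by
          rw [smul_add, smul_assoc, smul_assoc]⟩ }
  have hGhom : ∀ r, G r ≤ homEnd 𝒜 r := by
    rintro r _ ⟨a, ha, b, hb, rfl⟩
    have h1 := smul_mem_homEnd ha (one_mem_homEnd (F := F) (𝒜 := 𝒜))
    have h2 := smul_mem_homEnd hb hδ.1
    rw [add_zero] at h1
    rw [sub_add_cancel] at h2
    exact add_mem h1 h2
  have hG : ∀ r, ∀ Q ∈ D.weyl, Q ∈ homEnd 𝒜 r → Q ∈ G r := by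
    intro r Q hQ hQ'
    refine mem_of_mem_iSup hGhom (D.weyl_le_iSup ?_ ?_ ?_ ?_ hQ) hQ'
    · exact ⟨1, SetLike.GradedOne.one_mem, 0, zero_mem _, by simp⟩
    · rintro r r' _ ⟨a, ha, b, hb, rfl⟩ _ ⟨a', ha', b', hb', rfl⟩
      refine ⟨_, ?_, _, ?_, hprod r' a b a' b' ha' hb'⟩
      · refine add_mem (SetLike.GradedMul.mul_mem ha ha') ?_
        have := SetLike.GradedMul.mul_mem hb (hδ.1 _ _ ha')
        rwa [show r - m + (m + r') = r + r' by abel] at this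
      · refine add_mem (add_mem ?_ (Submodule.smul_mem _ _ ?_)) ?_
        · have := SetLike.GradedMul.mul_mem ha hb'
          rwa [show r + (r' - m) = r + r' - m by abel] at this
        · have := SetLike.GradedMul.mul_mem hb ha'
          rwa [show r - m + r' = r + r' - m by abel] at this
        · have := SetLike.GradedMul.mul_mem hb (hδ.1 _ _ hb')
          rwa [show r - m + (m + (r' - m)) = r + r' - m by abel] at this
    · intro r u hu
      exact ⟨u, hu, 0, zero_mem _, by rw [zero_smul, add_zero, lmul_eq_smul_one]⟩
    · intro r P hP
      obtain ⟨u, hu, huP⟩ := hDδ P hP.1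
      have hPt : P t = u := by
        rw [huP, lmul_mul_eq_smul, LinearMap.smul_apply, hδt, smul_eq_mul, mul_one]
      refine ⟨0, zero_mem _, u, ?_, by rw [zero_smul, zero_add, huP]; rfl⟩
      rw [← hPt, sub_eq_add_neg]
      exact hP.2.1 _ t ht
  have hbr : ∀ (r r' : Γ) (a b a' b' : A), a ∈ 𝒜 r → b ∈ 𝒜 (r - m) → a' ∈ 𝒜 r' →
      b' ∈ 𝒜 (r' - m) →
      colorBr ε r r' (a • (1 : Module.End F A) + b • δ) (a' • 1 + b' • δ) =
        (b * δ a' - (ε r r' : F) • (b' * δ a)) • (1 : Module.End F A) +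
        (b * δ b' - (ε r r' : F) • (b' * δ b)) • δ := by
    intro r r' a b a' b' ha hb ha' hb'
    rw [colorBr, hprod r' a b a' b' ha' hb', hprod r a' b' a b ha hb, h.comm r r' a ha a' ha',
      h.comm _ _ a ha b' hb', h.comm _ _ b hb a' ha', sub_eq_add_neg r' m, sub_eq_add_neg r m,
      h.skew.add_right, h.skew.add_left r, h.skew.neg_right r, h.skew.neg_left,
      ← h.skew.symm m r, smul_smul]
    have e : (ε m r' : F) * (ε r r' * (ε m r')⁻¹ : Fˣ) = ε r r' := by
      rw [Units.val_mul, mul_left_comm, Units.mul_inv, mul_one]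
    have hsub : ∀ (x y : A) (Q : Module.End F A), (x - y) • Q = x • Q - y • Q := fun x y Q =>
      LinearMap.ext fun z => sub_mul x y (Q z)
    rw [e, Units.val_mul, hsub, hsub]
    simp only [smul_add, add_smul, smul_assoc, smul_smul]
    abel
  -- the brackets are of the form `g + f δ` with a constant `f`
  have hcoef : ∀ (r r' : Γ) (b b' : A), b ∈ 𝒜 (r - m) → b' ∈ 𝒜 (r' - m) →
      b * δ b' - (ε r r' : F) • (b' * δ b) ∈ D.constants := by
    intro r r' b b' hb hb'
    have h1 := hδ.1 _ _ hb
    have h2 := hδ.1 _ _ hb'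
    rw [add_sub_cancel] at h1 h2
    refine hconst _ ?_
    rw [map_sub, map_smul, colorDer_apply_mul hδ hb, colorDer_apply_mul hδ hb', hker _ (himg b),
      hker _ (himg b'), mul_zero, mul_zero, smul_zero, smul_zero, add_zero, add_zero,
      h.comm r r' _ h1 _ h2, sub_self]
  have hW : ∀ r, ∀ Q ∈ D.derivedOps, Q ∈ homEnd 𝒜 r →
      ∃ a ∈ 𝒜 r, ∃ b ∈ 𝒜 (r - m), b ∈ D.constants ∧ Q = a • (1 : Module.End F A) + b • δ := by
    let G' : Γ → Submodule F (Module.End F A) := fun r =>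
      { carrier := {Q | ∃ a ∈ 𝒜 r, ∃ b ∈ 𝒜 (r - m), b ∈ D.constants ∧
          Q = a • (1 : Module.End F A) + b • δ}
        zero_mem' := ⟨0, zero_mem _, 0, zero_mem _, zero_mem _, by simp⟩
        add_mem' := by
          rintro _ _ ⟨a, ha, b, hb, hbc, rfl⟩ ⟨a', ha', b', hb', hbc', rfl⟩
          exact ⟨a + a', add_mem ha ha', b + b', add_mem hb hb', add_mem hbc hbc', by
            rw [add_smul, add_smul]; abel⟩
        smul_mem' := by
          rintro s _ ⟨a, ha, b, hb, hbc, rfl⟩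
          exact ⟨s • a, Submodule.smul_mem _ _ ha, s • b, Submodule.smul_mem _ _ hb,
            D.constants.smul_mem hbc s, by rw [smul_add, smul_assoc, smul_assoc]⟩ }
    intro r Q hQ hQ'
    have hle : D.derivedOps ≤ ⨆ r, G' r := by
      refine derivedOps_le fun r r' S hS hS' T hT hT' => Submodule.mem_iSup_of_mem (r + r') ?_
      obtain ⟨a, ha, b, hb, rfl⟩ := hG r S hS hS'
      obtain ⟨a', ha', b', hb', rfl⟩ := hG r' T hT hT'
      refine ⟨_, ?_, _, ?_, hcoef r r' b b' hb hb', hbr r r' a b a' b' ha hb ha' hb'⟩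
      · refine sub_mem ?_ (Submodule.smul_mem _ _ ?_)
        · have := SetLike.GradedMul.mul_mem hb (hδ.1 _ _ ha')
          rwa [show r - m + (m + r') = r + r' by abel] at this
        · have := SetLike.GradedMul.mul_mem hb' (hδ.1 _ _ ha)
          rwa [show r' - m + (m + r) = r + r' by abel] at this
      · refine sub_mem ?_ (Submodule.smul_mem _ _ ?_)
        · have := SetLike.GradedMul.mul_mem hb (hδ.1 _ _ hb')
          rwa [show r - m + (m + (r' - m)) = r + r' - m by abel] at this
        · have := SetLike.GradedMul.mul_mem hb' (hδ.1 _ _ hb)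
          rwa [show r' - m + (m + (r - m)) = r + r' - m by abel] at this
    have hG' : ∀ r, G' r ≤ homEnd 𝒜 r := by
      rintro r _ ⟨a, ha, b, hb, -, rfl⟩
      exact hGhom r ⟨a, ha, b, hb, rfl⟩
    exact mem_of_mem_iSup hG' (hle hQ) hQ'
  obtain ⟨a, ha, b, hb, hbc, rfl⟩ := hW j S hS hS'
  obtain ⟨a', ha', b', hb', hbc', rfl⟩ := hW k T hT hT'
  refine ⟨b * δ a' - (ε j k : F) • (b' * δ a), sub_mem (mul_mem hbc (himg _))
    (D.constants.smul_mem (mul_mem hbc' (himg _)) _), ?_⟩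
  rw [hbr j k a b a' b' ha hb ha' hb', hker b hbc, hker b' hbc', mul_zero, mul_zero, smul_zero,
    sub_zero, zero_smul, add_zero, lmul_eq_smul_one]

end GradedDerSubspace
end Exceptional
end WeylColor

namespace WeylColor

section Simplicity

variable {Γ F A I : Type*} [AddCommGroup Γ] [DecidableEq Γ] [Field F] [Ring A] [Algebra F A]
  {ε : Γ → Γ → Fˣ} {𝒜 : Γ → Submodule F A} [GradedAlgebra 𝒜] {D : GradedDerSubspace ε 𝒜}

open GradedDerSubspace

/-! ### Ideals of `W` and the leading coefficients -/

namespace GradedDerSubspace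

/-- `U` is a Lie color ideal of `W`, as a space of operators. -/
structure IsDerivedIdeal (D : GradedDerSubspace ε 𝒜) (U : Submodule F (Module.End F A)) :
    Prop where
  le : U ≤ D.derivedOps
  graded : IsGradedSubspace (homEnd 𝒜) U
  bracket_mem : ∀ j k, ∀ S ∈ D.derivedOps, S ∈ homEnd 𝒜 j → ∀ T ∈ U, T ∈ homEnd 𝒜 k →
    colorBr ε j k S T ∈ U

theorem IsDerivedIdeal.bracket_mem' {U : Submodule F (Module.End F A)} (hU : D.IsDerivedIdeal U)
    (hε : IsSkewBicharacter ε) {j k : Γ} {S T : Module.End F A} (hS : S ∈ U) (hS' : S ∈ homEnd 𝒜 j)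
    (hT : T ∈ D.derivedOps) (hT' : T ∈ homEnd 𝒜 k) : colorBr ε j k S T ∈ U := by
  rw [colorBr_swap hε]
  exact neg_mem (Submodule.smul_mem _ _ (hU.bracket_mem k j T hT hT' S hS hS'))

theorem colorBr_der_lmul (hε : IsSkewBicharacter ε) {k b : Γ} {P : Module.End F A}
    (hP : P ∈ colorDer ε 𝒜 k) {x : A} (hx : x ∈ 𝒜 b) :
    colorBr ε k b P (Algebra.lmul F A x) = Algebra.lmul F A (P x) := by
  have h1 := colorBr_der_smul hε hP (T := 1) (s := 0)
    (by rw [mul_one, one_mul, hε.zero_right, Units.val_one, one_smul]) hx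
  rwa [add_zero, ← lmul_eq_smul_one, ← lmul_eq_smul_one] at h1

end GradedDerSubspace

namespace IsWeylBasis

variable [LinearOrder I] {d : I → Module.End F A} {c : I → Γ} {U : Submodule F (Module.End F A)}

theorem der_ne_zero (h : IsWeylBasis D d c) (i : I) : d i ≠ 0 := by
  have hnt := h.simple.nontrivial
  exact h.basis.linearIndependent.ne_zero i

theorem nonempty (h : IsWeylBasis D d c) : Nonempty I := by
  by_contra hI
  rw [not_nonempty_iff] at hI
  refine h.ne_bot (eq_bot_iff.2 fun P hP => ?_)
  have hP' := D.graded hP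
  clear hP
  induction hP' using Submodule.iSup_induction' with
  | zero => exact zero_mem _
  | add S T _ _ hS hT => exact add_mem hS hT
  | mem k P hP =>
    have := h.mem_span (mem_fullDer_of_mem hP)
    rw [Set.range_eq_empty, Submodule.span_empty, Submodule.mem_bot] at this
    rw [this]
    exact zero_mem _

/-- Outside the exceptional case there are monomials of order two. If `d i` had no multiple of order
two, `D` would consist of multiples of `d i`, with `d i * d i = 0`, and `d i` would have constant
values. -/
theorem exists_single_add_single_mem (h : IsWeylBasis D d c) (hex : ¬ IsExceptional D) (i : I) :
    ∃ j, Finsupp.single i 1 + Finsupp.single j 1 ∈ exponents ε c := by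
  by_contra hall
  push Not at hall
  have hle : ∀ α ∈ exponents ε c, α ≤ Finsupp.single i 1 := fun α hα =>
    le_of_forall_notMem (single_mem_exponents h.char_ne_two i) hall hα
  have huniq : ∀ j, j = i := fun j => by
    by_contra hji
    have h1 := hle _ (single_mem_exponents (ε := ε) (c := c) h.char_ne_two j) j
    rw [Finsupp.single_eq_same, Finsupp.single_eq_of_ne hji] at h1
    omega
  have hodd : ε (c i) (c i) = -1 := by
    by_contra hne
    refine hall i fun j => ?_
    rw [huniq j, Finsupp.add_apply, Finsupp.single_eq_same]
    refine ⟨fun h0 => ?_, fun h1 => absurd h1 hne⟩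
    have := three_le_ringChar h.char_ne_two h0
    omega
  refine hex (h.isExceptional_of_der (h.mem_colorDer i) (h.der_ne_zero i) (fun x => ?_)
    (fun u hu => h.apply_constant i hu))
  rw [mem_constants_iff]
  intro k P hP
  have h1 := h.mem_span (mem_fullDer_of_mem hP)
  have hr : Set.range d = {d i} := by
    ext T
    constructor
    · rintro ⟨j, rfl⟩
      rw [huniq j]
      rfl
    · rintro rfl
      exact ⟨i, rfl⟩
  rw [hr, Submodule.mem_span_singleton] at h1
  obtain ⟨u, rfl⟩ := h1
  change (u : A) * d i (d i x) = 0
  rw [← Module.End.mul_apply, h.mul_self hodd, LinearMap.zero_apply, mul_zero]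

theorem lmul_mem_derivedOps (h : IsWeylBasis D d c) (a : A) :
    Algebra.lmul F A a ∈ D.derivedOps := by
  obtain ⟨i⟩ := h.nonempty
  have := h.smul_monomial_mem_derivedOps (β := 0) (i := i)
    (by rw [zero_add]; exact single_mem_exponents h.char_ne_two i) a
  rwa [monomial_zero, ← lmul_eq_smul_one] at this

theorem smul_fullDer_mem (h : IsWeylBasis D d c) {V : Submodule F (Module.End F A)}
    (hV : ∀ i, ∀ a : A, a • d i ∈ V) {P : Module.End F A} (hP : P ∈ D.fullDer) (a : A) :
    a • P ∈ V := by
  have hP' := h.mem_span hP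
  clear hP
  induction hP' using Submodule.span_induction generalizing a with
  | zero => rw [smul_zero]; exact zero_mem _
  | add S T _ _ hS hT => rw [smul_add]; exact add_mem (hS a) (hT a)
  | smul u T _ hT =>
    have h1 := hT (a * u)
    rwa [mul_smul] at h1
  | mem T hT => obtain ⟨i, rfl⟩ := hT; exact hV i a

theorem smul_fullDer_mem_derivedOps (h : IsWeylBasis D d c) (hex : ¬ IsExceptional D)
    {P : Module.End F A} (hP : P ∈ D.fullDer) (a : A) : a • P ∈ D.derivedOps := by
  refine h.smul_fullDer_mem (fun i a => ?_) hP a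
  obtain ⟨j, hj⟩ := h.exists_single_add_single_mem hex i
  rw [← monomial_single d i]
  exact h.smul_monomial_mem_derivedOps hj a

theorem isAdStable_of_isDerivedIdeal (h : IsWeylBasis D d c) (hex : ¬ IsExceptional D)
    (hU : D.IsDerivedIdeal U) : D.IsAdStable U where
  graded := hU.graded
  ad_mem k P hP j S hS hS' := by
    have := h.smul_fullDer_mem_derivedOps hex (mem_fullDer_of_mem hP) 1
    rw [one_smul] at this
    exact hU.bracket_mem k j P this hP.2.1 S hS hS'

/-- An ideal of `W` which does not consist of constants contains a nonconstant element of `A`: take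
a nonconstant operator of minimal order. If it has order one and its brackets with `A` are constant,
it differs from an element of `A` by a derivation with constant values. -/
theorem exists_lmul_mem (h : IsWeylBasis D d c) (hex : ¬ IsExceptional D)
    (hU : D.IsDerivedIdeal U) (hne : ∃ T ∈ U, ∀ u ∈ D.constants, T ≠ Algebra.lmul F A u) :
    ∃ b, ∃ x ∈ 𝒜 b, x ∉ D.constants ∧ Algebra.lmul F A x ∈ U := by
  classical
  have hhom : ∃ n t, ∃ T ∈ U, T ∈ homEnd 𝒜 t ∧ T ∈ filt ε d c n ∧
      ∀ u ∈ D.constants, T ≠ Algebra.lmul F A u := by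
    by_contra hall
    push Not at hall
    obtain ⟨T, hT, hTne⟩ := hne
    have hle : U ≤ (Subalgebra.toSubmodule D.constants).map (Algebra.lmul F A).toLinearMap := by
      refine hU.graded.trans (iSup_le fun t S hS => ?_)
      obtain ⟨n, hn⟩ := h.exists_mem_filt (D.derivedOps_le_weyl (hU.le hS.1))
      obtain ⟨u, hu, hSu⟩ := hall n t S hS.1 hS.2 hn
      exact ⟨u, hu, hSu.symm⟩
    obtain ⟨u, hu, hTu⟩ := hle hT
    exact hTne u hu hTu.symm
  obtain ⟨t, T, hTU, ht, hTn, hTne⟩ := Nat.find_spec hhom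
  have hmin := fun m (hm : m < Nat.find hhom) => Nat.find_min hhom hm
  generalize Nat.find hhom = n at hTn hmin
  rcases n with _ | _ | m
  · rw [filt_zero, Submodule.mem_bot] at hTn
    exact absurd (by rw [hTn, map_zero]) (hTne 0 (zero_mem _))
  · have hT1 := mem_filt_one hTn
    have := ht 0 1 SetLike.GradedOne.one_mem
    rw [add_zero] at this
    exact ⟨t, T 1, this, fun hc => hTne _ hc hT1, hT1 ▸ hTU⟩
  exfalso
  have hbr : ∀ b, ∀ x ∈ 𝒜 b, ∃ u ∈ D.constants,
      colorBr ε t b T (Algebra.lmul F A x) = Algebra.lmul F A u := by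
    intro b x hx
    by_contra hall
    push Not at hall
    exact hmin (m + 1) (by omega) ⟨t + b, _, hU.bracket_mem' h.skew hTU ht
      (h.lmul_mem_derivedOps x) (lmul_mem_homEnd hx), colorBr_mem_homEnd ht (lmul_mem_homEnd hx),
      h.colorBr_lmul_mem_filt hTn ht hx, hall⟩
  rcases m with _ | m
  · -- `T - T 1` is a derivation
    have hT1 := ht 0 1 SetLike.GradedOne.one_mem
    rw [add_zero] at hT1
    set S := T - Algebra.lmul F A (T 1) with hS
    have hSx : ∀ b, ∀ x ∈ 𝒜 b, colorBr ε t b T (Algebra.lmul F A x) = Algebra.lmul F A (S x) := by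
      intro b x hx
      obtain ⟨u, -, hu⟩ := hbr b x hx
      have h1 := LinearMap.congr_fun hu 1
      rw [hu]
      congr 1
      simp only [colorBr, LinearMap.sub_apply, Module.End.mul_apply, LinearMap.smul_apply,
        Algebra.coe_lmul_eq_mul, LinearMap.mul_apply', mul_one] at h1
      rw [hS, LinearMap.sub_apply, Algebra.coe_lmul_eq_mul, LinearMap.mul_apply', ← h1,
        h.comm t b _ hT1 x hx]
    have hSder : S ∈ colorDer ε 𝒜 t := by
      refine ⟨sub_mem ht (lmul_mem_homEnd hT1), fun b b' x hx y hy => ?_⟩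
      have h1 := LinearMap.congr_fun (hSx b x hx) y
      simp only [colorBr, LinearMap.sub_apply, Module.End.mul_apply, LinearMap.smul_apply,
        Algebra.coe_lmul_eq_mul, LinearMap.mul_apply'] at h1
      rw [← h1]
      simp only [hS, LinearMap.sub_apply, Algebra.coe_lmul_eq_mul, LinearMap.mul_apply', mul_sub,
        smul_sub]
      rw [← mul_assoc, ← mul_assoc, h.comm t b _ hT1 x hx, smul_mul_assoc]
      abel
    have hSval : ∀ x, S x ∈ D.constants := by
      intro x
      induction x using DirectSum.Decomposition.inductionOn 𝒜 with
      | zero => rw [map_zero]; exact zero_mem _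
      | @homogeneous b x =>
        obtain ⟨u, hu, hxu⟩ := hbr b x x.2
        rw [hSx b x x.2] at hxu
        have := LinearMap.congr_fun hxu 1
        simp only [Algebra.coe_lmul_eq_mul, LinearMap.mul_apply', mul_one] at this
        rwa [this]
      | add x y hx hy => rw [map_add]; exact add_mem hx hy
    refine hex (h.isExceptional_of_der hSder ?_ hSval fun u hu => ?_)
    · intro hS0
      have hT : T = Algebra.lmul F A (T 1) := sub_eq_zero.1 hS0
      refine hmin 1 (by omega) ⟨t, T, hTU, ht, ?_, hTne⟩
      rw [hT]
      exact lmul_mem_filt _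
    · rw [← DirectSum.sum_support_decompose 𝒜 u, map_sum]
      refine Finset.sum_eq_zero fun b _ => ?_
      have h1 := mul_lmul_constant h.skew h.comm D (SetLike.coe_mem (DirectSum.decompose 𝒜 u b))
        (decompose_mem_constants hu b) (D.derivedOps_le_weyl (hU.le hTU)) ht
      have h2 := hSx b _ (SetLike.coe_mem (DirectSum.decompose 𝒜 u b))
      rw [colorBr, h1, sub_self] at h2
      have := LinearMap.congr_fun h2 1
      simpa using this.symm
  · refine hmin (m + 2) (by omega) ⟨t, T, hTU, ht, h.mem_filt_of_colorBr hTn ht fun b x hx => ?_,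
      hTne⟩
    obtain ⟨u, -, hu⟩ := hbr b x hx
    rw [hu]
    exact filt_mono (by omega) (lmul_mem_filt u)

/-- An ideal of `W` which contains a nonconstant element of `A` contains `A`. -/
theorem lmul_mem (h : IsWeylBasis D d c) (hex : ¬ IsExceptional D) (hU : D.IsDerivedIdeal U)
    (hne : ∃ b, ∃ x ∈ 𝒜 b, x ∉ D.constants ∧ Algebra.lmul F A x ∈ U) (a : A) :
    Algebra.lmul F A a ∈ U := by
  classical
  have key : ∀ k, ∀ P ∈ D.carrier ⊓ colorDer ε 𝒜 k, ∀ b, ∀ x ∈ 𝒜 b, Algebra.lmul F A x ∈ U →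
      ∀ a, Algebra.lmul F A (a * P x) ∈ U := by
    intro k P hP b x hx hxU a
    induction a using DirectSum.Decomposition.inductionOn 𝒜 with
    | zero => rw [zero_mul, map_zero]; exact zero_mem _
    | add a a' ha ha' => rw [add_mul, map_add]; exact add_mem ha ha'
    | @homogeneous r a =>
      have h1 := hU.bracket_mem (r + k) b _
        (h.smul_fullDer_mem_derivedOps hex (mem_fullDer_of_mem hP) (a : A))
        (smul_mem_homEnd a.2 hP.2.1) _ hxU (lmul_mem_homEnd hx)
      rwa [colorBr_smul_lmul h.skew h.comm a.2 hx, colorBr_der_lmul h.skew hP.2 hx,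
        ← lmul_mul_eq_smul, ← map_mul] at h1
  let J : Ideal A :=
    { carrier := {v | ∀ a, Algebra.lmul F A (a * v) ∈ U}
      zero_mem' := fun a => by rw [mul_zero, map_zero]; exact zero_mem _
      add_mem' := fun hv hw a => by rw [mul_add, map_add]; exact add_mem (hv a) (hw a)
      smul_mem' := fun b v hv a => by rw [smul_eq_mul, ← mul_assoc]; exact hv (a * b) }
  have hJ : J = ⊥ ∨ J = ⊤ := by
    refine h.ideal_eq J (fun b v hv a => ?_) (fun k P hP b x hx hxJ => ?_)
    · induction a using DirectSum.Decomposition.inductionOn 𝒜 with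
      | zero => rw [zero_mul, map_zero]; exact zero_mem _
      | add a a' ha ha' => rw [add_mul, map_add]; exact add_mem ha ha'
      | @homogeneous r a =>
        have h1 := opProj_mem_of_graded hU.graded (r + b) (hv (a : A))
        rw [lmul_eq_smul_one, opProj_smul a.2 one_mem_homEnd, sub_zero, add_sub_cancel_left,
          ← lmul_eq_smul_one] at h1
        exact h1
    · refine key k P hP b x hx ?_
      have := hxJ 1
      rwa [one_mul] at this
  rcases hJ with hJ | hJ
  · exfalso
    obtain ⟨b, x, hx, hxc, hxU⟩ := hne
    refine hxc (mem_constants_iff.2 fun k P hP => ?_)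
    have : P x ∈ J := key k P hP b x hx hxU
    rw [hJ] at this
    exact this
  · have h1 : (1 : A) ∈ J := by rw [hJ]; trivial
    have := h1 a
    rwa [mul_one] at this

/-- An ideal of `W` which contains `A` contains `A d ^ β` as soon as `β` can be raised twice. -/
theorem smul_monomial_mem (h : IsWeylBasis D d c) (hex : ¬ IsExceptional D)
    (hU : D.IsDerivedIdeal U) (hA : ∀ a, Algebra.lmul F A a ∈ U) {β : I →₀ ℕ} {i j : I}
    (hij : β + Finsupp.single i 1 + Finsupp.single j 1 ∈ exponents ε c) (a : A) :
    a • monomial d β ∈ U := by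
  induction hn : β.degree using Nat.strong_induction_on generalizing β i j a with
  | _ n ih =>
  subst hn
  have hi : β + Finsupp.single i 1 ∈ exponents ε c :=
    exponents_mono hij (le_add_of_nonneg_right zero_le)
  have := h.smul_monomial_sub_single_mem (h.isAdStable_of_isDerivedIdeal hex hU) hi ?_ ?_ (j := i)
    (by simp) a
  · rwa [add_tsub_cancel_right] at this
  · intro T hT
    refine filt_subset (fun α hα hdeg a => ?_) hT
    rw [degree_add_single, Nat.add_sub_cancel] at hdeg
    -- a multi-index which cannot be raised dominates all the others
    have hraise : ∀ α ∈ exponents ε c, α.degree < β.degree + 2 →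
        ∃ k, α + Finsupp.single k 1 ∈ exponents ε c := by
      intro α hα hdeg
      by_contra hall
      push Not at hall
      have := degree_mono (le_of_forall_notMem hα hall hij)
      rw [degree_add_single, degree_add_single] at this
      omega
    obtain ⟨k, hk⟩ := hraise α hα (by omega)
    obtain ⟨l, hl⟩ := hraise _ hk (by rw [degree_add_single]; omega)
    exact ih α.degree hdeg hl a rfl
  · intro r a ha b x hx
    rw [← colorBr_smul_lmul h.skew h.comm ha hx]
    exact hU.bracket_mem _ _ _ (h.smul_monomial_mem_derivedOps hij a)
      (smul_mem_homEnd ha (h.monomial_mem_homEnd _)) _ (hA x) (lmul_mem_homEnd hx)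

end IsWeylBasis
end Simplicity
end WeylColor

namespace WeylColor

section TopTerm

variable {Γ F A I : Type*} [AddCommGroup Γ] [DecidableEq Γ] [Field F] [Ring A] [Algebra F A]
  {ε : Γ → Γ → Fˣ} {𝒜 : Γ → Submodule F A} [GradedAlgebra 𝒜] {D : GradedDerSubspace ε 𝒜}

open GradedDerSubspace

/-! ### Leading coefficients below the maximal monomial -/

namespace IsWeylBasis

variable [LinearOrder I] {d : I → Module.End F A} {c : I → Γ} {U : Submodule F (Module.End F A)}

/-- The leading coefficients, at `d ^ (α - e j)`, of the bracket of `d ^ α` with the element `x` of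
color `ξ`, normalized so that the factor `ε` for `d ^ α` and `x` is left out. The numbers `κ j`
include the exponents `α j`. -/
def leadingCoeff (ε : Γ → Γ → Fˣ) (d : I → Module.End F A) (c : I → Γ) (α : I →₀ ℕ) (κ : I → F)
    (ξ : Γ) (x : A) : α.support → A :=
  fun j => ((κ j * ε ξ (c j)) • d j x)

theorem leadingCoeff_mul (h : IsWeylBasis D d c) (α : I →₀ ℕ) (κ : I → F) {ξ ζ : Γ} {x z : A}
    (hx : x ∈ 𝒜 ξ) (hz : z ∈ 𝒜 ζ) :
    leadingCoeff ε d c α κ (ξ + ζ) (x * z) =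
      ((ε ξ ζ : F) • z) • leadingCoeff ε d c α κ ξ x + x • leadingCoeff ε d c α κ ζ z := by
  funext j
  simp only [leadingCoeff, Pi.add_apply, Pi.smul_apply, smul_eq_mul]
  rw [colorDer_apply_mul (h.mem_colorDer j) hx, h.comm _ _ _ ((h.mem_colorDer j).1 ξ x hx) z hz,
    h.skew.add_left, h.skew.add_left, smul_add, smul_smul, smul_smul, mul_smul_comm, mul_smul_comm,
    smul_mul_assoc, smul_smul]
  have e := h.skew.mul_swap ξ (c j)
  push_cast
  congr 2
  · linear_combination (κ j * ε ξ (c j) * ε ξ ζ) * h.skew.mul_swap ζ (c j)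
  · linear_combination (κ j * ε ζ (c j)) * e

/-- If the combinations of the leading coefficient vectors `v` with coefficients in `𝒟(A)` lie in a
subspace, so do the `A`-multiples of `∂(a) v(z) ± ∂(z) v(a)`. -/
theorem leadingCoeff_symm_mem (h : IsWeylBasis D d c) {α : I →₀ ℕ} {κ : I → F}
    {V : Submodule F (α.support → A)} {k : Γ} {P : Module.End F A} (hP : P ∈ colorDer ε 𝒜 k)
    (hV : ∀ ω, ∀ w ∈ 𝒜 ω, ∀ ξ, ∀ x ∈ 𝒜 ξ, P w • leadingCoeff ε d c α κ ξ x ∈ V)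
    {ξ η ζ : Γ} {x a z : A} (hx : x ∈ 𝒜 ξ) (ha : a ∈ 𝒜 η) (hz : z ∈ 𝒜 ζ) :
    x • (P a • leadingCoeff ε d c α κ ζ z +
      (ε η ζ : F) • P z • leadingCoeff ε d c α κ η a) ∈ V := by
  have h1 := hV _ _ (SetLike.GradedMul.mul_mem hz ha) ξ x hx
  have h2 := hV _ _ hz _ _ (SetLike.GradedMul.mul_mem ha hx)
  have h3 := hV _ _ ha _ _ (SetLike.GradedMul.mul_mem hx hz)
  rw [h.leadingCoeff_mul α κ ha hx] at h2
  rw [h.leadingCoeff_mul α κ hx hz] at h3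
  rw [colorDer_apply_mul hP hz] at h1
  have c1 : z * P a = (ε ζ (k + η) : F) • (P a * z) := h.comm _ _ z hz _ (hP.1 _ a ha)
  have c2 : x * P a = (ε ξ (k + η) : F) • (P a * x) := h.comm _ _ x hx _ (hP.1 _ a ha)
  have c3 : x * P z = (ε ξ (k + ζ) : F) • (P z * x) := h.comm _ _ x hx _ (hP.1 _ z hz)
  have e1 := h.skew.mul_swap ζ k
  have e2 := h.skew.mul_swap ξ η
  have e3 := h.skew.mul_swap ξ ζ
  have e4 := h.skew.mul_swap η ζ
  have h4 : x • (P a • leadingCoeff ε d c α κ ζ z +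
      (ε η ζ : F) • P z • leadingCoeff ε d c α κ η a) =
    (ε ξ (k + η) : F) • (P a • (((ε ξ ζ : F) • z) • leadingCoeff ε d c α κ ξ x +
      x • leadingCoeff ε d c α κ ζ z)) +
    ((ε ξ (k + ζ) : F) * ε η ζ * ε ξ η) • (P z • (((ε η ξ : F) • x) • leadingCoeff ε d c α κ η a +
      a • leadingCoeff ε d c α κ ξ x)) -
    ((ε ξ (k + ζ) : F) * ε η ζ * ε ξ η) • ((P z * a + (ε k ζ : F) • (z * P a)) •
      leadingCoeff ε d c α κ ξ x) := by
    rw [c1]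
    generalize leadingCoeff ε d c α κ ζ z = Z
    generalize leadingCoeff ε d c α κ η a = Y
    generalize leadingCoeff ε d c α κ ξ x = X
    funext j
    simp only [Pi.add_apply, Pi.sub_apply, Pi.smul_apply, smul_eq_mul, mul_add, add_mul,
      smul_add, smul_mul_assoc, mul_smul_comm, smul_smul, ← mul_assoc, c2, c3]
    generalize P a * x * Z j = t1
    generalize P z * x * Y j = t2
    generalize P a * z * X j = t3
    generalize P z * a * X j = t4
    have f1 : (ε η ζ : F) * ε ξ (k + ζ) = ε ξ (k + ζ) * ε η ζ * ε ξ η * ε η ξ := by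
      linear_combination -(ε ξ (k + ζ) : F) * ε η ζ * e2
    have f2 : (ε ξ (k + ζ) : F) * ε η ζ * ε ξ η * ε k ζ * ε ζ (k + η) =
        ε ξ (k + η) * ε ξ ζ := by
      rw [h.skew.add_right, h.skew.add_right, h.skew.add_right]
      push_cast
      linear_combination ((ε ξ k : F) * ε ξ ζ * ε ξ η) * ((ε k ζ : F) * ε ζ k * e4 + e1)
    rw [f1, f2]
    module
  rw [h4]
  exact sub_mem (add_mem (Submodule.smul_mem _ _ h3) (Submodule.smul_mem _ _ h2))
    (Submodule.smul_mem _ _ h1)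

/-- No nonzero derivation `δ = ∑ w j • d j` with constant coefficients satisfies
`∂(a) δ(z) ± ∂(z) δ(a) = 0` for all basis derivations `∂`, except in the case of a single odd basis
derivation: compare the coefficients in the resulting relations `δ(z) ∂ ± ∂(z) δ = 0`. -/
theorem eq_zero_of_symm (h : IsWeylBasis D d c) {s : Finset I} {ν : Γ} {w : s → A}
    (hw : ∀ j, w j ∈ D.constants ∧ w j ∈ 𝒜 (ν - c j))
    (hs : ∀ i ∈ s, ε (c i) (c i) = -1 → ∃ j ∈ s, j ≠ i)
    (hsym : ∀ i ∈ s, ∀ η, ∀ a ∈ 𝒜 η, ∀ ζ, ∀ z ∈ 𝒜 ζ,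
      (ε ζ ν : F) • (d i a * (∑ j, w j • d j) z) +
        ((ε η ζ : F) * ε η ν) • (d i z * (∑ j, w j • d j) a) = 0) : w = 0 := by
  classical
  set δ := ∑ j, w j • d j with hδ
  have hδhom : δ ∈ homEnd 𝒜 ν := by
    refine sum_mem fun j _ => ?_
    have := smul_mem_homEnd (hw j).2 (h.mem_colorDer j).1
    rwa [sub_add_cancel] at this
  -- the relation, as an identity of operators
  have hop : ∀ i ∈ s, ∀ ζ, ∀ z ∈ 𝒜 ζ,
      (((ε ζ ν : F) * ε (c i) (ν + ζ)) • δ z) • d i + d i z • δ = 0 := by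
    intro i hi ζ z hz
    refine end_ext (𝒜 := 𝒜) fun η a ha => ?_
    have h1 := hsym i hi η a ha ζ z hz
    rw [h.comm _ _ _ ((h.mem_colorDer i).1 η a ha) _ (hδhom ζ z hz), smul_smul, h.skew.add_left,
      Units.val_mul, h.skew.add_right η ν ζ, Units.val_mul] at h1
    have e : (ε η ν : F) * ε η ζ ≠ 0 := mul_ne_zero (Units.ne_zero _) (Units.ne_zero _)
    refine (smul_eq_zero.1 (?_ : ((ε η ν : F) * ε η ζ) • ((((ε ζ ν : F) * ε (c i) (ν + ζ)) • δ z) •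
      d i + d i z • δ) a = 0)).resolve_left e
    rw [← h1]
    simp only [LinearMap.add_apply, LinearMap.smul_apply, smul_eq_mul, smul_add, smul_mul_assoc,
      smul_smul]
    congr 2 <;> ring
  have hcoef : ∀ (i : s) ζ, ∀ z ∈ 𝒜 ζ, ∀ j,
      (if j = i then ((ε ζ ν : F) * ε (c i) (ν + ζ)) • δ z else 0) + d i z * w j = 0 := by
    intro i ζ z hz j
    refine congrFun (h.basis_coeff_eq_zero (s := s) (v := fun j =>
      (if j = i then ((ε ζ ν : F) * ε (c i) (ν + ζ)) • δ z else 0) + d i z * w j) ?_) j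
    rw [← hop i i.2 ζ z hz, hδ, Finset.smul_sum]
    simp only [add_smul, ite_smul, zero_smul, Finset.sum_add_distrib, Finset.sum_ite_eq',
      Finset.mem_univ, if_true, mul_smul]
  have hvan : ∀ (i j : s), w j ≠ 0 → ∃ ζ, ∃ z ∈ 𝒜 ζ, d i z * w j ≠ 0 := by
    intro i j hj
    by_contra hall
    push Not at hall
    obtain ⟨v, -, -, -, hv⟩ := h.exists_inv (hw j).2 (hw j).1 hj
    refine h.der_ne_zero i (end_ext (𝒜 := 𝒜) fun ζ z hz => ?_)
    rw [LinearMap.zero_apply, ← mul_one (d i z), ← hv, ← mul_assoc, hall ζ z hz, zero_mul]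
  have hoff : ∀ (i j : s), j ≠ i → w j = 0 := by
    intro i j hij
    by_contra hj
    obtain ⟨ζ, z, hz, hne⟩ := hvan i j hj
    have := hcoef i ζ z hz j
    rw [if_neg hij, zero_add] at this
    exact hne this
  funext i
  by_contra hi
  have honly : ∀ j : s, j = i := by
    intro j
    by_contra hji
    exact hi (hoff j i (Ne.symm hji))
  have heven : ε (c i) (c i) = 1 := by
    refine (h.skew.self_eq (c i)).resolve_right fun hodd => ?_
    obtain ⟨j, hj, hji⟩ := hs i i.2 hodd
    exact hji (congrArg Subtype.val (honly ⟨j, hj⟩))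
  obtain ⟨ζ, z, hz, hne⟩ := hvan i i hi
  have h1 := hcoef i ζ z hz i
  have hδz : δ z = w i * d i z := by
    rw [hδ, Finset.sum_eq_single i (fun j _ hj => absurd (honly j) hj)
      (fun h0 => absurd (Finset.mem_univ _) h0)]
    rfl
  rw [if_pos rfl, hδz, h.comm _ _ _ (hw i).2 _ ((h.mem_colorDer i).1 ζ z hz), smul_smul] at h1
  have e : (ε ζ ν : F) * ε (c i) (ν + ζ) * ε (ν - c i) (c i + ζ) = 1 := by
    rw [sub_eq_add_neg, h.skew.add_left, h.skew.add_right, h.skew.add_right, h.skew.add_right,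
      h.skew.neg_left, h.skew.neg_left, heven, inv_one, one_mul]
    have e1 := h.skew.mul_swap ζ ν
    have e2 := h.skew.mul_swap (c i) ν
    push_cast
    have e3 : (ε (c i) ζ : F) * (ε (c i) ζ : F)⁻¹ = 1 := mul_inv_cancel₀ (Units.ne_zero _)
    linear_combination (ε (c i) ν : F) * ε ν (c i) * (ε (c i) ζ * (ε (c i) ζ : F)⁻¹) * e1 +
      (ε (c i) ζ * (ε (c i) ζ : F)⁻¹) * e2 + e3
  rw [e, one_smul, ← two_smul F] at h1
  exact hne ((smul_eq_zero.1 h1).resolve_left h.two_ne_zero)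

/-- Let `|γ| ≥ 2`. An ideal of `W` which contains `A` and the operators of order at most `|γ| - 2`
contains `A d ^ (γ - e i)`. Only the coefficients in `𝒟(A)` are available for `d ^ γ`, but the
brackets of `𝒟(A) d ^ γ` with `A` still have enough leading coefficients: a tuple of constants
annihilating them would give a derivation `δ` which is excluded by `eq_zero_of_symm`. -/
theorem smul_monomial_sub_single_mem_of_isDerivedIdeal (h : IsWeylBasis D d c)
    (hex : ¬ IsExceptional D)
    (hU : D.IsDerivedIdeal U) (hA : ∀ a, Algebra.lmul F A a ∈ U) {γ : I →₀ ℕ}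
    (hγ : γ ∈ exponents ε c) (hγ2 : 2 ≤ γ.degree)
    (hlow : ∀ T ∈ filt ε d c (γ.degree - 1), T ∈ U) {i : I} (hi : γ i ≠ 0) (a : A) :
    a • monomial d (γ - Finsupp.single i 1) ∈ U := by
  obtain ⟨κ₀, hκ₀, hx⟩ := h.monomial_mul_lmul hγ
  set κ : I → F := fun j => (γ j : F) * κ₀ j with hκ
  have hκ0 : ∀ j, γ j ≠ 0 → κ j ≠ 0 := fun j hj =>
    mul_ne_zero (natCast_exponent_ne_zero hγ hj) (hκ₀ j hj).1
  set T : γ.support → Module.End F A := fun j => monomial d (γ - Finsupp.single (j : I) 1) with hT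
  rcases h.mem_or_exists_annihilator (ι := γ.support) (h.isAdStable_of_isDerivedIdeal hex hU)
    (T := T) (τ := fun j => colorDeg c (γ - Finsupp.single (j : I) 1))
    (fun j => h.monomial_mem_homEnd _)
    (fun k P hP j => h.der_mul_monomial ⟨mem_fullDer_of_mem hP, hP.2⟩ _) with hall | hann
  · exact hall ⟨i, Finsupp.mem_support_iff.2 hi⟩ a
  exfalso
  obtain ⟨μ, u, ⟨j₀, hj₀⟩, hu, hann⟩ := hann
  -- the brackets of `𝒟(A) d ^ γ` with `A`
  let V : Submodule F (γ.support → A) :=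
    { carrier := {v | ∑ j, v j • T j ∈ U}
      zero_mem' := by simp
      add_mem' := fun {v w} hv hw => by
        simpa only [Set.mem_ofPred_eq, Pi.add_apply, add_smul, Finset.sum_add_distrib] using
          add_mem hv hw
      smul_mem' := fun r v hv => by
        simpa only [Set.mem_ofPred_eq, Pi.smul_apply, smul_assoc, ← Finset.smul_sum] using
          Submodule.smul_mem _ r hv }
  have hV : ∀ k, ∀ P ∈ D.fullDer ⊓ colorDer ε 𝒜 k, ∀ ω, ∀ w ∈ 𝒜 ω, ∀ ξ, ∀ x ∈ 𝒜 ξ,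
      P w • leadingCoeff ε d c γ κ ξ x ∈ V := by
    intro k P hP ω w hw ξ x hxξ
    change ∑ j, (P w • leadingCoeff ε d c γ κ ξ x) j • T j ∈ U
    have h1 := hlow _ ((filt ε d c _).smul_mem (P w) (hx ξ x hxξ))
    rw [smul_sub] at h1
    have h2 : P w • colorBr ε (colorDeg c γ) ξ (monomial d γ) (Algebra.lmul F A x) ∈ U := by
      rw [← colorBr_smul_lmul h.skew h.comm (hP.2.1 ω w hw) hxξ]
      exact hU.bracket_mem _ _ _ (h.fullDerImage_smul_mem_derivedOps
        (h.monomial_mem_constantWeyl γ) (h.monomial_mem_homEnd γ) (apply_mem_fullDerImage hP.1 w))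
        (smul_mem_homEnd (hP.2.1 ω w hw) (h.monomial_mem_homEnd γ)) _ (hA x) (lmul_mem_homEnd hxξ)
    have h3 := (Submodule.sub_mem_iff_right U h2).1 h1
    rw [smul_comm, Submodule.smul_mem_iff U (Units.ne_zero _), Finset.smul_sum,
      ← Finset.sum_coe_sort γ.support] at h3
    convert h3 using 2 with j
    rw [smul_comm (P w), Pi.smul_apply, leadingCoeff, smul_eq_mul, mul_smul_comm, smul_assoc,
      smul_smul (P w)]
  set ν := μ + colorDeg c γ with hν
  have hdeg : ∀ j : γ.support, μ + colorDeg c (γ - Finsupp.single (j : I) 1) = ν - c j := by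
    intro j
    rw [hν, ← colorDeg_sub_single (c := c) (Finsupp.mem_support_iff.1 j.2)]
    abel
  set w : γ.support → A := fun j => (κ j * ε (c j)
    (μ + colorDeg c (γ - Finsupp.single (j : I) 1))) • u j with hw
  have hw0 : w = 0 := by
    refine h.eq_zero_of_symm (s := γ.support) (ν := ν) (w := w) (fun j => ⟨?_, ?_⟩)
      (fun i hi hodd => ?_) (fun i hi η a ha ζ z hz => ?_)
    · exact D.constants.smul_mem (hu j).1 _
    · rw [← hdeg j]
      exact Submodule.smul_mem _ _ (hu j).2
    · by_contra hall
      push Not at hall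
      have h1 : γ.degree = γ i := by
        rw [Finsupp.degree_apply, Finset.sum_eq_single i]
        · exact fun j hj hji => absurd (hall j hj) hji
        · exact fun h0 => absurd hi h0
      have := (hγ i).2 hodd
      omega
    · have h1 := hann (d i a • leadingCoeff ε d c γ κ ζ z +
        (ε η ζ : F) • d i z • leadingCoeff ε d c γ κ η a) ?_
      · have e1 := h.sum_leadingCoeff_mul (κ := κ) (fun j => (hu j).2) hz
        have e2 := h.sum_leadingCoeff_mul (κ := κ) (fun j => (hu j).2) ha
        simp only [Pi.add_apply, Pi.smul_apply, add_mul, Finset.sum_add_distrib, smul_mul_assoc,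
          smul_eq_mul, mul_assoc, ← Finset.smul_sum, ← Finset.mul_sum, leadingCoeff] at h1 e1 e2
        rw [e1, e2] at h1
        rw [← h1, mul_smul_comm, mul_smul_comm, smul_smul]
      · refine mem_coeffModule_of_homogeneous (𝒜 := 𝒜) fun ξ x hxξ => ?_
        exact h.leadingCoeff_symm_mem (V := V) (h.mem_colorDer i)
          (hV (c i) (d i) ⟨h.mem_fullDer i, h.mem_colorDer i⟩) hxξ ha hz
  have := congrFun hw0 j₀
  exact hj₀ ((smul_eq_zero.1 this).resolve_left (mul_ne_zero
    (hκ0 _ (Finsupp.mem_support_iff.1 j₀.2)) (Units.ne_zero _)))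

end IsWeylBasis
end TopTerm
end WeylColor

namespace WeylColor

section Conclusion

variable {Γ F A I : Type*} [AddCommGroup Γ] [DecidableEq Γ] [Field F] [Ring A] [Algebra F A]
  {ε : Γ → Γ → Fˣ} {𝒜 : Γ → Submodule F A} [GradedAlgebra 𝒜] {D : GradedDerSubspace ε 𝒜}

open GradedDerSubspace

/-! ### The ideals of `W` -/

namespace GradedDerSubspace

/-- The ideal generated by the values of the homogeneous elements of `D` is the unit ideal. -/
theorem IsWeylDatum.span_image_eq_top (h : D.IsWeylDatum) :
    Ideal.span {y | ∃ k, ∃ P ∈ D.carrier ⊓ colorDer ε 𝒜 k, ∃ b, ∃ x ∈ 𝒜 b, P x = y} = ⊤ := by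
  refine (h.ideal_eq _ (Ideal.homogeneous_span 𝒜 _ ?_) ?_).resolve_left fun hbot => ?_
  · rintro _ ⟨k, P, hP, b, x, hx, rfl⟩
    exact ⟨k + b, hP.2.1 b x hx⟩
  · exact fun k P hP b x hx _ => Ideal.subset_span ⟨k, P, hP, b, x, hx, rfl⟩
  · rw [Ideal.span_eq_bot] at hbot
    refine h.ne_bot (eq_bot_iff.2 fun P hP => ?_)
    have hP' := D.graded hP
    clear hP
    induction hP' using Submodule.iSup_induction' with
    | zero => exact zero_mem _
    | add S T _ _ hS hT => exact add_mem hS hT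
    | mem k P hP => exact end_ext (𝒜 := 𝒜) fun b x hx => hbot _ ⟨k, P, hP, b, x, hx, rfl⟩

/-- An ideal of `W` which contains `A` and `A 𝒟` contains `𝒟(A) T` for `T` in `F₁[D]`. -/
theorem IsWeylDatum.fullDerImage_smul_mem (h : D.IsWeylDatum) {U : Submodule F (Module.End F A)}
    (hU : D.IsDerivedIdeal U) (hA : ∀ a, Algebra.lmul F A a ∈ U)
    (hDer : ∀ P ∈ D.fullDer, ∀ a : A, a • P ∈ U) {t : Γ} {T : Module.End F A}
    (hT : T ∈ D.constantWeyl) (ht : T ∈ homEnd 𝒜 t) {y : A} (hy : y ∈ D.fullDerImage) :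
    y • T ∈ U := by
  have key : ∀ k, ∀ P ∈ D.fullDer ⊓ colorDer ε 𝒜 k, ∀ j, ∀ Q ∈ D.carrier ⊓ colorDer ε 𝒜 j,
      ∀ ω, ∀ w ∈ 𝒜 ω, ∀ β, ∀ b ∈ 𝒜 β, P (b * Q w) • T ∈ U := by
    intro k P hP j Q hQ ω w hw β b hb
    have hQw := hQ.2.1 ω w hw
    have hQD := IsWeylBasis.mem_fullDer_of_mem hQ
    have hyT := smul_mem_homEnd hQw ht
    -- `[P, b Q(w) T] = [P b, Q(w) T] ± [Q(w) T P, b]`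
    have h1 := colorBr_mul_right h.skew k β (j + ω + t) P (Algebra.lmul F A b) (Q w • T)
    rw [lmul_mul_eq_smul, smul_smul, ← add_assoc, colorBr_der_smul h.skew hP.2
      (h.constantWeyl_comm hP.1.2 hP.2.1 hT ht) (SetLike.GradedMul.mul_mem hb hQw)] at h1
    rw [h1]
    refine add_mem ?_ (Submodule.smul_mem _ _ ?_)
    · refine hU.bracket_mem' h.skew ?_ (mul_mem_homEnd hP.2.1 (lmul_mem_homEnd hb))
        (h.fullDerImage_smul_mem_derivedOps hT ht (apply_mem_fullDerImage hQD w)) hyT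
      rw [lmul_eq_smul_one, colorDer_mul_smul hP.2 hb, mul_one, ← lmul_eq_smul_one]
      exact add_mem (hA _) (Submodule.smul_mem _ _ (hDer P hP.1 b))
    · refine hU.bracket_mem _ _ _ ?_ (mul_mem_homEnd hyT hP.2.1) _ (hA b) (lmul_mem_homEnd hb)
      rw [smul_mul_end]
      exact h.fullDerImage_smul_mem_derivedOps (mul_mem hT hP.1.2) (mul_mem_homEnd ht hP.2.1)
        (apply_mem_fullDerImage hQD w)
  let J : Ideal A :=
    { carrier := {v | ∀ a, ∀ k, ∀ P ∈ D.fullDer ⊓ colorDer ε 𝒜 k, P (a * v) • T ∈ U}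
      zero_mem' := fun a k P _ => by rw [mul_zero, map_zero, zero_smul]; exact zero_mem _
      add_mem' := fun hv hw a k P hP => by
        rw [mul_add, map_add, add_smul]
        exact add_mem (hv a k P hP) (hw a k P hP)
      smul_mem' := fun b v hv a k P hP => by
        rw [smul_eq_mul, ← mul_assoc]
        exact hv (a * b) k P hP }
  have hJ : (1 : A) ∈ J := by
    have h1 : (1 : A) ∈ Ideal.span {y | ∃ k, ∃ P ∈ D.carrier ⊓ colorDer ε 𝒜 k, ∃ b, ∃ x ∈ 𝒜 b,
        P x = y} := by
      rw [h.span_image_eq_top]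
      trivial
    refine Ideal.span_le.2 ?_ h1
    rintro _ ⟨j, Q, hQ, ω, w, hw, rfl⟩ a k P hP
    induction a using DirectSum.Decomposition.inductionOn 𝒜 with
    | zero => rw [zero_mul, map_zero, zero_smul]; exact zero_mem _
    | add a a' ha ha' => rw [add_mul, map_add, add_smul]; exact add_mem ha ha'
    | @homogeneous β b => exact key k P hP j Q hQ ω w hw β b b.2
  have hle : D.fullDerImage ≤ U.comap
      ((LinearMap.mul F (Module.End F A)).flip T ∘ₗ (Algebra.lmul F A).toLinearMap) := by
    refine fullDerImage_le fun k P hP b x _ => ?_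
    have := hJ x k P hP
    rwa [mul_one] at this
  exact hle hy

end GradedDerSubspace

namespace IsWeylBasis

variable [LinearOrder I] {d : I → Module.End F A} {c : I → Γ} {U : Submodule F (Module.End F A)}

/-- Outside the exceptional case, an ideal of `W` which does not consist of constants is `W`. -/
theorem eq_derivedOps (h : IsWeylBasis D d c) (hex : ¬ IsExceptional D)
    (hU : D.IsDerivedIdeal U) (hne : ∃ T ∈ U, ∀ u ∈ D.constants, T ≠ Algebra.lmul F A u) :
    U = D.derivedOps := by
  refine le_antisymm hU.le ?_
  have hA := h.lmul_mem hex hU (h.exists_lmul_mem hex hU hne)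
  by_cases hfin : (exponents ε c).Finite
  · obtain ⟨γ, hγ, hmax⟩ := Set.exists_max_image (exponents ε c) Finsupp.degree hfin
      ⟨0, zero_mem_exponents⟩
    have hγ2 : 2 ≤ γ.degree := by
      obtain ⟨i⟩ := h.nonempty
      obtain ⟨j, hj⟩ := h.exists_single_add_single_mem hex i
      have := hmax _ hj
      rwa [degree_add_single, Finsupp.degree_single] at this
    -- the multi-indices which are not of the two highest orders can be raised twice
    have hlow : ∀ T ∈ filt ε d c (γ.degree - 1), T ∈ U := fun T hT => by
      refine filt_subset (fun α hα hdeg a => ?_) hT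
      obtain ⟨i, hi⟩ := exists_add_single_mem_of_ne hα hγ hmax (by rintro rfl; omega)
      obtain ⟨j, hj⟩ := exists_add_single_mem_of_ne hi hγ hmax (by
        intro heq
        have := congrArg Finsupp.degree heq
        rw [degree_add_single] at this
        omega)
      exact h.smul_monomial_mem hex hU hA hj a
    have hne : ∀ α ∈ exponents ε c, α ≠ γ → ∀ a : A, a • monomial d α ∈ U := by
      intro α hα hne a
      obtain ⟨i, hi⟩ := exists_add_single_mem_of_ne hα hγ hmax hne
      by_cases heq : α + Finsupp.single i 1 = γ
      · have := h.smul_monomial_sub_single_mem_of_isDerivedIdeal hex hU hA hγ hγ2 hlow (i := i)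
          (by rw [← heq]; simp) a
        rwa [← heq, add_tsub_cancel_right] at this
      · obtain ⟨j, hj⟩ := exists_add_single_mem_of_ne hi hγ hmax heq
        exact h.smul_monomial_mem hex hU hA hj a
    have hDer : ∀ P ∈ D.fullDer, ∀ a : A, a • P ∈ U := fun P hP a => by
      refine h.smul_fullDer_mem (fun i a => ?_) hP a
      rw [← monomial_single d i]
      refine hne _ (single_mem_exponents h.char_ne_two i) ?_ a
      rintro rfl
      rw [Finsupp.degree_single] at hγ2
      omega
    rw [h.derivedOps_eq_iSup hγ hmax]
    refine iSup_le fun α => ?_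
    rw [GradedDerSubspace.summand]
    split_ifs with hαγ
    · rintro _ ⟨a, ha, rfl⟩
      exact h.fullDerImage_smul_mem hU hA hDer (h.monomial_mem_constantWeyl α)
        (h.monomial_mem_homEnd α) ha
    · rintro _ ⟨a, -, rfl⟩
      exact hne α α.2 hαγ a
  · intro T hT
    obtain ⟨n, hn⟩ := h.exists_mem_filt (D.derivedOps_le_weyl hT)
    refine filt_subset (fun α hα _ a => ?_) hn
    obtain ⟨i, hi⟩ := exists_add_single_mem_of_infinite hfin hα
    obtain ⟨j, hj⟩ := exists_add_single_mem_of_infinite hfin hi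
    exact h.smul_monomial_mem hex hU hA hj a

/-- Outside the exceptional case, some bracket of homogeneous elements of `W` is not constant. -/
theorem exists_colorBr_not_constant (h : IsWeylBasis D d c) (hex : ¬ IsExceptional D) :
    ∃ j k, ∃ S ∈ D.derivedOps, S ∈ homEnd 𝒜 j ∧ ∃ T ∈ D.derivedOps, T ∈ homEnd 𝒜 k ∧
      ∀ u ∈ D.constants, colorBr ε j k S T ≠ Algebra.lmul F A u := by
  obtain ⟨i⟩ := h.nonempty
  -- `d i` kills the constants, so that `A` does not consist of constants
  obtain ⟨r, a, ha, hac⟩ : ∃ r, ∃ a ∈ 𝒜 r, a ∉ D.constants := by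
    by_contra hall
    push Not at hall
    exact h.der_ne_zero i (end_ext (𝒜 := 𝒜) fun b x hx => h.apply_constant i (hall b x hx))
  obtain ⟨b, x, hx, hx0⟩ : ∃ b, ∃ x ∈ 𝒜 b, d i x ≠ 0 := by
    by_contra hall
    push Not at hall
    exact h.der_ne_zero i (end_ext (𝒜 := 𝒜) hall)
  have hbr : ∀ s, ∀ v ∈ 𝒜 s, colorBr ε (s + c i) b (v • d i) (Algebra.lmul F A x) =
      Algebra.lmul F A (v * d i x) := fun s v hv => by
    rw [colorBr_smul_lmul h.skew h.comm hv hx, colorBr_der_lmul h.skew (h.mem_colorDer i) hx,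
      ← lmul_mul_eq_smul, ← map_mul]
  have hfin : ∀ s, ∀ v ∈ 𝒜 s, v * d i x ∉ D.constants →
      ∃ j k, ∃ S ∈ D.derivedOps, S ∈ homEnd 𝒜 j ∧ ∃ T ∈ D.derivedOps, T ∈ homEnd 𝒜 k ∧
        ∀ u ∈ D.constants, colorBr ε j k S T ≠ Algebra.lmul F A u := by
    intro s v hv hvc
    refine ⟨s + c i, b, v • d i, h.smul_fullDer_mem_derivedOps hex (h.mem_fullDer i) v,
      smul_mem_homEnd hv (h.mem_colorDer i).1, _, h.lmul_mem_derivedOps x, lmul_mem_homEnd hx,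
      fun u hu heq => hvc ?_⟩
    rw [hbr s v hv] at heq
    have := LinearMap.congr_fun heq 1
    simp only [Algebra.coe_lmul_eq_mul, LinearMap.mul_apply', mul_one] at this
    rwa [this]
  by_cases hc : d i x ∈ D.constants
  · refine hfin r a ha fun hmem => hac ?_
    obtain ⟨v, -, hvc, -, hv⟩ := h.exists_inv ((h.mem_colorDer i).1 b x hx) hc hx0
    have := mul_mem hmem hvc
    rwa [mul_assoc, hv, mul_one] at this
  · exact hfin 0 1 SetLike.GradedOne.one_mem (by rwa [one_mul])

end IsWeylBasis
end Conclusion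
end WeylColor

namespace WeylColor

section LieQuotient

variable {Γ F A I : Type*} [AddCommGroup Γ] [DecidableEq Γ] [Field F] [Ring A] [Algebra F A]
  {ε : Γ → Γ → Fˣ} {𝒜 : Γ → Submodule F A} [GradedAlgebra 𝒜] {D : GradedDerSubspace ε 𝒜}

/-! ### The Lie color algebra `W / F₁` -/

namespace GradedDerSubspace

theorem toEnd_mem_derivedOps {x : D.Weyl} : D.toEnd x ∈ D.derivedOps ↔ x ∈ D.derived := by
  refine ⟨fun hx => ?_, fun hx => Submodule.mem_map.2 ⟨x, hx, rfl⟩⟩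
  obtain ⟨y, hy, hyx⟩ := Submodule.mem_map.1 hx
  rwa [← D.toEnd_injective hyx]

theorem mem_constantOps {x : D.Weyl} :
    x ∈ D.constantOps ↔ ∃ u ∈ D.constants, D.toEnd x = Algebra.lmul F A u := by
  constructor
  · rintro ⟨u, hu, rfl⟩
    exact ⟨u, hu, rfl⟩
  · rintro ⟨u, hu, hx⟩
    exact ⟨u, hu, D.toEnd_injective hx.symm⟩

/-- The class of an element of `W` in `W / F₁`. -/
noncomputable def lieMk (D : GradedDerSubspace ε 𝒜) (x : D.Weyl) (hx : x ∈ D.derived) :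
    D.LieQuotient :=
  (D.constantOps.submoduleOf D.derived).mkQ ⟨x, hx⟩

theorem exists_lieMk (q : D.LieQuotient) : ∃ x hx, q = D.lieMk x hx := by
  obtain ⟨⟨x, hx⟩, rfl⟩ := Submodule.mkQ_surjective _ q
  exact ⟨x, hx, rfl⟩

theorem lieMk_eq_iff {x y : D.Weyl} (hx : x ∈ D.derived) (hy : y ∈ D.derived) :
    D.lieMk x hx = D.lieMk y hy ↔ x - y ∈ D.constantOps :=
  Submodule.Quotient.eq _

theorem lieMk_eq_zero {x : D.Weyl} (hx : x ∈ D.derived) :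
    D.lieMk x hx = 0 ↔ x ∈ D.constantOps :=
  Submodule.Quotient.mk_eq_zero _

theorem mem_lieQuotientGrading {k : Γ} {q : D.LieQuotient} :
    q ∈ D.lieQuotientGrading k ↔ ∃ x hx, x ∈ D.weylGrading k ∧ q = D.lieMk x hx := by
  constructor
  · rintro ⟨⟨x, hx⟩, hxk, rfl⟩
    exact ⟨x, hx, hxk, rfl⟩
  · rintro ⟨x, hx, hxk, rfl⟩
    exact ⟨⟨x, hx⟩, hxk, rfl⟩

theorem lieQuotientBracket_lieMk (hε : IsSkewBicharacter ε) (hA : IsColorCommutative ε 𝒜)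
    {x y : D.Weyl} (hx : x ∈ D.derived) (hy : y ∈ D.derived) :
    D.lieQuotientBracket hε hA (D.lieMk x hx) (D.lieMk y hy) =
      D.lieMk (D.bracket x y) (D.bracket_mem_derived x y) :=
  rfl

theorem bracket_of_mem {j k : Γ} {x y : D.Weyl} (hx : x ∈ D.weylGrading j)
    (hy : y ∈ D.weylGrading k) : D.bracket x y = x * y - (ε j k : F) • (y * x) :=
  colorCommutator_of_mem ε _ hx hy

theorem bracket_mem_weylGrading {j k : Γ} {x y : D.Weyl} (hx : x ∈ D.weylGrading j)
    (hy : y ∈ D.weylGrading k) : D.bracket x y ∈ D.weylGrading (j + k) := by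
  change D.toEnd (D.bracket x y) ∈ homEnd 𝒜 (j + k)
  rw [toEnd_bracket hx hy]
  exact colorBr_mem_homEnd hx hy

theorem derived_graded (D : GradedDerSubspace ε 𝒜) : IsGradedSubspace D.weylGrading D.derived := by
  refine Submodule.span_le.2 ?_
  rintro _ ⟨x, y, rfl⟩
  change D.bracket x y ∈ ⨆ a, D.derived ⊓ D.weylGrading a
  induction x using DirectSum.Decomposition.inductionOn D.weylGrading with
  | zero => simp
  | add x x' hx hx' => rw [map_add, LinearMap.add_apply]; exact add_mem hx hx'
  | @homogeneous j x =>
    induction y using DirectSum.Decomposition.inductionOn D.weylGrading with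
    | zero => simp
    | add y y' hy hy' => rw [map_add]; exact add_mem hy hy'
    | @homogeneous k y =>
      exact Submodule.mem_iSup_of_mem (j + k)
        ⟨D.bracket_mem_derived _ _, bracket_mem_weylGrading x.2 y.2⟩

theorem iSup_lieQuotientGrading (D : GradedDerSubspace ε 𝒜) : ⨆ k, D.lieQuotientGrading k = ⊤ := by
  rw [eq_top_iff]
  rintro q -
  obtain ⟨x, hx, rfl⟩ := exists_lieMk q
  have hx' := D.derived_graded hx
  have hle : ⨆ a, D.derived ⊓ D.weylGrading a ≤ D.derived := iSup_le fun a => inf_le_left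
  induction hx' using Submodule.iSup_induction' with
  | zero => exact zero_mem _
  | add x y hx' hy' hx₁ hy₁ => exact add_mem (hx₁ (hle hx')) (hy₁ (hle hy'))
  | mem k x hxk =>
    exact Submodule.mem_iSup_of_mem k (mem_lieQuotientGrading.2 ⟨x, hx, hxk.2, rfl⟩)

theorem isInternal_lieQuotientGrading (D : GradedDerSubspace ε 𝒜) :
    DirectSum.IsInternal D.lieQuotientGrading := by
  classical
  refine DirectSum.isInternal_submodule_of_iSupIndep_of_iSup_eq_top ?_ D.iSup_lieQuotientGrading
  rw [iSupIndep_iff_finsetSum_eq_zero_imp_eq_zero]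
  intro s v hv h0 i hi
  have hex : ∀ j : s, ∃ x hx, x ∈ D.weylGrading j ∧ v j = D.lieMk x hx :=
    fun j => mem_lieQuotientGrading.1 (hv j j.2)
  choose x hx hxj hvx using hex
  have hsum : D.lieMk (∑ j, x j) (sum_mem fun j _ => hx j) = 0 := by
    rw [← h0, ← Finset.sum_coe_sort s, Finset.sum_congr rfl fun j _ => hvx j]
    simp only [lieMk, ← map_sum]
    congr 1
    exact Subtype.ext (by simp)
  obtain ⟨u, hu, hxu⟩ := mem_constantOps.1 ((lieMk_eq_zero _).1 hsum)
  rw [hvx ⟨i, hi⟩, lieMk_eq_zero, mem_constantOps]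
  refine ⟨_, decompose_mem_constants hu (i - 0), ?_⟩
  rw [map_sum, lmul_eq_smul_one] at hxu
  have h1 := congrArg (opProj 𝒜 i) hxu
  rw [opProj_smul' one_mem_homEnd, map_sum, Finset.sum_eq_single ⟨i, hi⟩] at h1
  · rw [lmul_eq_smul_one, ← h1]
    exact (opProj_same (hxj ⟨i, hi⟩)).symm
  · exact fun j _ hji => opProj_ne (fun h => hji (Subtype.ext h)) (hxj j)
  · exact fun h => absurd (Finset.mem_univ _) h

theorem bracket_skew (hε : IsSkewBicharacter ε) {a b : Γ} {x y : D.Weyl}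
    (hx : x ∈ D.weylGrading a) (hy : y ∈ D.weylGrading b) :
    D.bracket x y = -((ε a b : F) • D.bracket y x) := by
  rw [bracket_of_mem hx hy, bracket_of_mem hy hx, smul_sub, smul_smul, hε.mul_swap, one_smul,
    neg_sub]

theorem bracket_jacobi (hε : IsSkewBicharacter ε) {a b c : Γ} {x y z : D.Weyl}
    (hx : x ∈ D.weylGrading a) (hy : y ∈ D.weylGrading b) (hz : z ∈ D.weylGrading c) :
    D.bracket x (D.bracket y z) =
      D.bracket (D.bracket x y) z + (ε a b : F) • D.bracket y (D.bracket x z) := by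
  rw [bracket_of_mem hx (bracket_mem_weylGrading hy hz), bracket_of_mem hy hz,
    bracket_of_mem (bracket_mem_weylGrading hx hy) hz, bracket_of_mem hx hy,
    bracket_of_mem hy (bracket_mem_weylGrading hx hz), bracket_of_mem hx hz,
    hε.add_right, hε.add_right, hε.add_left]
  simp only [mul_sub, sub_mul, smul_mul_assoc, mul_smul_comm, mul_assoc, Units.val_mul]
  have e := hε.mul_swap a b
  linear_combination (norm := module) (ε b c : F) • e • (x * (z * y)) -
    ((ε b c : F) * ε a c) • e • (z * (x * y))

theorem isLieColorAlgebra (D : GradedDerSubspace ε 𝒜) (hε : IsSkewBicharacter ε)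
    (hA : IsColorCommutative ε 𝒜) :
    IsLieColorAlgebra ε D.lieQuotientGrading (D.lieQuotientBracket hε hA) where
  internal := D.isInternal_lieQuotientGrading
  bracket_mem a b p hp q hq := by
    obtain ⟨x, hx, hxa, rfl⟩ := mem_lieQuotientGrading.1 hp
    obtain ⟨y, hy, hyb, rfl⟩ := mem_lieQuotientGrading.1 hq
    rw [lieQuotientBracket_lieMk]
    exact mem_lieQuotientGrading.2 ⟨_, _, bracket_mem_weylGrading hxa hyb, rfl⟩
  skew a b p hp q hq := by
    obtain ⟨x, hx, hxa, rfl⟩ := mem_lieQuotientGrading.1 hp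
    obtain ⟨y, hy, hyb, rfl⟩ := mem_lieQuotientGrading.1 hq
    exact congrArg (D.constantOps.submoduleOf D.derived).mkQ
      (Subtype.ext (bracket_skew hε hxa hyb) :
        (⟨_, D.bracket_mem_derived x y⟩ : D.derived) =
          -((ε a b : F) • ⟨_, D.bracket_mem_derived y x⟩))
  jacobi a b c p hp q hq r hr := by
    obtain ⟨x, hx, hxa, rfl⟩ := mem_lieQuotientGrading.1 hp
    obtain ⟨y, hy, hyb, rfl⟩ := mem_lieQuotientGrading.1 hq
    obtain ⟨z, hz, hzc, rfl⟩ := mem_lieQuotientGrading.1 hr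
    exact congrArg (D.constantOps.submoduleOf D.derived).mkQ
      (Subtype.ext (bracket_jacobi hε hxa hyb hzc) :
        (⟨_, D.bracket_mem_derived x (D.bracket y z)⟩ : D.derived) =
          ⟨_, D.bracket_mem_derived (D.bracket x y) z⟩ +
            (ε a b : F) • ⟨_, D.bracket_mem_derived y (D.bracket x z)⟩)

theorem lmul_mem_iSup_of_constants {U : Submodule F (Module.End F A)}
    (hU : ∀ u ∈ D.constants, Algebra.lmul F A u ∈ U) {u : A} (hu : u ∈ D.constants) :
    Algebra.lmul F A u ∈ ⨆ a, U ⊓ homEnd 𝒜 a := by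
  classical
  rw [← DirectSum.sum_support_decompose 𝒜 u, map_sum]
  exact sum_mem fun b _ => Submodule.mem_iSup_of_mem b
    ⟨hU _ (decompose_mem_constants hu b), lmul_mem_homEnd (SetLike.coe_mem _)⟩

/-- The preimage in `W` of an ideal of `W / F₁` is an ideal of `W`. -/
theorem exists_isDerivedIdeal (hε : IsSkewBicharacter ε) (hA : IsColorCommutative ε 𝒜)
    (hle : D.constantOps ≤ D.derived) {K : Submodule F D.LieQuotient}
    (hK : IsColorIdeal D.lieQuotientGrading (D.lieQuotientBracket hε hA) K) :
    ∃ U : Submodule F (Module.End F A), D.IsDerivedIdeal U ∧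
      ∀ T, T ∈ U ↔ ∃ x hx, D.lieMk x hx ∈ K ∧ D.toEnd x = T := by
  let U : Submodule F (Module.End F A) :=
    ((K.comap (D.constantOps.submoduleOf D.derived).mkQ).map D.derived.subtype).map
      D.toEnd.toLinearMap
  have hU : ∀ T, T ∈ U ↔ ∃ x hx, D.lieMk x hx ∈ K ∧ D.toEnd x = T := by
    intro T
    constructor
    · rintro ⟨_, ⟨⟨x, hx⟩, hxK, rfl⟩, rfl⟩
      exact ⟨x, hx, hxK, rfl⟩
    · rintro ⟨x, hx, hxK, rfl⟩
      exact ⟨x, ⟨⟨x, hx⟩, hxK, rfl⟩, rfl⟩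
  have hconst : ∀ u ∈ D.constants, Algebra.lmul F A u ∈ U := fun u hu => by
    have hmem : D.ofA u ∈ D.constantOps := ⟨u, hu, rfl⟩
    refine (hU _).2 ⟨D.ofA u, hle hmem, ?_, rfl⟩
    rw [(lieMk_eq_zero _).2 hmem]
    exact zero_mem _
  refine ⟨U, ⟨?_, ?_, ?_⟩, hU⟩
  · intro T hT
    obtain ⟨x, hx, -, rfl⟩ := (hU T).1 hT
    exact toEnd_mem_derivedOps.2 hx
  · intro T hT
    obtain ⟨x, hx, hxK, rfl⟩ := (hU T).1 hT
    have key : ∀ q ∈ ⨆ a, K ⊓ D.lieQuotientGrading a, ∀ x hx, q = D.lieMk x hx →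
        D.toEnd x ∈ ⨆ a, U ⊓ homEnd 𝒜 a := by
      intro q hq
      induction hq using Submodule.iSup_induction' with
      | zero =>
        intro x hx h0
        obtain ⟨u, hu, hxu⟩ := mem_constantOps.1 ((lieMk_eq_zero hx).1 h0.symm)
        rw [hxu]
        exact lmul_mem_iSup_of_constants hconst hu
      | add p q _ _ hp hq =>
        intro x hx hpq
        obtain ⟨y, hy, rfl⟩ := exists_lieMk p
        have h1 := hq (x - y) (sub_mem hx hy) (eq_sub_of_add_eq' hpq)
        have h2 := hp y hy rfl
        rw [map_sub] at h1
        have := add_mem h1 h2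
        rwa [sub_add_cancel] at this
      | mem a q hq =>
        intro x hx hqx
        obtain ⟨y, hy, hya, hqy⟩ := mem_lieQuotientGrading.1 hq.2
        obtain ⟨u, hu, hxu⟩ := mem_constantOps.1 ((lieMk_eq_iff hx hy).1 (hqx.symm.trans hqy))
        rw [map_sub, sub_eq_iff_eq_add] at hxu
        rw [hxu]
        refine add_mem (lmul_mem_iSup_of_constants hconst hu) (Submodule.mem_iSup_of_mem a
          ⟨(hU _).2 ⟨y, hy, ?_, rfl⟩, hya⟩)
        rw [← hqy]
        exact hq.1
    exact key _ (hK.1 hxK) x hx rfl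
  · intro j k S hS hSj T hT hTk
    obtain ⟨s, hs, rfl⟩ := Submodule.mem_map.1 hS
    obtain ⟨t, ht, htK, rfl⟩ := (hU T).1 hT
    exact (hU _).2 ⟨D.bracket s t, D.bracket_mem_derived s t, hK.2 (D.lieMk s hs) _ htK,
      toEnd_bracket hSj hTk⟩

/-- In the exceptional case `W / F₁` is abelian. -/
theorem IsWeylDatum.lieQuotientBracket_eq_zero (h : D.IsWeylDatum) (hex : IsExceptional D)
    (p q : D.LieQuotient) : D.lieQuotientBracket h.skew h.comm p q = 0 := by
  have hp : p ∈ ⨆ k, D.lieQuotientGrading k := by rw [iSup_lieQuotientGrading]; trivial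
  have hq : q ∈ ⨆ k, D.lieQuotientGrading k := by rw [iSup_lieQuotientGrading]; trivial
  induction hp using Submodule.iSup_induction' with
  | zero => rw [map_zero, LinearMap.zero_apply]
  | add p p' _ _ hp hp' => rw [map_add, LinearMap.add_apply, hp, hp', add_zero]
  | mem j p hp =>
    induction hq using Submodule.iSup_induction' with
    | zero => rw [map_zero]
    | add q q' _ _ hq hq' => rw [map_add, hq, hq', add_zero]
    | mem k q hq =>
      obtain ⟨x, hx, hxj, rfl⟩ := mem_lieQuotientGrading.1 hp
      obtain ⟨y, hy, hyk, rfl⟩ := mem_lieQuotientGrading.1 hq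
      rw [lieQuotientBracket_lieMk, lieMk_eq_zero, mem_constantOps, toEnd_bracket hxj hyk]
      exact h.colorBr_of_isExceptional hex (toEnd_mem_derivedOps.2 hx) hxj
        (toEnd_mem_derivedOps.2 hy) hyk

end GradedDerSubspace

open GradedDerSubspace

namespace IsWeylBasis

variable [LinearOrder I] {d : I → Module.End F A} {c : I → Γ}

theorem constantOps_le_derived (h : IsWeylBasis D d c) : D.constantOps ≤ D.derived := by
  intro x hx
  obtain ⟨u, -, hxu⟩ := mem_constantOps.1 hx
  rw [← toEnd_mem_derivedOps, hxu]
  exact h.lmul_mem_derivedOps u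

/-- `W / F₁` is simple except in the exceptional case, where it is abelian. -/
theorem isSimple_iff (h : IsWeylBasis D d c) :
    IsSimpleLieColorAlgebra ε D.lieQuotientGrading (D.lieQuotientBracket h.skew h.comm) ↔
      ¬ IsExceptional D := by
  refine ⟨fun hs hex => ?_, fun hex =>
    ⟨D.isLieColorAlgebra h.skew h.comm, ?_, fun K hK => ?_⟩⟩
  · obtain ⟨p, q, hpq⟩ := hs.nonabelian
    exact hpq (h.lieQuotientBracket_eq_zero hex p q)
  · obtain ⟨j, k, S, hS, hSj, T, hT, hTk, hne⟩ := h.exists_colorBr_not_constant hex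
    obtain ⟨s, hs, rfl⟩ := Submodule.mem_map.1 hS
    obtain ⟨t, ht, rfl⟩ := Submodule.mem_map.1 hT
    refine ⟨D.lieMk s hs, D.lieMk t ht, fun h0 => ?_⟩
    rw [lieQuotientBracket_lieMk, lieMk_eq_zero, mem_constantOps] at h0
    obtain ⟨u, hu, hst⟩ := h0
    exact hne u hu ((toEnd_bracket hSj hTk).symm.trans hst)
  · obtain ⟨U, hU, hUK⟩ := exists_isDerivedIdeal h.skew h.comm h.constantOps_le_derived hK
    by_cases hne : ∃ T ∈ U, ∀ u ∈ D.constants, T ≠ Algebra.lmul F A u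
    · right
      rw [eq_top_iff]
      rintro q -
      obtain ⟨x, hx, rfl⟩ := exists_lieMk q
      have hxU := toEnd_mem_derivedOps.2 hx
      rw [← h.eq_derivedOps hex hU hne, hUK] at hxU
      obtain ⟨y, hy, hyK, hyx⟩ := hxU
      obtain rfl := D.toEnd_injective hyx
      exact hyK
    · left
      push Not at hne
      rw [eq_bot_iff]
      intro q hq
      obtain ⟨x, hx, rfl⟩ := exists_lieMk q
      exact (lieMk_eq_zero hx).2 (mem_constantOps.2 (hne _ ((hUK _).2 ⟨x, hx, hq, rfl⟩)))

end IsWeylBasis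
end LieQuotient
end WeylColor

open WeylColor in
theorem theorem3p9 {Γ : Type*} {F : Type*} {A : Type*} [AddCommGroup Γ] [DecidableEq Γ]
    [Field F] [Ring A] [Algebra F A] (hF : ringChar F ≠ 2)
    (ε : Γ → Γ → Fˣ) (hε : IsSkewBicharacter ε)
    (𝒜 : Γ → Submodule F A) [GradedAlgebra 𝒜] (hA : IsColorCommutative ε 𝒜)
    (D : GradedDerSubspace ε 𝒜) (hD : D.IsColorCommuting) (hD0 : D.carrier ≠ ⊥)
    (hsimple : D.IsGradedSimple) :
    (∀ (I : Type*) [LinearOrder I] (d : I → Module.End F A) (c : I → Γ),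
      D.IsHomogeneousBasis d c →
      ((exponents ε c).Infinite → D.derived = ⊤) ∧
      ((exponents ε c).Finite → ∀ γ ∈ exponents ε c,
        (∀ α ∈ exponents ε c, α.degree ≤ γ.degree) →
        iSupIndep (fun α : exponents ε c => D.summand d γ α) ∧
        D.derived.map D.toEnd.toLinearMap = ⨆ α : exponents ε c, D.summand d γ α)) ∧
    (D.constantOps ≤ D.derived ∧
      IsLieColorAlgebra ε D.lieQuotientGrading (D.lieQuotientBracket hε hA) ∧
      (IsSimpleLieColorAlgebra ε D.lieQuotientGrading (D.lieQuotientBracket hε hA) ↔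
        ¬ IsExceptional D)) := by
  have h : D.IsWeylDatum := ⟨hF, hε, hA, hD, hD0, hsimple⟩
  refine ⟨fun I _ d c hb => ?_, ?_⟩
  · have hB : IsWeylBasis D d c := ⟨h, hb⟩
    exact ⟨hB.derived_eq_top, fun _ γ hγ hmax =>
      ⟨hB.iSupIndep_summand γ, hB.derivedOps_eq_iSup hγ hmax⟩⟩
  · -- these assertions do not involve a basis: choose one, and any total order on it
    obtain ⟨s, c, hb⟩ := h.exists_basis
    classical
    let _ : LinearOrder s := linearOrderOfSTO WellOrderingRel
    have hB : IsWeylBasis D (fun T : s => (T.1.1 : Module.End F A)) c := ⟨h, hb⟩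
    exact ⟨hB.constantOps_le_derived, D.isLieColorAlgebra hε hA, hB.isSimple_iff⟩
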